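/- **Setting.** All functions live on $\mathbb R^2$ with polar coordinates $(r,\theta)$; $B_s$ is the open disk of radius $s$ centred at $0$. Let $L\ge 1$ and $N\ge 0$ be integers, let $2=r_1>r_2>\dots>r_{L+1}=1$, let $\sigma_0=1$, $\sigma_1,\dots,\sigma_L>0$ and $\sigma_{L+1}=0$, and let $$\sigma=\sum_{j=0}^{L+1}\sigma_j\chi(A_j),\qquad A_0=\{r>r_1\},\quad A_j=\{r_{j+1}<r\le r_j\}\ (1\le j\le L),\quad A_{L+1}=\{r\le r_{L+1}\},$$ so that $\sigma$ is a disk of radius $2$ with $L$ coatings around an insulated core of radius $1$ (in particular one may take $L=N\ge1$). For a harmonic polynomial $H$ let $u$ be the weak ($H^1_{\rm loc}$ up to the boundary of the core) solution of $\nabla\cdot\sigma\nabla u=0$ outside the core, with $\partial u/\partial\nu=0$ on the boundary of the core and $u-H=O(|x|^{-1})$ as $|x|\to\infty$. The contracted generalized polarization tensors $M^{cc}_{mn},M^{cs}_{mn},M^{sc}_{mn},M^{ss}_{mn}$ $(m,n\ge1)$ of $\sigma$ are the coefficients in the expansions, for $|x|>2$, $$(u-H)(x)=-\sum_{m\ge1}\frac{\cos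 m\theta}{2\pi m r^m}M^{cc}_{mn}-\sum_{m\ge1}\frac{\sin m\theta}{2\pi m r^m}M^{sc}_{mn}\quad\text{if }H=r^n\cos n\theta,$$ $$(u-H)(x)=-\sum_{m\ge1}\frac{\cos m\theta}{2\pi m r^m}M^{cs}_{mn}-\sum_{m\ge1}\frac{\sin m\theta}{2\pi m r^m}M^{ss}_{mn}\quad\text{if }H=r^n\sin n\theta.$$ Assume that $\sigma$ is a GPT-vanishing structure of order $N$: $M^{cc}_{mn}=M^{cs}_{mn}=M^{sc}_{mn}=M^{ss}_{mn}=0$ for all $1\le m,n\le N$. For $0<\rho<1$ put $\Psi_{1/\rho}(x)=x/\rho$, let $F_\rho:B_2\to B_2$ be $$F_\rho(x)=\begin{cases}x,&\frac32\le|x|\le2,\\ \Bigl(\frac{3-3\rho}{3-2\rho}+\frac{1}{3-2\rho}|x|\Bigr)\frac{x}{|x|},&\rho\le|x|\le\frac32,\\ x/\rho,&|x|\le\rho,\end{cases}$$ and let $$(F_\rho)_*(\sigma\circ\Psi_{1/\rho})=\frac{(DF_\rho)\,(\sigma\circ\Psi_{1/\rho})\,(DF_\rho)^T}{|\det DF_\rho|}\circ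 F_\rho^{-1},$$ a matrix-valued conductivity. For a conductivity $A$ and $K=\overline{B_1}$ or $K=\emptyset$, the Dirichlet-to-Neumann map $\Lambda_{B_2,K}[A]:H^{1/2}(\partial B_2)\to H^{-1/2}(\partial B_2)$ sends $f$ to $A\nabla u\cdot\nu|_{\partial B_2}$, where $u\in H^1(B_2\setminus K)$ is the weak solution of $\nabla\cdot A\nabla u=0$ in $B_2\setminus K$, $A\nabla u\cdot\nu=0$ on $\partial K$, $u=f$ on $\partial B_2$. **Theorem.** There is a constant $C$, independent of $\rho$, such that for all $0<\rho<1$ the maps $\Lambda_{B_2,\overline{B_1}}\bigl[(F_\rho)_*(\sigma\circ\Psi_{1/\rho})\bigr]$ and $\Lambda_{B_2,\emptyset}[1]$ exist as bounded operators from $H^{1/2}(\partial B_2)$ to $H^{-1/2}(\partial B_2)$ and $$\Bigl\|\Lambda_{B_2,\overline{B_1}}\bigl[(F_\rho)_*(\sigma\circ\Psi_{1/\rho})\bigr]-\Lambda_{B_2,\emptyset}[1]\Bigr\|\le C\rho^{2N+2}$$ in the operator norm from $H^{1/2}(\partial B_2)$ to its dual $H^{-1/2}(\partial B_2)$. -/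

import Mathlib

open Set MeasureTheory
open scoped Real ENNReal ContDiff Matrix

namespace NearCloaking

noncomputable section

/-! ### The plane, polar coordinates, test functions -/

/-- The Euclidean plane. -/
abbrev Plane : Type := EuclideanSpace ℝ (Fin 2)

/-- The polar angle `θ` of `x = (r cos θ, r sin θ)`; the radius is `‖x‖`. -/
def angle (x : Plane) : ℝ := Complex.arg ⟨x 0, x 1⟩

/-- Test functions: smooth real functions with compact support in the plane. -/
structure IsTest (φ : Plane → ℝ) : Prop where
  smooth : ContDiff ℝ ∞ φ
  compact : HasCompactSupport φ

/-- The partial derivative `∂ᵢ φ`. -/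
def pd (i : Fin 2) (φ : Plane → ℝ) (x : Plane) : ℝ :=
  fderiv ℝ φ x (EuclideanSpace.single i 1)

section Weak

variable {E : Type*} [NormedAddCommGroup E] [NormedSpace ℝ E]

/-- `G` is the weak gradient of `u` in the open set `U`. It is used below only for `u` and `G`
that are square integrable on the bounded parts of `U`. -/
def HasWeakGradOn (U : Set Plane) (u : Plane → E) (G : Plane → Fin 2 → E) : Prop :=
  ∀ φ : Plane → ℝ, IsTest φ → tsupport φ ⊆ U → ∀ i : Fin 2,
    ∫ x in U, pd i φ x • u x = -∫ x in U, φ x • G x i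

/-- The form `∫_U (A ∇u) · ∇φ`, where `G = ∇u`. -/
def fluxForm (A : Plane → Matrix (Fin 2) (Fin 2) ℝ) (U : Set Plane)
    (G : Plane → Fin 2 → E) (φ : Plane → ℝ) : E :=
  ∫ x in U, ∑ i, ∑ j, (A x i j * pd i φ x) • G x j

end Weak

/-- A scalar (isotropic) conductivity as a matrix field. -/
def isotropic (s : Plane → ℝ) (x : Plane) : Matrix (Fin 2) (Fin 2) ℝ := s x • 1

/-! ### The multi-coated disk with insulated core -/

/-- The regions `A_0 = {r_1 < |x|}`, `A_j = {r_{j+1} < |x| ≤ r_j}` for `1 ≤ j ≤ L`, and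
`A_{L+1} = {|x| ≤ r_{L+1}}`. -/
def region (L : ℕ) (r : ℕ → ℝ) (j : ℕ) : Set Plane :=
  if j = 0 then {x | r 1 < ‖x‖}
  else if j = L + 1 then {x | ‖x‖ ≤ r (L + 1)}
  else {x | r (j + 1) < ‖x‖ ∧ ‖x‖ ≤ r j}

/-- The conductivity distribution `∑_{j=0}^{L+1} σ_j χ(A_j)`. -/
def layered (L : ℕ) (r σ : ℕ → ℝ) (x : Plane) : ℝ :=
  ∑ j ∈ Finset.range (L + 2), (region L r j).indicator (fun _ => σ j) x

/-- Radii `2 = r_1 > r_2 > ⋯ > r_{L+1} = 1` and conductivities: `σ_0 = 1` in the background,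
`σ_1, …, σ_L > 0` in the `L` coatings, `σ_{L+1} = 0` in the insulated core. -/
structure IsCoatedDisk (L : ℕ) (r σ : ℕ → ℝ) : Prop where
  outer : r 1 = 2
  inner : r (L + 1) = 1
  decreasing : ∀ j, 1 ≤ j → j ≤ L → r (j + 1) < r j
  background : σ 0 = 1
  coating : ∀ j, 1 ≤ j → j ≤ L → 0 < σ j
  core : σ (L + 1) = 0

/-! ### Contracted generalized polarization tensors -/

/-- The exterior of the insulated core. -/
def exterior : Set Plane := {x | 1 < ‖x‖}

/-- `u` solves `∇ · s∇u = 0` in the plane, `u - H = O(|x|⁻¹)` at infinity, where the conductivity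
`s` vanishes in the unit disk. Thus `u` is an `H¹_loc` function outside the core (up to its
boundary), and as the test functions do not have to vanish on the core, the equation contains the
homogeneous Neumann condition on the boundary of the core. -/
def IsTransmissionSolution (s H u : Plane → ℝ) : Prop :=
  (∃ G : Plane → Fin 2 → ℝ,
    (∀ R : ℝ, MemLp u 2 (volume.restrict (exterior ∩ Metric.ball 0 R)) ∧
      MemLp G 2 (volume.restrict (exterior ∩ Metric.ball 0 R))) ∧
    HasWeakGradOn exterior u G ∧
    ∀ φ, IsTest φ → fluxForm (isotropic s) exterior G φ = 0) ∧
  ∃ C R : ℝ, ∀ᵐ x : Plane, R < ‖x‖ → |u x - H x| ≤ C * ‖x‖⁻¹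

/-- The harmonic polynomial `rⁿ cos nθ`. -/
def harmCos (n : ℕ) (x : Plane) : ℝ := ‖x‖ ^ n * Real.cos (n * angle x)

/-- The harmonic polynomial `rⁿ sin nθ`. -/
def harmSin (n : ℕ) (x : Plane) : ℝ := ‖x‖ ^ n * Real.sin (n * angle x)

/-- The multipolar expansion
`w(x) = -∑_{m ≥ 1} (cos mθ / (2π m r^m)) c_m - ∑_{m ≥ 1} (sin mθ / (2π m r^m)) d_m`
in the region `|x| > 2`. -/
def HasMultipoleExpansion (w : Plane → ℝ) (c d : ℕ → ℝ) : Prop :=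
  ∀ᵐ x : Plane, 2 < ‖x‖ → HasSum (fun k : ℕ =>
    -(Real.cos ((k + 1 : ℕ) * angle x) / (2 * π * (k + 1 : ℕ) * ‖x‖ ^ (k + 1)) * c (k + 1))
    - (Real.sin ((k + 1 : ℕ) * angle x) / (2 * π * (k + 1 : ℕ) * ‖x‖ ^ (k + 1)) * d (k + 1)))
    (w x)

/-- `Mcc`, `Mcs`, `Msc`, `Mss` are the contracted generalized polarization tensors of the
conductivity distribution `s` (with indices `m, n ≥ 1`): the coefficients of the multipolar
expansions of `u - H`, for `H = rⁿ cos nθ` and for `H = rⁿ sin nθ`. -/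
structure IsContractedGPT (s : Plane → ℝ) (Mcc Mcs Msc Mss : ℕ → ℕ → ℝ) : Prop where
  cos_expansion : ∀ n, 1 ≤ n → ∀ u, IsTransmissionSolution s (harmCos n) u →
    HasMultipoleExpansion (fun x => u x - harmCos n x) (fun m => Mcc m n) (fun m => Msc m n)
  sin_expansion : ∀ n, 1 ≤ n → ∀ u, IsTransmissionSolution s (harmSin n) u →
    HasMultipoleExpansion (fun x => u x - harmSin n x) (fun m => Mcs m n) (fun m => Mss m n)

/-- `s` is a GPT-vanishing structure of order `N`. -/
def IsGPTVanishing (N : ℕ) (s : Plane → ℝ) : Prop :=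
  ∃ Mcc Mcs Msc Mss : ℕ → ℕ → ℝ, IsContractedGPT s Mcc Mcs Msc Mss ∧
    ∀ m n, 1 ≤ m → m ≤ N → 1 ≤ n → n ≤ N →
      Mcc m n = 0 ∧ Mcs m n = 0 ∧ Msc m n = 0 ∧ Mss m n = 0

/-! ### The blow-up transformation and the push-forward -/

/-- The radial map `F_ρ`: it is the identity for `|x| ≥ 3/2`, it maps `ρ ≤ |x| ≤ 3/2` onto
`1 ≤ |x| ≤ 3/2`, and it is `x / ρ` for `|x| ≤ ρ`. For `0 < ρ < 1` it is a bijection of the plane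
and of the disk of radius 2. -/
def blowUp (ρ : ℝ) (x : Plane) : Plane :=
  if ‖x‖ ≤ ρ then ρ⁻¹ • x
  else if ‖x‖ ≤ 3 / 2 then
    (((3 - 3 * ρ) / (3 - 2 * ρ) + 1 / (3 - 2 * ρ) * ‖x‖) * ‖x‖⁻¹) • x
  else x

/-- The Jacobian matrix `(∂_j F_i)`. -/
def jacobian (F : Plane → Plane) (x : Plane) : Matrix (Fin 2) (Fin 2) ℝ :=
  Matrix.of fun i j => fderiv ℝ F x (EuclideanSpace.single j 1) i

/-- The push-forward `F_* s = (DF s DFᵀ / |det DF|) ∘ F⁻¹` of a scalar conductivity. -/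
def pushForward (F : Plane → Plane) (s : Plane → ℝ) (y : Plane) : Matrix (Fin 2) (Fin 2) ℝ :=
  let x := Function.invFun F y
  |(jacobian F x).det|⁻¹ • (jacobian F x * isotropic s x * (jacobian F x)ᵀ)

/-- `Ψ_t(x) = t x`. -/
def dilation (t : ℝ) (x : Plane) : Plane := t • x

/-! ### The Sobolev space of order 1/2 on the circle of radius 2 -/

/-- Functions on the circle of radius 2 are functions of the angle `θ ∈ ℝ / 2πℤ`. -/
abbrev Angle : Type := AddCircle (2 * π)

instance factTwoPiPos : Fact (0 < 2 * π) := ⟨Real.two_pi_pos⟩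

/-- The outer unit normal at the angle `θ`. -/
def normal (θ : Angle) : Plane := !₂[Real.Angle.cos θ, Real.Angle.sin θ]

/-- The point of the circle of radius 2 at the angle `θ`. -/
def bdryPoint (θ : Angle) : Plane := (2 : ℝ) • normal θ

/-- Square integrable functions on the circle. -/
abbrev L2Circle : Type := Lp ℂ 2 (AddCircle.haarAddCircle : Measure Angle)

/-- The sequence `(1 + k²)^{1/4} f_k`, where `f_k` are the Fourier coefficients of `f`. -/
def weightedCoeff (f : L2Circle) (k : ℤ) : ℂ :=
  (((1 + (k : ℝ) ^ 2) ^ (1 / 4 : ℝ) : ℝ) : ℂ) * fourierCoeff f k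

theorem weightedCoeff_add (f g : L2Circle) :
    weightedCoeff (f + g) = weightedCoeff f + weightedCoeff g := by
  funext k
  simp only [weightedCoeff, Pi.add_apply, ← fourierBasis_repr, map_add, lp.coeFn_add, mul_add]

theorem weightedCoeff_smul (c : ℂ) (f : L2Circle) :
    weightedCoeff (c • f) = c • weightedCoeff f := by
  funext k
  simp only [weightedCoeff, Pi.smul_apply, ← fourierBasis_repr, map_smul, lp.coeFn_smul,
    smul_eq_mul]
  ring

/-- The functions `f` in `L²` with `∑_k (1 + k²)^{1/2} |f_k|² < ∞`. -/
def sobolevHalf : Submodule ℂ L2Circle where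
  carrier := {f | Memℓp (weightedCoeff f) 2}
  zero_mem' := by
    have h : weightedCoeff 0 = 0 := by
      simpa using weightedCoeff_smul 0 0
    simp only [mem_ofPred_eq, h]
    exact zero_memℓp
  add_mem' := by
    intro f g hf hg
    simp only [mem_ofPred_eq, weightedCoeff_add] at *
    exact hf.add hg
  smul_mem' := by
    intro c f hf
    simp only [mem_ofPred_eq, weightedCoeff_smul] at *
    exact hf.const_smul c

/-- The Sobolev space `H^{1/2}` of the circle of radius 2. It is a type of its own because it does
not carry the norm of `L²`. -/
def HHalf : Type := sobolevHalf

instance : AddCommGroup HHalf := inferInstanceAs (AddCommGroup sobolevHalf)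

instance : Module ℂ HHalf := inferInstanceAs (Module ℂ sobolevHalf)

/-- An element of `H^{1/2}` as a function of the angle. -/
def HHalf.toFun (f : HHalf) : Angle → ℂ := ((Subtype.val f : L2Circle) : Angle → ℂ)

/-- The embedding `f ↦ ((1 + k²)^{1/4} f_k)_k` of `H^{1/2}` into `ℓ²`. -/
def HHalf.toSeq : HHalf →ₗ[ℂ] lp (fun _ : ℤ => ℂ) 2 where
  toFun f := ⟨weightedCoeff (Subtype.val f), f.property⟩
  map_add' f g := Subtype.ext (weightedCoeff_add (Subtype.val f) (Subtype.val g))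
  map_smul' c f := Subtype.ext (weightedCoeff_smul c (Subtype.val f))

theorem HHalf.toSeq_injective : Function.Injective HHalf.toSeq := by
  intro f g h
  apply Subtype.ext
  apply fourierBasis.repr.injective
  ext k
  have hk : weightedCoeff (Subtype.val f) k = weightedCoeff (Subtype.val g) k :=
    congrFun (congrArg Subtype.val h) k
  have hw : (((1 + (k : ℝ) ^ 2) ^ (1 / 4 : ℝ) : ℝ) : ℂ) ≠ 0 := by
    exact_mod_cast (by positivity : ((1 + (k : ℝ) ^ 2) ^ (1 / 4 : ℝ) : ℝ) ≠ 0)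
  simpa only [fourierBasis_repr] using mul_left_cancel₀ hw hk

instance : NormedAddCommGroup HHalf :=
  NormedAddCommGroup.induced HHalf (lp (fun _ : ℤ => ℂ) 2) HHalf.toSeq HHalf.toSeq_injective

instance : NormedSpace ℂ HHalf := NormedSpace.induced ℂ HHalf (lp (fun _ : ℤ => ℂ) 2) HHalf.toSeq

/-- The norm of `H^{1/2}`: `‖f‖² = ∑_k (1 + k²)^{1/2} |f_k|²`. -/
theorem HHalf.norm_sq (f : HHalf) :
    ‖f‖ ^ 2 = ∑' k : ℤ, (1 + (k : ℝ) ^ 2) ^ (1 / 2 : ℝ) * ‖fourierCoeff f.toFun k‖ ^ 2 := by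
  have h := lp.norm_rpow_eq_tsum (p := 2) (by norm_num) (HHalf.toSeq f)
  have h2 : ‖f‖ = ‖HHalf.toSeq f‖ := rfl
  simp only [ENNReal.toReal_ofNat, Real.rpow_ofNat] at h
  rw [h2, h]
  refine tsum_congr fun k => ?_
  change ‖weightedCoeff (Subtype.val f) k‖ ^ 2 = _
  rw [weightedCoeff, norm_mul, mul_pow, Complex.norm_real, Real.norm_of_nonneg (by positivity),
    ← Real.rpow_natCast, ← Real.rpow_mul (by positivity)]
  norm_num [HHalf.toFun]

/-- The space `H^{-1/2}` of the circle of radius 2, with the dual norm. -/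
abbrev HMinusHalf : Type := StrongDual ℂ HHalf

/-! ### The Dirichlet-to-Neumann map -/

/-- `f` is the trace on the circle of radius 2 of the function `u` with weak gradient `G` in
`B_2 \ K`: the Gauss–Green formula holds with all test functions that vanish near the closed
set `K`, where `ds = 2 dθ`. -/
def HasTrace (K : Set Plane) (u : Plane → ℂ) (G : Plane → Fin 2 → ℂ) (f : Angle → ℂ) : Prop :=
  ∀ φ : Plane → ℝ, IsTest φ → tsupport φ ⊆ Kᶜ → ∀ i : Fin 2,
    ∫ x in Metric.ball 0 2 \ K, (pd i φ x • u x + φ x • G x i) =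
      ∫ θ : Angle, (2 * (φ (bdryPoint θ) * normal θ i)) • f θ

/-- `u ∈ H¹(B_2 \ K)`, with gradient `G`, is the weak solution of `∇ · A∇u = 0` in `B_2 \ K`,
with zero flux through the boundary of `K` (the test functions do not have to vanish on `K`)
and `u = f` on the circle of radius 2. -/
structure IsDirichletSolution (A : Plane → Matrix (Fin 2) (Fin 2) ℝ) (K : Set Plane) (f : HHalf)
    (u : Plane → ℂ) (G : Plane → Fin 2 → ℂ) : Prop where
  memLp_fun : MemLp u 2 (volume.restrict (Metric.ball 0 2 \ K))
  memLp_grad : MemLp G 2 (volume.restrict (Metric.ball 0 2 \ K))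
  grad : HasWeakGradOn (Metric.ball 0 2 \ K) u G
  trace : HasTrace K u G f.toFun
  equation : ∀ φ, IsTest φ → tsupport φ ⊆ Metric.ball 0 2 →
    fluxForm A (Metric.ball 0 2 \ K) G φ = 0

/-- `Λ` is the Dirichlet-to-Neumann map of `B_2` with conductivity `A` and insulated core `K`:
`Λ f` is the conormal derivative `A∇u · ν` on the circle of radius 2 of the solution `u` with
boundary value `f`. As an element of `H^{-1/2}` it is given by
`⟨A∇u · ν, φ|_{∂B_2}⟩ = ∫_{B_2 \ K} A∇u · ∇φ`, for all test functions `φ` (their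
restrictions span a dense subspace of `H^{1/2}`). The solution `u` is unique if `A` is bounded and
uniformly elliptic in `B_2 \ K`, as are all the conductivities considered here; so there is at
most one such `Λ`. -/
def IsDtN (A : Plane → Matrix (Fin 2) (Fin 2) ℝ) (K : Set Plane)
    (Λ : HHalf →L[ℂ] HMinusHalf) : Prop :=
  ∀ f : HHalf, ∃ u G, IsDirichletSolution A K f u G ∧
    ∀ φ, IsTest φ → ∀ g : HHalf,
      g.toFun =ᵐ[AddCircle.haarAddCircle] (fun θ => (φ (bdryPoint θ) : ℂ)) →
      Λ f g = fluxForm A (Metric.ball 0 2 \ K) G φ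

end

end NearCloaking

/-!
Everything separates in polar coordinates. The push-forward of a radial conductivity under a radial
map is diagonal in the polar frame, and in the logarithm of the radius before the blow-up its
separated solutions of degree `n` solve `C V' = P`, `P' = n² C V` with the profile `C` of the coated
disk itself. Both Dirichlet-to-Neumann maps are therefore Fourier multipliers: `P / V` at radius
`2 / ρ` for the near-cloak, and `n` for the homogeneous disk. Outside the coatings `V` and `P` are
combinations of `rⁿ` and `r⁻ⁿ`, so `P / V` differs from `n` by `O(n ρ²ⁿ)`, and the difference
vanishes exactly if the `r⁻ⁿ` term, that is the polarization tensor of order `n`, does. Only the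
orders `n > N` are left, and they contribute `O(n ρ²ᴺ⁺²)`.
-/

namespace NearCloaking

noncomputable section

open Filter Topology

/-! ### Polar coordinates -/

/-- The point with polar coordinates `(r, θ)`. -/
def polarPt (r θ : ℝ) : Plane := !₂[r * Real.cos θ, r * Real.sin θ]

/-- The open annulus `a < |x| < b`. -/
def annulus (a b : ℝ) : Set Plane := {x | a < ‖x‖ ∧ ‖x‖ < b}

/-- The rectangle of polar coordinates of the annulus `a < |x| < b`, cut along the negative
real axis like `angle`. -/
def polarRect (a b : ℝ) : Set (ℝ × ℝ) := Ioo a b ×ˢ Ioo (-π) π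

/-- The components of the radial unit vector at the angle `θ`. -/
def radDir (i : Fin 2) (θ : ℝ) : ℝ := ![Real.cos θ, Real.sin θ] i

/-- The components of the tangential unit vector at the angle `θ`. -/
def tanDir (i : Fin 2) (θ : ℝ) : ℝ := ![-Real.sin θ, Real.cos θ] i

/-- The components of the radial unit vector field `x / |x|` (zero at the origin). -/
def radField (i : Fin 2) (x : Plane) : ℝ := x i / ‖x‖

/-- The components of the tangential unit vector field (zero at the origin). -/
def tanField (i : Fin 2) (x : Plane) : ℝ := ![-x 1, x 0] i / ‖x‖

theorem norm_polarPt {r : ℝ} (hr : 0 ≤ r) (θ : ℝ) : ‖polarPt r θ‖ = r := by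
  have h : ‖polarPt r θ‖ ^ 2 = r ^ 2 := by
    rw [EuclideanSpace.norm_sq_eq, Fin.sum_univ_two, Real.norm_eq_abs, Real.norm_eq_abs, sq_abs,
      sq_abs]
    change (r * Real.cos θ) ^ 2 + (r * Real.sin θ) ^ 2 = r ^ 2
    linear_combination r ^ 2 * Real.sin_sq_add_cos_sq θ
  exact (sq_eq_sq₀ (norm_nonneg _) hr).1 h

theorem polarPt_ne_zero {r : ℝ} (hr : 0 < r) (θ : ℝ) : polarPt r θ ≠ 0 := by
  rw [← norm_ne_zero_iff, norm_polarPt hr.le]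
  exact hr.ne'

theorem angle_polarPt {r : ℝ} (hr : 0 < r) {θ : ℝ} (hθ : θ ∈ Ioc (-π) π) :
    angle (polarPt r θ) = θ := by
  refine Eq.trans ?_ (Complex.arg_mul_cos_add_sin_mul_I hr hθ)
  rw [angle]
  congr 1
  apply Complex.ext <;> simp [polarPt, Complex.cos_ofReal_re, Complex.sin_ofReal_re]

theorem radField_polarPt {r : ℝ} (hr : 0 < r) (i : Fin 2) (θ : ℝ) :
    radField i (polarPt r θ) = radDir i θ := by
  rw [radField, norm_polarPt hr.le]
  fin_cases i <;> simp [polarPt, radDir, hr.ne']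

theorem tanField_polarPt {r : ℝ} (hr : 0 < r) (i : Fin 2) (θ : ℝ) :
    tanField i (polarPt r θ) = tanDir i θ := by
  rw [tanField, norm_polarPt hr.le]
  fin_cases i
  · simp [polarPt, tanDir, neg_div, hr.ne']
  · simp [polarPt, tanDir, hr.ne']

theorem tanField_zero (x : Plane) : tanField 0 x = -radField 1 x := by
  simp [tanField, radField, neg_div]

theorem tanField_one (x : Plane) : tanField 1 x = radField 0 x := by
  simp [tanField, radField]

theorem radField_sq_add_sq {x : Plane} (hx : x ≠ 0) : radField 0 x ^ 2 + radField 1 x ^ 2 = 1 := by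
  have h := EuclideanSpace.norm_sq_eq x
  simp only [Fin.sum_univ_two, Real.norm_eq_abs, sq_abs] at h
  rw [radField, radField, div_pow, div_pow, ← add_div, ← h]
  exact div_self (pow_ne_zero 2 (norm_ne_zero_iff.2 hx))

theorem continuous_polarPt : Continuous fun z : ℝ × ℝ => polarPt z.1 z.2 := by
  unfold polarPt
  fun_prop

theorem continuous_radDir (i : Fin 2) : Continuous (radDir i) := by
  fin_cases i
  exacts [Real.continuous_cos, Real.continuous_sin]

theorem hasDerivAt_tanDir (i : Fin 2) (θ : ℝ) : HasDerivAt (tanDir i) (-radDir i θ) θ := by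
  fin_cases i
  exacts [(Real.hasDerivAt_sin θ).neg, Real.hasDerivAt_cos θ]

theorem continuous_tanDir (i : Fin 2) : Continuous (tanDir i) :=
  continuous_iff_continuousAt.2 fun θ => (hasDerivAt_tanDir i θ).continuousAt

theorem tanDir_pi (i : Fin 2) : tanDir i π = tanDir i (-π) := by
  fin_cases i <;> simp [tanDir]

theorem measurableSet_annulus (a b : ℝ) : MeasurableSet (annulus a b) :=
  (measurableSet_lt measurable_const measurable_norm).inter
    (measurableSet_lt measurable_norm measurable_const)

instance isFiniteMeasure_annulus (a b : ℝ) : IsFiniteMeasure (volume.restrict (annulus a b)) :=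
  isFiniteMeasure_restrict.2 <| ne_top_of_le_ne_top
    (measure_ball_lt_top (x := (0 : Plane)) (r := b)).ne
    (measure_mono fun _ hx => mem_ball_zero_iff.2 hx.2)

theorem measurableSet_polarRect (a b : ℝ) : MeasurableSet (polarRect a b) :=
  measurableSet_Ioo.prod measurableSet_Ioo

instance isFiniteMeasure_polarRect (a b : ℝ) :
    IsFiniteMeasure (volume.restrict (polarRect a b)) := by
  refine isFiniteMeasure_restrict.2 (ne_of_lt ?_)
  rw [polarRect, Measure.volume_eq_prod, Measure.prod_prod]
  exact ENNReal.mul_lt_top measure_Ioo_lt_top measure_Ioo_lt_top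

/-- Cartesian coordinates as a measurable equivalence, used to transport Mathlib's polar
coordinates from `ℝ × ℝ` to `Plane`. -/
def planeEquiv : ℝ × ℝ ≃ᵐ Plane :=
  MeasurableEquiv.finTwoArrow.symm.trans (MeasurableEquiv.toLp 2 (Fin 2 → ℝ))

theorem measurePreserving_planeEquiv : MeasurePreserving planeEquiv :=
  ((volume_preserving_finTwoArrow ℝ).symm).trans
    ((EuclideanSpace.volume_preserving_symm_measurableEquiv_toLp (Fin 2)).symm)

theorem planeEquiv_polarCoord_symm (z : ℝ × ℝ) :
    planeEquiv (polarCoord.symm z) = polarPt z.1 z.2 := by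
  ext i
  fin_cases i <;> rfl

theorem integral_annulus_eq {E : Type*} [NormedAddCommGroup E] [NormedSpace ℝ E] {a b : ℝ}
    (ha : 0 ≤ a) (f : Plane → E) :
    ∫ x in annulus a b, f x = ∫ z in polarRect a b, z.1 • f (polarPt z.1 z.2) := by
  rw [← integral_indicator (measurableSet_annulus a b),
    ← measurePreserving_planeEquiv.integral_comp planeEquiv.measurableEmbedding,
    ← integral_comp_polarCoord_symm, ← integral_indicator (measurableSet_polarRect a b),
    ← integral_indicator polarCoord.open_target.measurableSet]
  congr 1 with z
  simp only [planeEquiv_polarCoord_symm, indicator, smul_ite, smul_zero]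
  by_cases hz : z ∈ polarCoord.target
  · have hz' : 0 < z.1 ∧ z.2 ∈ Ioo (-π) π := hz
    have hiff : planeEquiv (polarCoord.symm z) ∈ annulus a b ↔ z ∈ polarRect a b := by
      simp only [planeEquiv_polarCoord_symm, annulus, polarRect, mem_ofPred_eq,
        norm_polarPt hz'.1.le, mem_prod, hz'.2, and_true, mem_Ioo]
    by_cases h : z ∈ polarRect a b
    · simp only [hz, h, hiff.2 h, if_true]
    · simp only [hz, h, mt hiff.1 h, if_true, if_false]
  · have hz' : z ∉ polarRect a b := fun h => hz ⟨ha.trans_lt h.1.1, h.2⟩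
    simp only [hz, hz', if_false]

/-! ### Derivatives in polar coordinates -/

/-- The radial derivative `∂_r` in polar coordinates. -/
def radDeriv (φ : Plane → ℝ) (r θ : ℝ) : ℝ := ∑ i, radDir i θ * pd i φ (polarPt r θ)

/-- The tangential derivative `r⁻¹ ∂_θ` in polar coordinates. -/
def tanDeriv (φ : Plane → ℝ) (r θ : ℝ) : ℝ := ∑ i, tanDir i θ * pd i φ (polarPt r θ)

theorem IsTest.contDiff_one {φ : Plane → ℝ} (hφ : IsTest φ) : ContDiff ℝ 1 φ :=
  hφ.smooth.of_le (by norm_cast)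

theorem fderiv_eq_sum_pd (φ : Plane → ℝ) (x v : Plane) :
    fderiv ℝ φ x v = ∑ i, v i * pd i φ x := by
  conv_lhs => rw [← (EuclideanSpace.basisFun (Fin 2) ℝ).sum_repr v]
  simp [pd]

theorem pd_polarPt (φ : Plane → ℝ) (i : Fin 2) (r θ : ℝ) :
    pd i φ (polarPt r θ) = radDir i θ * radDeriv φ r θ + tanDir i θ * tanDeriv φ r θ := by
  simp only [radDeriv, tanDeriv, Fin.sum_univ_two]
  fin_cases i
  · change pd 0 φ (polarPt r θ) = Real.cos θ * (Real.cos θ * _ + Real.sin θ * _) +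
      -Real.sin θ * (-Real.sin θ * _ + Real.cos θ * _)
    linear_combination (-pd 0 φ (polarPt r θ)) * Real.sin_sq_add_cos_sq θ
  · change pd 1 φ (polarPt r θ) = Real.sin θ * (Real.cos θ * _ + Real.sin θ * _) +
      Real.cos θ * (-Real.sin θ * _ + Real.cos θ * _)
    linear_combination (-pd 1 φ (polarPt r θ)) * Real.sin_sq_add_cos_sq θ

theorem sum_radField_mul_pd (φ : Plane → ℝ) {r : ℝ} (hr : 0 < r) (θ : ℝ) :
    ∑ i, radField i (polarPt r θ) * pd i φ (polarPt r θ) = radDeriv φ r θ := by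
  simp only [radField_polarPt hr, radDeriv]

theorem sum_tanField_mul_pd (φ : Plane → ℝ) {r : ℝ} (hr : 0 < r) (θ : ℝ) :
    ∑ i, tanField i (polarPt r θ) * pd i φ (polarPt r θ) = tanDeriv φ r θ := by
  simp only [tanField_polarPt hr, tanDeriv]

section ContDiff

variable {φ : Plane → ℝ}

theorem continuous_pd (hφ : ContDiff ℝ 1 φ) (i : Fin 2) : Continuous (pd i φ) :=
  (hφ.continuous_fderiv one_ne_zero).clm_apply continuous_const

theorem continuous_comp_polarPt (hφ : ContDiff ℝ 1 φ) :
    Continuous fun z : ℝ × ℝ => φ (polarPt z.1 z.2) :=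
  hφ.continuous.comp continuous_polarPt

theorem continuous_radDeriv (hφ : ContDiff ℝ 1 φ) :
    Continuous fun z : ℝ × ℝ => radDeriv φ z.1 z.2 :=
  continuous_finsetSum _ fun i _ => ((continuous_radDir i).comp continuous_snd).mul
    ((continuous_pd hφ i).comp continuous_polarPt)

theorem continuous_tanDeriv (hφ : ContDiff ℝ 1 φ) :
    Continuous fun z : ℝ × ℝ => tanDeriv φ z.1 z.2 :=
  continuous_finsetSum _ fun i _ => ((continuous_tanDir i).comp continuous_snd).mul
    ((continuous_pd hφ i).comp continuous_polarPt)

theorem hasDerivAt_comp_polarPt_left (hφ : ContDiff ℝ 1 φ) (r θ : ℝ) :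
    HasDerivAt (fun s => φ (polarPt s θ)) (radDeriv φ r θ) r := by
  have hpolar : HasDerivAt (fun s => polarPt s θ) (polarPt 1 θ) r := by
    have heq : (fun s => polarPt s θ) = fun s => s • polarPt 1 θ := by
      ext s i; fin_cases i <;> simp [polarPt]
    rw [heq]
    simpa using (hasDerivAt_id r).smul_const (polarPt 1 θ)
  have hcomp := (hφ.differentiable one_ne_zero (polarPt r θ)).hasFDerivAt.comp_hasDerivAt r hpolar
  rw [fderiv_eq_sum_pd] at hcomp
  refine hcomp.congr_deriv ?_
  simp [radDeriv, radDir, polarPt]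

theorem hasDerivAt_comp_polarPt_right (hφ : ContDiff ℝ 1 φ) (r θ : ℝ) :
    HasDerivAt (fun t => φ (polarPt r t)) (r * tanDeriv φ r θ) θ := by
  have hpolar : HasDerivAt (fun t => polarPt r t) (r • !₂[-Real.sin θ, Real.cos θ]) θ := by
    have heq : (fun t => polarPt r t) = fun t => Real.cos t • !₂[r, 0] + Real.sin t • !₂[0, r] := by
      ext s i; fin_cases i <;> simp [polarPt, mul_comm]
    rw [heq]
    refine (((Real.hasDerivAt_cos θ).smul_const !₂[r, 0]).add
      ((Real.hasDerivAt_sin θ).smul_const !₂[0, r])).congr_deriv ?_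
    ext i; fin_cases i <;> simp [mul_comm]
  have hcomp := (hφ.differentiable one_ne_zero (polarPt r θ)).hasFDerivAt.comp_hasDerivAt θ hpolar
  rw [fderiv_eq_sum_pd] at hcomp
  refine hcomp.congr_deriv ?_
  simp only [tanDeriv, tanDir, Fin.sum_univ_two, PiLp.smul_apply, smul_eq_mul,
    Matrix.cons_val_zero, Matrix.cons_val_one]
  ring

end ContDiff

/-! ### Bounded radial profiles -/

/-- A measurable function of the radius that is bounded on `a < s < b`. -/
structure IsBddProfile (a b : ℝ) (g : ℝ → ℝ) : Prop where
  measurable : Measurable g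
  bounded : ∃ C, ∀ s ∈ Ioo a b, |g s| ≤ C

namespace IsBddProfile

variable {a b : ℝ} {g h : ℝ → ℝ}

theorem of_continuous (hg : Continuous g) : IsBddProfile a b g := by
  obtain ⟨C, hC⟩ := (isCompact_Icc (a := a) (b := b)).exists_bound_of_continuousOn hg.continuousOn
  exact ⟨hg.measurable, C, fun s hs => hC s (Ioo_subset_Icc_self hs)⟩

theorem add (hg : IsBddProfile a b g) (hh : IsBddProfile a b h) :
    IsBddProfile a b fun s => g s + h s := by
  obtain ⟨C, hC⟩ := hg.bounded
  obtain ⟨D, hD⟩ := hh.bounded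
  exact ⟨hg.measurable.add hh.measurable, C + D, fun s hs =>
    (abs_add_le _ _).trans (add_le_add (hC s hs) (hD s hs))⟩

theorem mul (hg : IsBddProfile a b g) (hh : IsBddProfile a b h) :
    IsBddProfile a b fun s => g s * h s := by
  obtain ⟨C, hC⟩ := hg.bounded
  obtain ⟨D, hD⟩ := hh.bounded
  refine ⟨hg.measurable.mul hh.measurable, C * D, fun s hs => ?_⟩
  rw [abs_mul]
  exact mul_le_mul (hC s hs) (hD s hs) (abs_nonneg _) ((abs_nonneg _).trans (hC s hs))

theorem const_mul (c : ℝ) (hg : IsBddProfile a b g) : IsBddProfile a b fun s => c * g s :=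
  (of_continuous continuous_const).mul hg

theorem integrableOn (hg : IsBddProfile a b g) : IntegrableOn g (Ioo a b) := by
  obtain ⟨C, hC⟩ := hg.bounded
  exact Measure.integrableOn_of_bounded (M := C) measure_Ioo_lt_top.ne
    hg.measurable.aestronglyMeasurable (ae_restrict_of_forall_mem measurableSet_Ioo hC)

theorem memLp_top_polarRect (hg : IsBddProfile a b g) :
    MemLp (fun z : ℝ × ℝ => (g z.1 : ℂ)) ∞ (volume.restrict (polarRect a b)) := by
  obtain ⟨C, hC⟩ := hg.bounded
  refine memLp_top_of_bound
    (Complex.measurable_ofReal.comp (hg.measurable.comp measurable_fst)).aestronglyMeasurable C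
    (ae_restrict_of_forall_mem (measurableSet_polarRect a b) fun z hz => ?_)
  simpa using hC z.1 hz.1

theorem memLp_top_annulus (hg : IsBddProfile a b g) :
    MemLp (fun x : Plane => (g ‖x‖ : ℂ)) ∞ (volume.restrict (annulus a b)) := by
  obtain ⟨C, hC⟩ := hg.bounded
  refine memLp_top_of_bound
    (Complex.measurable_ofReal.comp (hg.measurable.comp measurable_norm)).aestronglyMeasurable C
    (ae_restrict_of_forall_mem (measurableSet_annulus a b) fun x hx => ?_)
  simpa using hC _ hx

end IsBddProfile

/-- A measurable function of the radius that is bounded and bounded away from zero on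
`a < s < b`: a coefficient of a uniformly elliptic radial conductivity. -/
structure IsEllipticProfile (a b : ℝ) (η : ℝ → ℝ) : Prop where
  measurable : Measurable η
  bounds : ∃ m M : ℝ, 0 < m ∧ ∀ s ∈ Ioo a b, m ≤ η s ∧ η s ≤ M

namespace IsEllipticProfile

variable {a b : ℝ} {η : ℝ → ℝ}

theorem pos (h : IsEllipticProfile a b η) {s : ℝ} (hs : s ∈ Ioo a b) : 0 < η s := by
  obtain ⟨m, M, hm, hb⟩ := h.bounds
  exact hm.trans_le (hb s hs).1

theorem isBddProfile (h : IsEllipticProfile a b η) : IsBddProfile a b η := by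
  obtain ⟨m, M, -, hb⟩ := h.bounds
  refine ⟨h.measurable, M, fun s hs => ?_⟩
  rw [abs_of_pos (h.pos hs)]
  exact (hb s hs).2

theorem inv (h : IsEllipticProfile a b η) : IsEllipticProfile a b fun s => (η s)⁻¹ := by
  obtain ⟨m, M, hm, hb⟩ := h.bounds
  rcases (Ioo a b).eq_empty_or_nonempty with h0 | ⟨s₀, hs₀⟩
  · exact ⟨h.measurable.inv, 1, 1, one_pos, by simp [h0]⟩
  · have hM : 0 < M := hm.trans_le ((hb s₀ hs₀).1.trans (hb s₀ hs₀).2)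
    exact ⟨h.measurable.inv, M⁻¹, m⁻¹, inv_pos.2 hM, fun s hs =>
      ⟨inv_anti₀ (h.pos hs) (hb s hs).2, inv_anti₀ hm (hb s hs).1⟩⟩

theorem mul {τ : ℝ → ℝ} (h : IsEllipticProfile a b η) (h' : IsEllipticProfile a b τ) :
    IsEllipticProfile a b fun s => η s * τ s := by
  obtain ⟨m, M, hm, hb⟩ := h.bounds
  obtain ⟨m', M', hm', hb'⟩ := h'.bounds
  exact ⟨h.measurable.mul h'.measurable, m * m', M * M', mul_pos hm hm', fun s hs =>
    ⟨mul_le_mul (hb s hs).1 (hb' s hs).1 hm'.le (h.pos hs).le,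
      mul_le_mul (hb s hs).2 (hb' s hs).2 (h'.pos hs).le
        ((h.pos hs).le.trans (hb s hs).2)⟩⟩

end IsEllipticProfile

/-! ### Integration by parts -/

theorem memLp_top_polarRect_of_continuous {a b : ℝ} {F : ℝ × ℝ → ℂ} (hF : Continuous F) :
    MemLp F ∞ (volume.restrict (polarRect a b)) := by
  obtain ⟨C, hC⟩ := (isCompact_Icc (a := a) (b := b)).prod (isCompact_Icc (a := -π) (b := π))
    |>.exists_bound_of_continuousOn hF.continuousOn
  exact memLp_top_of_bound hF.aestronglyMeasurable C <|
    ae_restrict_of_forall_mem (measurableSet_polarRect a b) fun z hz =>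
      hC z ⟨Ioo_subset_Icc_self hz.1, Ioo_subset_Icc_self hz.2⟩

theorem memLp_top_annulus_of_continuous {a b : ℝ} {F : Plane → ℂ} (hF : Continuous F) :
    MemLp F ∞ (volume.restrict (annulus a b)) := by
  obtain ⟨C, hC⟩ := (isCompact_closedBall (0 : Plane) b).exists_bound_of_continuousOn
    hF.continuousOn
  exact memLp_top_of_bound hF.aestronglyMeasurable C <|
    ae_restrict_of_forall_mem (measurableSet_annulus a b) fun x hx =>
      hC x (mem_closedBall_zero_iff.2 hx.2.le)

theorem integral_Ioo_deriv_smul_add_smul_deriv {E : Type*} [NormedAddCommGroup E]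
    [NormedSpace ℝ E] [CompleteSpace E] {a b : ℝ} (hab : a ≤ b) {P dP : ℝ → ℝ} {Φ dΦ : ℝ → E}
    {S : Set ℝ} (hS : S.Countable) (hP : Continuous P) (hdP : IsBddProfile a b dP)
    (hPd : ∀ s ∈ Ioo a b \ S, HasDerivAt P (dP s) s) (hdΦ : Continuous dΦ)
    (hΦd : ∀ s, HasDerivAt Φ (dΦ s) s) :
    ∫ s in Ioo a b, (dP s • Φ s + P s • dΦ s) = P b • Φ b - P a • Φ a := by
  have hΦ : Continuous Φ := continuous_iff_continuousAt.2 fun s => (hΦd s).continuousAt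
  have hint : IntervalIntegrable (fun s => dP s • Φ s + P s • dΦ s) volume a b := by
    refine IntervalIntegrable.add ?_ ((hP.smul hdΦ).intervalIntegrable a b)
    refine IntervalIntegrable.smul_continuousOn ?_ hΦ.continuousOn
    exact (intervalIntegrable_iff_integrableOn_Ioo_of_le hab).2 hdP.integrableOn
  have hftc := integral_eq_of_hasDerivAt_off_countable_of_le (fun s => P s • Φ s) _ hab hS
    (hP.smul hΦ).continuousOn
    (fun s hs => ((hPd s hs).smul (hΦd s)).congr_deriv (add_comm _ _)) hint
  rwa [intervalIntegral.integral_of_le hab, integral_Ioc_eq_integral_Ioo] at hftc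

theorem setIntegral_polarRect_symm {E : Type*} [NormedAddCommGroup E] [NormedSpace ℝ E]
    {a b : ℝ} {F : ℝ × ℝ → E} (hF : IntegrableOn F (polarRect a b)) :
    ∫ z in polarRect a b, F z = ∫ θ in Ioo (-π) π, ∫ r in Ioo a b, F (r, θ) := by
  rw [IntegrableOn, polarRect, Measure.volume_eq_prod, ← Measure.prod_restrict] at *
  exact integral_prod_symm F hF

section PolarRect

variable {φ : Plane → ℝ} {a b : ℝ}

theorem integrableOn_radial_parts (hφ : ContDiff ℝ 1 φ) {P dP : ℝ → ℝ} (hP : Continuous P)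
    (hdP : IsBddProfile a b dP) {E : ℝ → ℂ} (hE : Continuous E) :
    IntegrableOn (fun z : ℝ × ℝ => (dP z.1 * φ (polarPt z.1 z.2) +
      P z.1 * radDeriv φ z.1 z.2 : ℂ) * E z.2) (polarRect a b) := by
  have hfun : Continuous (fun z : ℝ × ℝ => (φ (polarPt z.1 z.2) : ℂ) * E z.2) :=
    (Complex.continuous_ofReal.comp (continuous_comp_polarPt hφ)).mul (hE.comp continuous_snd)
  have hder : Continuous (fun z : ℝ × ℝ => (P z.1 * radDeriv φ z.1 z.2 : ℂ) * E z.2) :=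
    ((Complex.continuous_ofReal.comp (hP.comp continuous_fst)).mul
      (Complex.continuous_ofReal.comp (continuous_radDeriv hφ))).mul (hE.comp continuous_snd)
  refine ((((memLp_top_polarRect_of_continuous hfun).mul' (r := ∞)
    hdP.memLp_top_polarRect).integrable le_top).add
    ((memLp_top_polarRect_of_continuous hder).integrable le_top)).congr (.of_forall fun z => ?_)
  simp only [Pi.add_apply]
  ring

theorem integral_radial_parts (hφ : ContDiff ℝ 1 φ) (hab : a ≤ b) {P dP : ℝ → ℝ} {S : Set ℝ}
    (hS : S.Countable) (hP : Continuous P) (hdP : IsBddProfile a b dP)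
    (hPd : ∀ s ∈ Ioo a b \ S, HasDerivAt P (dP s) s) {E : ℝ → ℂ} (hE : Continuous E) :
    ∫ z in polarRect a b, (dP z.1 * φ (polarPt z.1 z.2) + P z.1 * radDeriv φ z.1 z.2 : ℂ) * E z.2
      = ∫ θ in Ioo (-π) π, (P b * φ (polarPt b θ) - P a * φ (polarPt a θ) : ℂ) * E θ := by
  rw [setIntegral_polarRect_symm (integrableOn_radial_parts hφ hP hdP hE)]
  refine setIntegral_congr_fun measurableSet_Ioo fun θ _ => (integral_mul_const (E θ) _).trans ?_
  congr 1
  have hderiv (s : ℝ) : HasDerivAt (fun s => (φ (polarPt s θ) : ℂ)) (radDeriv φ s θ) s :=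
    (hasDerivAt_comp_polarPt_left hφ s θ).ofReal_comp
  have hcont := (continuous_radDeriv hφ).comp (by fun_prop : Continuous fun s : ℝ => (s, θ))
  exact integral_Ioo_deriv_smul_add_smul_deriv hab hS hP hdP hPd
    (Complex.continuous_ofReal.comp hcont) hderiv

theorem continuous_angular_parts (hφ : ContDiff ℝ 1 φ) {F dF : ℝ → ℂ} (hF : Continuous F)
    (hdF : Continuous dF) :
    Continuous fun z : ℝ × ℝ => dF z.2 * φ (polarPt z.1 z.2) +
      F z.2 * (z.1 * tanDeriv φ z.1 z.2) := by
  have hφc := Complex.continuous_ofReal.comp (continuous_comp_polarPt hφ)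
  have hφd := Complex.continuous_ofReal.comp (continuous_tanDeriv hφ)
  exact ((hdF.comp continuous_snd).mul hφc).add ((hF.comp continuous_snd).mul
    ((Complex.continuous_ofReal.comp continuous_fst).mul hφd))

theorem integrableOn_angular_parts (hφ : ContDiff ℝ 1 φ) {Q : ℝ → ℝ} (hQ : IsBddProfile a b Q)
    {F dF : ℝ → ℂ} (hF : Continuous F) (hdF : Continuous dF) :
    IntegrableOn (fun z : ℝ × ℝ => (Q z.1 : ℂ) * (dF z.2 * φ (polarPt z.1 z.2) +
      F z.2 * (z.1 * tanDeriv φ z.1 z.2))) (polarRect a b) :=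
  ((memLp_top_polarRect_of_continuous (continuous_angular_parts hφ hF hdF)).mul' (r := ∞)
    hQ.memLp_top_polarRect).integrable le_top

theorem integral_angular_parts (hφ : ContDiff ℝ 1 φ) {Q : ℝ → ℝ} (hQ : IsBddProfile a b Q)
    {F dF : ℝ → ℂ} (hdF : Continuous dF) (hFd : ∀ θ, HasDerivAt F (dF θ) θ)
    (hper : F π = F (-π)) :
    ∫ z in polarRect a b, (Q z.1 : ℂ) * (dF z.2 * φ (polarPt z.1 z.2) +
      F z.2 * (z.1 * tanDeriv φ z.1 z.2)) = 0 := by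
  have hF : Continuous F := continuous_iff_continuousAt.2 fun θ => (hFd θ).continuousAt
  rw [polarRect, Measure.volume_eq_prod,
    setIntegral_prod _ (integrableOn_angular_parts hφ hQ hF hdF)]
  refine integral_eq_zero_of_ae (.of_forall fun r => ?_)
  have hderiv : ∀ θ, HasDerivAt (fun θ => F θ * (φ (polarPt r θ) : ℂ))
      (dF θ * φ (polarPt r θ) + F θ * (r * tanDeriv φ r θ)) θ := fun θ => by
    have h := (hFd θ).mul (hasDerivAt_comp_polarPt_right hφ r θ).ofReal_comp
    push_cast at h
    exact h
  have hftc := intervalIntegral.integral_eq_sub_of_hasDerivAt (a := -π) (b := π)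
    (fun θ _ => hderiv θ) (((continuous_angular_parts hφ hF hdF).comp
      (by fun_prop : Continuous fun t : ℝ => (r, t))).intervalIntegrable _ _)
  rw [intervalIntegral.integral_of_le (by linarith [Real.pi_pos]),
    integral_Ioc_eq_integral_Ioo] at hftc
  simp only [Pi.zero_apply]
  rw [integral_const_mul, hftc]
  simp [polarPt, hper]

/-- In polar coordinates, this is the divergence theorem in an annulus for `φ` times the vector
field with radial part `P(r) E(θ) / r` and tangential part `Q(r) F(θ)`. -/
theorem integral_polarRect_divergence (hφ : ContDiff ℝ 1 φ) (hab : a ≤ b)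
    {P dP Q : ℝ → ℝ} {S : Set ℝ} (hS : S.Countable) (hP : Continuous P)
    (hdP : IsBddProfile a b dP) (hPd : ∀ s ∈ Ioo a b \ S, HasDerivAt P (dP s) s)
    (hQ : IsBddProfile a b Q) {E F dF : ℝ → ℂ} (hE : Continuous E) (hdF : Continuous dF)
    (hFd : ∀ θ, HasDerivAt F (dF θ) θ) (hper : F π = F (-π)) :
    ∫ z in polarRect a b,
      ((dP z.1 * φ (polarPt z.1 z.2) + P z.1 * radDeriv φ z.1 z.2 : ℂ) * E z.2 +
        (Q z.1 : ℂ) * (dF z.2 * φ (polarPt z.1 z.2) + F z.2 * (z.1 * tanDeriv φ z.1 z.2)))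
      = ∫ θ in Ioo (-π) π, (P b * φ (polarPt b θ) - P a * φ (polarPt a θ) : ℂ) * E θ := by
  have hF : Continuous F := continuous_iff_continuousAt.2 fun θ => (hFd θ).continuousAt
  rw [integral_add (integrableOn_radial_parts hφ hP hdP hE)
    (integrableOn_angular_parts hφ hQ hF hdF), integral_angular_parts hφ hQ hdF hFd hper,
    add_zero]
  exact integral_radial_parts hφ hab hS hP hdP hPd hE

end PolarRect

/-! ### Separated solutions -/

/-- The function `e^{ikθ}` in the plane. -/
def expAngle (k : ℤ) (x : Plane) : ℂ := Complex.exp (k * angle x * Complex.I)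

/-- The function `g(r) e^{ikθ}`. -/
def modeFun (k : ℤ) (g : ℝ → ℝ) (x : Plane) : ℂ := g ‖x‖ * expAngle k x

/-- The tangential component `r⁻¹ ∂_θ` of the gradient of `w(r) e^{ikθ}`. -/
def modeTan (k : ℤ) (w : ℝ → ℝ) : Plane → ℂ :=
  fun x => Complex.I * modeFun k (fun s => k * w s / s) x

/-- The vector field with radial component `R` and tangential component `T`. -/
def polarVector (R T : Plane → ℂ) (x : Plane) (i : Fin 2) : ℂ :=
  radField i x * R x + tanField i x * T x

/-- The conductivity with radial part `η(r)` and tangential part `τ(r)`. -/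
def polarTensor (η τ : ℝ → ℝ) (x : Plane) : Matrix (Fin 2) (Fin 2) ℝ :=
  Matrix.of fun i j => η ‖x‖ * (radField i x * radField j x) + τ ‖x‖ * (tanField i x * tanField j x)

/-- The derivative `w' = p / (η r)` of the radial part `w` of a separated solution whose flux
through the circle of radius `r` is governed by `p = r η w'`. -/
def slope (η p : ℝ → ℝ) (s : ℝ) : ℝ := (η s)⁻¹ * (p s / s)

/-- `w` is the radial part and `p = r η w'` the radial flux of a separated solution of angular
frequency `κ` in the annulus `a < r < b`, for the conductivity with radial part `η` and tangential
part `τ`, with vanishing flux at `r = a`. The equations may fail on a countable set, such as a set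
of interfaces. -/
structure IsRadialMode (a b κ : ℝ) (η τ w p : ℝ → ℝ) : Prop where
  continuous_fun : Continuous w
  continuous_flux : Continuous p
  isBddProfile_flux : IsBddProfile a b fun s => p s / s
  isBddProfile_fun : IsBddProfile a b fun s => κ * w s / s
  hasDerivAt : ∃ S : Set ℝ, S.Countable ∧ ∀ s ∈ Ioo a b \ S,
    HasDerivAt w (slope η p s) s ∧ HasDerivAt p (κ * (τ s * (κ * w s / s))) s
  flux_inner : p a = 0

theorem hasDerivAt_exp_int_mul (k : ℤ) (θ : ℝ) :
    HasDerivAt (fun t : ℝ => Complex.exp (k * t * Complex.I))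
      (k * Complex.I * Complex.exp (k * θ * Complex.I)) θ := by
  have h : HasDerivAt (fun t : ℝ => (k * t * Complex.I : ℂ)) (k * Complex.I) θ := by
    simpa using ((Complex.ofRealCLM.hasDerivAt (x := θ)).const_mul (k : ℂ)).mul_const Complex.I
  simpa [mul_comm] using h.cexp

theorem continuous_exp_int_mul (k : ℤ) :
    Continuous fun t : ℝ => Complex.exp (k * t * Complex.I) := by
  fun_prop

theorem exp_int_mul_pi (k : ℤ) :
    Complex.exp (k * (π : ℝ) * Complex.I) = Complex.exp (k * (-π : ℝ) * Complex.I) := by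
  rw [Complex.exp_eq_exp_iff_exists_int]
  exact ⟨k, by push_cast; ring⟩

theorem expAngle_polarPt {r : ℝ} (hr : 0 < r) (k : ℤ) {θ : ℝ} (hθ : θ ∈ Ioo (-π) π) :
    expAngle k (polarPt r θ) = Complex.exp (k * θ * Complex.I) := by
  rw [expAngle, angle_polarPt hr (Ioo_subset_Ioc_self hθ)]

theorem modeFun_polarPt {r : ℝ} (hr : 0 < r) (k : ℤ) (g : ℝ → ℝ) {θ : ℝ} (hθ : θ ∈ Ioo (-π) π) :
    modeFun k g (polarPt r θ) = g r * Complex.exp (k * θ * Complex.I) := by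
  rw [modeFun, norm_polarPt hr.le, expAngle_polarPt hr k hθ]

theorem hasDerivAt_tanDir_mul_exp (i : Fin 2) (k : ℤ) (θ : ℝ) :
    HasDerivAt (fun t : ℝ => (tanDir i t : ℂ) * Complex.exp (k * t * Complex.I))
      (-radDir i θ * Complex.exp (k * θ * Complex.I) +
        tanDir i θ * (k * Complex.I * Complex.exp (k * θ * Complex.I))) θ := by
  have h := (hasDerivAt_tanDir i θ).ofReal_comp
  rw [Complex.ofReal_neg] at h
  exact h.mul (hasDerivAt_exp_int_mul k θ)

theorem continuous_radDir_mul_exp (i : Fin 2) (k : ℤ) :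
    Continuous fun t : ℝ => (radDir i t : ℂ) * Complex.exp (k * t * Complex.I) :=
  (Complex.continuous_ofReal.comp (continuous_radDir i)).mul (continuous_exp_int_mul k)

theorem continuous_deriv_tanDir_mul_exp (i : Fin 2) (k : ℤ) :
    Continuous fun t : ℝ => -(radDir i t : ℂ) * Complex.exp (k * t * Complex.I) +
      tanDir i t * (k * Complex.I * Complex.exp (k * t * Complex.I)) :=
  ((Complex.continuous_ofReal.comp (continuous_radDir i)).neg.mul (continuous_exp_int_mul k)).add
    ((Complex.continuous_ofReal.comp (continuous_tanDir i)).mul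
      (continuous_const.mul (continuous_exp_int_mul k)))

theorem sum_polarTensor_mul (η τ : ℝ → ℝ) (R T : Plane → ℂ) (q : Fin 2 → ℝ) {x : Plane}
    (hx : x ≠ 0) :
    ∑ i, ∑ j, (polarTensor η τ x i j * q i : ℂ) * polarVector R T x j =
      (η ‖x‖ * ∑ i, radField i x * q i : ℝ) * R x +
      (τ ‖x‖ * ∑ i, tanField i x * q i : ℝ) * T x := by
  have h : (radField 0 x : ℂ) ^ 2 + (radField 1 x : ℂ) ^ 2 = 1 := by
    exact_mod_cast radField_sq_add_sq hx
  simp only [polarTensor, polarVector, Matrix.of_apply, Fin.sum_univ_two, tanField_zero,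
    tanField_one]
  push_cast
  linear_combination (η ‖x‖ * (radField 0 x * q 0 + radField 1 x * q 1) * R x +
    τ ‖x‖ * (-radField 1 x * q 0 + radField 0 x * q 1) * T x : ℂ) * h

namespace IsRadialMode

variable {a b : ℝ} {k : ℤ} {η τ w p : ℝ → ℝ} {φ : Plane → ℝ}

theorem isBddProfile_slope {κ : ℝ} (h : IsRadialMode a b κ η τ w p) (hη : IsEllipticProfile a b η) :
    IsBddProfile a b (slope η p) :=
  hη.inv.isBddProfile.mul h.isBddProfile_flux

theorem integral_green (h : IsRadialMode a b k η τ w p) (hη : IsEllipticProfile a b η)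
    (ha : 0 ≤ a) (hab : a ≤ b) (hφ : ContDiff ℝ 1 φ) (i : Fin 2) :
    ∫ x in annulus a b, (pd i φ x * modeFun k w x +
        φ x * polarVector (modeFun k (slope η p)) (modeTan k w) x i) =
      ∫ θ in Ioo (-π) π, ((b * w b : ℝ) * φ (polarPt b θ) - (a * w a : ℝ) * φ (polarPt a θ) : ℂ) *
        (radDir i θ * Complex.exp (k * θ * Complex.I)) := by
  obtain ⟨S, hS, hd⟩ := h.hasDerivAt
  have hw := IsBddProfile.of_continuous (a := a) (b := b) h.continuous_fun
  have hdP : IsBddProfile a b fun s => w s + s * slope η p s :=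
    hw.add ((IsBddProfile.of_continuous continuous_id).mul (h.isBddProfile_slope hη))
  have hPd : ∀ s ∈ Ioo a b \ S, HasDerivAt (fun s => s * w s) (w s + s * slope η p s) s :=
    fun s hs => ((hasDerivAt_id s).mul (hd s hs).1).congr_deriv (by rw [one_mul, id_eq])
  have hP : Continuous fun s => s * w s := continuous_id.mul h.continuous_fun
  rw [integral_annulus_eq ha]
  refine Eq.trans ?_ (integral_polarRect_divergence hφ hab hS hP hdP hPd hw
    (continuous_radDir_mul_exp i k) (continuous_deriv_tanDir_mul_exp i k)
    (hasDerivAt_tanDir_mul_exp i k) (by rw [tanDir_pi, exp_int_mul_pi]))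
  refine setIntegral_congr_fun (measurableSet_polarRect a b) fun z hz => ?_
  have hr : 0 < z.1 := ha.trans_lt hz.1.1
  have hr' : (z.1 : ℂ) ≠ 0 := Complex.ofReal_ne_zero.2 hr.ne'
  simp only [polarVector, modeTan, modeFun_polarPt hr k _ hz.2, radField_polarPt hr,
    tanField_polarPt hr, pd_polarPt, Complex.real_smul]
  push_cast
  field_simp
  ring

theorem integral_flux (h : IsRadialMode a b k η τ w p) (hη : IsEllipticProfile a b η)
    (hτ : IsEllipticProfile a b τ) (ha : 0 ≤ a) (hab : a ≤ b) (hφ : ContDiff ℝ 1 φ) :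
    ∫ x in annulus a b, ∑ i, ∑ j, (polarTensor η τ x i j * pd i φ x : ℂ) *
        polarVector (modeFun k (slope η p)) (modeTan k w) x j =
      ∫ θ in Ioo (-π) π, (p b * φ (polarPt b θ) : ℂ) * Complex.exp (k * θ * Complex.I) := by
  obtain ⟨S, hS, hd⟩ := h.hasDerivAt
  have hQ := hτ.isBddProfile.mul h.isBddProfile_fun
  have hexp (θ : ℝ) := (hasDerivAt_exp_int_mul k θ).const_mul Complex.I
  have hdexp : Continuous fun θ : ℝ =>
      Complex.I * (k * Complex.I * Complex.exp (k * θ * Complex.I)) := by fun_prop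
  have hparts := integral_polarRect_divergence hφ hab hS h.continuous_flux (hQ.const_mul k)
    (fun s hs => (hd s hs).2) hQ (continuous_exp_int_mul k) hdexp hexp (by rw [exp_int_mul_pi])
  simp only [h.flux_inner, Complex.ofReal_zero, zero_mul, sub_zero] at hparts
  rw [integral_annulus_eq ha, ← hparts]
  refine setIntegral_congr_fun (measurableSet_polarRect a b) fun z hz => ?_
  have hr : 0 < z.1 := ha.trans_lt hz.1.1
  have hr' : (z.1 : ℂ) ≠ 0 := Complex.ofReal_ne_zero.2 hr.ne'
  have hη' : (η z.1 : ℂ) ≠ 0 := Complex.ofReal_ne_zero.2 (hη.pos hz.1).ne'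
  simp only [sum_polarTensor_mul η τ _ _ (fun i => pd i φ (polarPt z.1 z.2)) (polarPt_ne_zero hr _),
    sum_radField_mul_pd φ hr, sum_tanField_mul_pd φ hr, modeTan, modeFun_polarPt hr k _ hz.2,
    norm_polarPt hr.le, Complex.real_smul, slope]
  push_cast
  field_simp
  linear_combination (-(k : ℂ) ^ 2 * φ (polarPt z.1 z.2) * τ z.1 * w z.1) * Complex.I_sq

end IsRadialMode

/-! ### Series of separated functions in `L²` -/

theorem measurable_angle : Measurable angle := by
  have h : Measurable fun x : Plane => (x 0 + x 1 * Complex.I : ℂ) := by fun_prop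
  simp only [← Complex.mk_eq_add_mul_I] at h
  exact Complex.measurable_arg.comp h

theorem measurable_expAngle (k : ℤ) : Measurable (expAngle k) := by
  have h := measurable_angle
  unfold expAngle
  fun_prop

theorem norm_expAngle (k : ℤ) (x : Plane) : ‖expAngle k x‖ = 1 := by
  have h := Complex.norm_exp_ofReal_mul_I (k * angle x)
  push_cast at h
  exact h

theorem expAngle_mul_conj (k l : ℤ) (x : Plane) :
    expAngle l x * (starRingEnd ℂ) (expAngle k x) = expAngle (l - k) x := by
  rw [expAngle, expAngle, expAngle, ← Complex.exp_conj, ← Complex.exp_add]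
  congr 1
  simp only [map_mul, map_intCast, Complex.conj_ofReal, Complex.conj_I, Int.cast_sub]
  ring

theorem measurable_modeFun (k : ℤ) {g : ℝ → ℝ} (hg : Measurable g) : Measurable (modeFun k g) :=
  (Complex.measurable_ofReal.comp (hg.comp measurable_norm)).mul (measurable_expAngle k)

theorem norm_modeFun (k : ℤ) (g : ℝ → ℝ) (x : Plane) : ‖modeFun k g x‖ = |g ‖x‖| := by
  rw [modeFun, norm_mul, norm_expAngle, mul_one, Complex.norm_real, Real.norm_eq_abs]

theorem memLp_modeFun (k : ℤ) {a b : ℝ} {g : ℝ → ℝ} (hg : IsBddProfile a b g) (q : ℝ≥0∞) :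
    MemLp (modeFun k g) q (volume.restrict (annulus a b)) := by
  obtain ⟨C, hC⟩ := hg.bounded
  refine MemLp.of_bound (measurable_modeFun k hg.measurable).aestronglyMeasurable C
    (ae_restrict_of_forall_mem (measurableSet_annulus a b) fun x hx => ?_)
  rw [norm_modeFun]
  exact hC _ hx

theorem integral_exp_int_mul (k : ℤ) :
    ∫ θ in Ioo (-π) π, Complex.exp (k * θ * Complex.I) = if k = 0 then (2 * π : ℂ) else 0 := by
  have hle : -π ≤ π := by linarith [Real.pi_pos]
  rw [← integral_Ioc_eq_integral_Ioo, ← intervalIntegral.integral_of_le hle]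
  split_ifs with hk
  · simp [hk, two_mul]
  · have hk' : (k : ℂ) * Complex.I ≠ 0 := mul_ne_zero (Int.cast_ne_zero.2 hk) Complex.I_ne_zero
    simp only [mul_right_comm, integral_exp_mul_complex hk']
    rw [mul_right_comm, exp_int_mul_pi, mul_right_comm, sub_self, zero_div]

theorem integral_modeFun (k : ℤ) {a b : ℝ} (ha : 0 ≤ a) (g : ℝ → ℝ) :
    ∫ x in annulus a b, modeFun k g x =
      (∫ s in Ioo a b, s * g s : ℝ) * if k = 0 then (2 * π : ℂ) else 0 := by
  rw [integral_annulus_eq ha, ← integral_exp_int_mul, ← integral_complex_ofReal,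
    ← setIntegral_prod_mul]
  refine setIntegral_congr_fun (measurableSet_polarRect a b) fun z hz => ?_
  simp only [modeFun_polarPt (ha.trans_lt hz.1.1) k g hz.2, Complex.real_smul]
  push_cast
  ring

/-- The function `g(r) e^{ikθ}` as an element of `L²`. -/
def modeLp {a b : ℝ} (k : ℤ) {g : ℝ → ℝ} (hg : IsBddProfile a b g) :
    Lp ℂ 2 (volume.restrict (annulus a b)) :=
  (memLp_modeFun k hg 2).toLp

theorem inner_modeLp {a b : ℝ} (ha : 0 ≤ a) (k l : ℤ) {g h : ℝ → ℝ} (hg : IsBddProfile a b g)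
    (hh : IsBddProfile a b h) : inner ℂ (modeLp k hg) (modeLp l hh) =
      (∫ s in Ioo a b, s * (g s * h s) : ℝ) * if l - k = 0 then (2 * π : ℂ) else 0 := by
  rw [L2.inner_def, ← integral_modeFun _ ha]
  refine integral_congr_ae ?_
  filter_upwards [(memLp_modeFun k hg 2).coeFn_toLp, (memLp_modeFun l hh 2).coeFn_toLp]
    with x hgx hhx
  rw [modeLp, modeLp, hgx, hhx, RCLike.inner_apply, modeFun, modeFun, modeFun,
    ← expAngle_mul_conj, map_mul, Complex.conj_ofReal]
  push_cast
  ring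

theorem norm_modeLp_sq {a b : ℝ} (ha : 0 ≤ a) (k : ℤ) {g : ℝ → ℝ} (hg : IsBddProfile a b g) :
    ‖modeLp k hg‖ ^ 2 = 2 * π * ∫ s in Ioo a b, s * g s ^ 2 := by
  have h := inner_modeLp ha k k hg hg
  rw [inner_self_eq_norm_sq_to_K, sub_self, if_pos rfl] at h
  simp only [pow_two (g _)]
  refine Complex.ofReal_injective ?_
  push_cast at h ⊢
  rw [mul_comm]
  exact h

theorem summable_of_pairwise_inner_eq_zero {𝕜 ι H : Type*} [RCLike 𝕜] [NormedAddCommGroup H]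
    [InnerProductSpace 𝕜 H] [CompleteSpace H] {v : ι → H}
    (hv : Pairwise fun i j => inner 𝕜 (v i) (v j) = 0) (hs : Summable fun i => ‖v i‖ ^ 2) :
    Summable v := by
  have ho : OrthogonalFamily 𝕜 (fun i => (Submodule.span 𝕜 {v i} : Submodule 𝕜 H))
      fun i => (Submodule.span 𝕜 {v i}).subtypeₗᵢ := by
    refine OrthogonalFamily.of_pairwise fun i j hij => ?_
    rw [Function.onFun, Submodule.isOrtho_span]
    rintro x rfl y rfl
    exact hv hij
  exact (ho.summable_iff_norm_sq_summable
    fun i => ⟨v i, Submodule.mem_span_singleton_self (v i)⟩).2 hs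

theorem inner_toLp_conj {α : Type*} [MeasurableSpace α] {μ : Measure α} {B : α → ℂ}
    (hB : MemLp (fun x => (starRingEnd ℂ) (B x)) 2 μ) (v : Lp ℂ 2 μ) :
    inner ℂ hB.toLp v = ∫ x, B x * v x ∂μ := by
  rw [L2.inner_def]
  refine integral_congr_ae ?_
  filter_upwards [hB.coeFn_toLp] with x hx
  rw [hx, RCLike.inner_apply, RingHomCompTriple.comp_apply, RingHom.id_apply, mul_comm]

theorem summable_smul_modeLp {a b : ℝ} (ha : 0 ≤ a) (f : ℤ → ℂ) {g : ℤ → ℝ → ℝ}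
    (hg : ∀ k, IsBddProfile a b (g k))
    (hs : Summable fun k => ‖f k‖ ^ 2 * ∫ s in Ioo a b, s * g k s ^ 2) :
    Summable fun k => f k • modeLp k (hg k) := by
  refine summable_of_pairwise_inner_eq_zero (𝕜 := ℂ) (fun k l hkl => ?_) ?_
  · simp only [inner_smul_left, inner_smul_right, inner_modeLp ha,
      if_neg (sub_ne_zero.2 hkl.symm), mul_zero]
  · refine (hs.mul_left (2 * π)).congr fun k => ?_
    rw [norm_smul, mul_pow, norm_modeLp_sq ha]
    ring

theorem exists_mode_series {a b : ℝ} (ha : 0 ≤ a) (f : ℤ → ℂ) {g : ℤ → ℝ → ℝ}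
    (hg : ∀ k, IsBddProfile a b (g k))
    (hs : Summable fun k => ‖f k‖ ^ 2 * ∫ s in Ioo a b, s * g k s ^ 2) :
    ∃ u : Plane → ℂ, MemLp u 2 (volume.restrict (annulus a b)) ∧
      ∀ B : Plane → ℂ, MemLp B ∞ (volume.restrict (annulus a b)) →
        HasSum (fun k => f k * ∫ x in annulus a b, B x * modeFun k (g k) x)
          (∫ x in annulus a b, B x * u x) := by
  obtain ⟨u, hu⟩ := summable_smul_modeLp ha f hg hs
  refine ⟨u, Lp.memLp u, fun B hB => ?_⟩
  have hB2 : MemLp (fun x => (starRingEnd ℂ) (B x)) 2 (volume.restrict (annulus a b)) :=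
    (hB.mono_exponent le_top).star
  have hsum := hu.mapL (innerSL ℂ hB2.toLp)
  rw [innerSL_apply_apply, inner_toLp_conj] at hsum
  refine hsum.congr_fun fun k => ?_
  rw [map_smul, innerSL_apply_apply, inner_toLp_conj, smul_eq_mul]
  congr 1
  refine integral_congr_ae ?_
  filter_upwards [(memLp_modeFun k (hg k) 2).coeFn_toLp] with x hx
  rw [modeLp, hx]

/-! ### Fourier multipliers from `H^{1/2}` to `H^{-1/2}` -/

/-- The `k`-th Fourier coefficient of an element of `H^{1/2}`. -/
def HHalf.coeff (f : HHalf) (k : ℤ) : ℂ := fourierCoeff f.toFun k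

theorem HHalf.norm_toSeq_apply (f : HHalf) (k : ℤ) :
    ‖HHalf.toSeq f k‖ = (1 + (k : ℝ) ^ 2) ^ (1 / 4 : ℝ) * ‖f.coeff k‖ := by
  change ‖weightedCoeff (Subtype.val f) k‖ = _
  rw [weightedCoeff, norm_mul, Complex.norm_real, Real.norm_of_nonneg (by positivity)]
  rfl

theorem HHalf.norm_toSeq_mul_norm_toSeq_neg (f g : HHalf) (k : ℤ) :
    ‖HHalf.toSeq f k‖ * ‖HHalf.toSeq g (-k)‖ =
      √(1 + (k : ℝ) ^ 2) * (‖f.coeff k‖ * ‖g.coeff (-k)‖) := by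
  have hw : √(1 + (k : ℝ) ^ 2) =
      (1 + (k : ℝ) ^ 2) ^ (1 / 4 : ℝ) * (1 + (k : ℝ) ^ 2) ^ (1 / 4 : ℝ) := by
    rw [← Real.rpow_add (by positivity), Real.sqrt_eq_rpow]
    norm_num
  rw [norm_toSeq_apply, norm_toSeq_apply, hw, Int.cast_neg, neg_sq]
  ring

theorem HHalf.coeff_add (f g : HHalf) (k : ℤ) : (f + g).coeff k = f.coeff k + g.coeff k := by
  change fourierCoeff ((Subtype.val f + Subtype.val g : L2Circle) : Angle → ℂ) k =
    fourierCoeff ((Subtype.val f : L2Circle) : Angle → ℂ) k +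
    fourierCoeff ((Subtype.val g : L2Circle) : Angle → ℂ) k
  simp only [← fourierBasis_repr, map_add, lp.coeFn_add, Pi.add_apply]

theorem HHalf.coeff_smul (c : ℂ) (f : HHalf) (k : ℤ) : (c • f).coeff k = c * f.coeff k := by
  change fourierCoeff ((c • Subtype.val f : L2Circle) : Angle → ℂ) k =
    c * fourierCoeff ((Subtype.val f : L2Circle) : Angle → ℂ) k
  simp only [← fourierBasis_repr, map_smul, lp.coeFn_smul, Pi.smul_apply, smul_eq_mul]

theorem HHalf.summable_norm_toSeq (f : HHalf) :
    Summable fun k => ‖HHalf.toSeq f k‖ ^ (2 : ℝ) := by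
  simpa only [ENNReal.toReal_ofNat] using (lp.memℓp (HHalf.toSeq f)).summable (by norm_num)

theorem HHalf.summable_weight (f : HHalf) :
    Summable fun k : ℤ => √(1 + (k : ℝ) ^ 2) * ‖f.coeff k‖ ^ 2 := by
  refine f.summable_norm_toSeq.congr fun k => ?_
  rw [norm_toSeq_apply, Real.sqrt_eq_rpow, Real.rpow_two, mul_pow, ← Real.rpow_natCast,
    ← Real.rpow_mul (by positivity)]
  norm_num

theorem HHalf.norm_eq_tsum (f : HHalf) :
    ‖f‖ = (∑' k, ‖HHalf.toSeq f k‖ ^ (2 : ℝ)) ^ (1 / 2 : ℝ) := by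
  change ‖HHalf.toSeq f‖ = _
  rw [lp.norm_eq_tsum_rpow (by norm_num), ENNReal.toReal_ofNat]

theorem HHalf.summable_weight_mul (f g : HHalf) :
    Summable fun k : ℤ => √(1 + (k : ℝ) ^ 2) * (‖f.coeff k‖ * ‖g.coeff (-k)‖) := by
  simp only [← norm_toSeq_mul_norm_toSeq_neg]
  exact Real.summable_mul_of_Lp_Lq_of_nonneg Real.HolderConjugate.two_two
    (fun _ => norm_nonneg _) (fun _ => norm_nonneg _) f.summable_norm_toSeq
    ((Equiv.neg ℤ).summable_iff.2 g.summable_norm_toSeq)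

theorem HHalf.tsum_weight_mul_le (f g : HHalf) :
    ∑' k : ℤ, √(1 + (k : ℝ) ^ 2) * (‖f.coeff k‖ * ‖g.coeff (-k)‖) ≤ ‖f‖ * ‖g‖ := by
  simp only [← norm_toSeq_mul_norm_toSeq_neg]
  rw [f.norm_eq_tsum, g.norm_eq_tsum,
    ← (Equiv.neg ℤ).tsum_eq fun k => ‖HHalf.toSeq g k‖ ^ (2 : ℝ)]
  exact Real.inner_le_Lp_mul_Lq_tsum_of_nonneg Real.HolderConjugate.two_two
    (fun _ => norm_nonneg _) (fun _ => norm_nonneg _) f.summable_norm_toSeq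
    ((Equiv.neg ℤ).summable_iff.2 g.summable_norm_toSeq)

/-- `Λ` is the Fourier multiplier with symbol `l` on the circle: `⟨Λ f, g⟩ = 2π ∑ l_k f_k g_{-k}`
with the bilinear pairing, whence the index `-k`. -/
def IsMultiplier (l : ℤ → ℝ) (Λ : HHalf →L[ℂ] HMinusHalf) : Prop :=
  ∀ f g : HHalf, HasSum (fun k => f.coeff k * (2 * π * l k * g.coeff (-k))) (Λ f g)

section Multiplier

variable {l l' : ℤ → ℝ} {M : ℝ}

theorem norm_multiplier_term_le (hl : ∀ k : ℤ, |l k| ≤ M * √(1 + (k : ℝ) ^ 2)) (f g : HHalf)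
    (k : ℤ) :
    ‖f.coeff k * (2 * π * l k * g.coeff (-k) : ℂ)‖ ≤
      2 * π * M * (√(1 + (k : ℝ) ^ 2) * (‖f.coeff k‖ * ‖g.coeff (-k)‖)) := by
  simp only [norm_mul, Complex.norm_real, Real.norm_eq_abs, abs_of_pos Real.pi_pos,
    Complex.norm_ofNat]
  calc ‖f.coeff k‖ * (2 * π * |l k| * ‖g.coeff (-k)‖)
      = |l k| * (2 * π * (‖f.coeff k‖ * ‖g.coeff (-k)‖)) := by ring
    _ ≤ M * √(1 + (k : ℝ) ^ 2) * (2 * π * (‖f.coeff k‖ * ‖g.coeff (-k)‖)) := by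
        gcongr
        exact hl k
    _ = _ := by ring

theorem summable_multiplier (hl : ∀ k : ℤ, |l k| ≤ M * √(1 + (k : ℝ) ^ 2)) (f g : HHalf) :
    Summable fun k => f.coeff k * (2 * π * l k * g.coeff (-k) : ℂ) :=
  .of_norm_bounded ((f.summable_weight_mul g).mul_left _) (norm_multiplier_term_le hl f g)

theorem norm_tsum_multiplier_le (hl : ∀ k : ℤ, |l k| ≤ M * √(1 + (k : ℝ) ^ 2)) (f g : HHalf) :
    ‖∑' k, f.coeff k * (2 * π * l k * g.coeff (-k) : ℂ)‖ ≤ 2 * π * M * ‖f‖ * ‖g‖ := by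
  have hM : 0 ≤ M := by simpa using (abs_nonneg _).trans (hl 0)
  refine (tsum_of_norm_bounded ((f.summable_weight_mul g).mul_left _).hasSum
    (norm_multiplier_term_le hl f g)).trans ?_
  rw [tsum_mul_left, mul_assoc (2 * π * M)]
  exact mul_le_mul_of_nonneg_left (f.tsum_weight_mul_le g) (by positivity)

theorem exists_isMultiplier (hl : ∀ k : ℤ, |l k| ≤ M * √(1 + (k : ℝ) ^ 2)) :
    ∃ Λ, IsMultiplier l Λ := by
  have hs := summable_multiplier hl
  refine ⟨LinearMap.mkContinuous₂ (LinearMap.mk₂ ℂ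
    (fun f g : HHalf => ∑' k, f.coeff k * (2 * π * l k * g.coeff (-k) : ℂ))
    (fun f f' g => ?_) (fun c f g => ?_) (fun f g g' => ?_) (fun c f g => ?_)) (2 * π * M)
    (norm_tsum_multiplier_le hl), fun f g => (hs f g).hasSum⟩
  · simp only [HHalf.coeff_add, add_mul]
    exact (hs f g).tsum_add (hs f' g)
  · simp only [HHalf.coeff_smul, mul_assoc, smul_eq_mul, tsum_mul_left]
  · simp only [HHalf.coeff_add, mul_add]
    exact (hs f g).tsum_add (hs f g')
  · simp only [HHalf.coeff_smul, mul_left_comm _ c, smul_eq_mul, tsum_mul_left]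

theorem IsMultiplier.norm_sub_le {Λ Λ' : HHalf →L[ℂ] HMinusHalf} (h : IsMultiplier l Λ)
    (h' : IsMultiplier l' Λ') (hl : ∀ k : ℤ, |l k - l' k| ≤ M * √(1 + (k : ℝ) ^ 2)) :
    ‖Λ - Λ'‖ ≤ 2 * π * M := by
  have hM : 0 ≤ M := by simpa using (abs_nonneg _).trans (hl 0)
  refine ContinuousLinearMap.opNorm_le_bound₂ _ (by positivity) fun f g => ?_
  have hsum : HasSum (fun k => f.coeff k * (2 * π * (l k - l' k : ℝ) * g.coeff (-k)))
      ((Λ - Λ') f g) := by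
    refine ((h f g).sub (h' f g)).congr_fun fun k => ?_
    push_cast
    ring
  rw [← hsum.tsum_eq]
  exact norm_tsum_multiplier_le hl f g

end Multiplier

/-! ### Boundary values -/

theorem bdryPoint_coe (θ : ℝ) : bdryPoint (θ : Angle) = polarPt 2 θ := by
  ext i
  fin_cases i
  · exact congrArg (2 * ·) (Real.Angle.cos_coe θ)
  · exact congrArg (2 * ·) (Real.Angle.sin_coe θ)

theorem normal_coe (θ : ℝ) (i : Fin 2) : normal (θ : Angle) i = radDir i θ := by
  fin_cases i
  · exact Real.Angle.cos_coe θ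
  · exact Real.Angle.sin_coe θ

theorem continuous_normal (i : Fin 2) : Continuous fun θ : Angle => normal θ i := by
  fin_cases i
  · exact Real.Angle.continuous_cos
  · exact Real.Angle.continuous_sin

theorem continuous_bdryPoint : Continuous bdryPoint :=
  ((PiLp.continuous_toLp 2 _).comp (continuous_pi continuous_normal)).const_smul (2 : ℝ)

theorem fourier_coe (k : ℤ) (θ : ℝ) :
    fourier k (θ : Angle) = Complex.exp (k * θ * Complex.I) := by
  rw [fourier_coe_apply]
  congr 1
  have : (π : ℂ) ≠ 0 := Complex.ofReal_ne_zero.2 Real.pi_ne_zero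
  push_cast
  field_simp

theorem integral_angle_eq (F : Angle → ℂ) :
    ∫ θ, F θ = ∫ θ in Ioo (-π) π, F (θ : ℝ) := by
  rw [← AddCircle.integral_preimage (2 * π) (-π), integral_Ioc_eq_integral_Ioo]
  ring_nf

theorem integral_volume_angle (F : Angle → ℂ) :
    ∫ θ, F θ = 2 * π * ∫ θ, F θ ∂AddCircle.haarAddCircle := by
  rw [AddCircle.volume_eq_smul_haarAddCircle, integral_smul_measure,
    ENNReal.toReal_ofReal Real.two_pi_pos.le, Complex.real_smul]
  push_cast
  rfl

theorem HHalf.two_pi_mul_coeff_neg {φ : Plane → ℝ} {g : HHalf}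
    (hg : g.toFun =ᵐ[AddCircle.haarAddCircle] fun θ => (φ (bdryPoint θ) : ℂ)) (k : ℤ) :
    2 * π * g.coeff (-k) =
      ∫ θ in Ioo (-π) π, (φ (polarPt 2 θ) : ℂ) * Complex.exp (k * θ * Complex.I) := by
  have h : g.coeff (-k) = ∫ θ : Angle, fourier k θ * (φ (bdryPoint θ) : ℂ)
      ∂AddCircle.haarAddCircle := by
    rw [HHalf.coeff, fourierCoeff, neg_neg]
    refine integral_congr_ae ?_
    filter_upwards [hg] with θ hθ
    rw [hθ, smul_eq_mul]
  rw [h, ← integral_volume_angle, integral_angle_eq]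
  simp only [fourier_coe, bdryPoint_coe, mul_comm]

theorem HHalf.hasSum_integral (f : HHalf) {ψ : Angle → ℝ} (hψ : Continuous ψ) :
    HasSum (fun k => f.coeff k *
        ∫ θ in Ioo (-π) π, (ψ (θ : ℝ) : ℂ) * Complex.exp (k * θ * Complex.I))
      (∫ θ, ψ θ • f.toFun θ) := by
  obtain ⟨C, hC⟩ := isCompact_univ.exists_bound_of_continuousOn hψ.continuousOn
  have hB : MemLp (fun θ => (starRingEnd ℂ) (ψ θ : ℂ)) 2
      (AddCircle.haarAddCircle : Measure Angle) :=
    (MemLp.of_bound (Complex.continuous_ofReal.comp hψ).aestronglyMeasurable C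
      (.of_forall fun θ => by simpa using hC θ (mem_univ θ))).star
  have h := ((hasSum_fourier_series_L2 (Subtype.val f : L2Circle)).mapL
    (innerSL ℂ hB.toLp)).mul_left (2 * π : ℂ)
  rw [innerSL_apply_apply, inner_toLp_conj, ← integral_volume_angle] at h
  refine (h.congr_fun fun k => ?_)
  rw [map_smul, smul_eq_mul, mul_left_comm, innerSL_apply_apply, inner_toLp_conj]
  congr 1
  rw [← integral_congr_ae (f := fun θ => (ψ θ : ℂ) * fourier k θ), ← integral_volume_angle,
    integral_angle_eq]
  · simp only [fourier_coe]
  · filter_upwards [coeFn_fourierLp 2 k] with x hx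
    rw [hx]

/-! ### The Dirichlet-to-Neumann map of a radial conductivity -/

theorem measurable_radField (i : Fin 2) : Measurable (radField i) := by
  unfold radField
  fun_prop

theorem measurable_tanField (i : Fin 2) : Measurable (tanField i) := by
  fin_cases i
  · exact (funext tanField_zero : tanField 0 = fun x => -radField 1 x) ▸
      (measurable_radField 1).neg
  · exact (funext tanField_one : tanField 1 = radField 0) ▸ measurable_radField 0

theorem abs_radField_le (i : Fin 2) (x : Plane) : |radField i x| ≤ 1 := by
  rw [radField, abs_div, abs_norm]
  exact div_le_one_of_le₀ (PiLp.norm_apply_le x i) (norm_nonneg x)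

theorem abs_tanField_le (i : Fin 2) (x : Plane) : |tanField i x| ≤ 1 := by
  fin_cases i
  · exact (congrArg abs (tanField_zero x)).trans_le
      ((abs_neg _).trans_le (abs_radField_le 1 x))
  · exact (congrArg abs (tanField_one x)).trans_le (abs_radField_le 0 x)

theorem memLp_top_radField (i : Fin 2) (μ : Measure Plane) :
    MemLp (fun x => (radField i x : ℂ)) ∞ μ :=
  memLp_top_of_bound (Complex.measurable_ofReal.comp (measurable_radField i)).aestronglyMeasurable
    1 (.of_forall fun x => (Complex.norm_real _).trans_le (abs_radField_le i x))

theorem memLp_top_tanField (i : Fin 2) (μ : Measure Plane) :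
    MemLp (fun x => (tanField i x : ℂ)) ∞ μ :=
  memLp_top_of_bound (Complex.measurable_ofReal.comp (measurable_tanField i)).aestronglyMeasurable
    1 (.of_forall fun x => (Complex.norm_real _).trans_le (abs_tanField_le i x))

theorem memLp_modeTan {a b : ℝ} (k : ℤ) {w : ℝ → ℝ} (hw : IsBddProfile a b fun s => k * w s / s)
    (q : ℝ≥0∞) : MemLp (modeTan k w) q (volume.restrict (annulus a b)) :=
  (memLp_modeFun k hw q).const_mul Complex.I

theorem memLp_polarVector {μ : Measure Plane} {R T : Plane → ℂ} (hR : MemLp R 2 μ)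
    (hT : MemLp T 2 μ) : MemLp (polarVector R T) 2 μ :=
  memLp_pi_iff.2 fun i => (hR.mul' (r := 2) (memLp_top_radField i μ)).add
    (hT.mul' (r := 2) (memLp_top_tanField i μ))

theorem memLp_top_mul_sum_pd {a b : ℝ} {η : ℝ → ℝ} (hη : IsBddProfile a b η) {φ : Plane → ℝ}
    (hφ : ContDiff ℝ 1 φ) {V : Fin 2 → Plane → ℝ}
    (hV : ∀ i, MemLp (fun x => (V i x : ℂ)) ∞ (volume.restrict (annulus a b))) :
    MemLp (fun x : Plane => ((η ‖x‖ * ∑ i, V i x * pd i φ x : ℝ) : ℂ)) ∞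
      (volume.restrict (annulus a b)) := by
  have hpd : ∀ i, MemLp (fun x => (pd i φ x : ℂ)) ∞ (volume.restrict (annulus a b)) := fun i =>
    memLp_top_annulus_of_continuous (Complex.continuous_ofReal.comp (continuous_pd hφ i))
  have h := (((hpd 0).mul' (r := ∞) (hV 0)).add ((hpd 1).mul' (r := ∞) (hV 1))).mul' (r := ∞)
    hη.memLp_top_annulus
  simpa only [Fin.sum_univ_two, Complex.ofReal_mul, Complex.ofReal_add, Pi.add_apply] using h

theorem fluxForm_polarVector {a b : ℝ} (ha : 0 ≤ a) {η τ : ℝ → ℝ}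
    {A : Plane → Matrix (Fin 2) (Fin 2) ℝ}
    (hA : ∀ᵐ x : Plane, x ∈ annulus a b → A x = polarTensor η τ x) {U : Set Plane}
    (hU : U =ᵐ[volume] annulus a b) (R T : Plane → ℂ) (φ : Plane → ℝ) :
    fluxForm A U (polarVector R T) φ =
      ∫ x in annulus a b, ((η ‖x‖ * ∑ i, radField i x * pd i φ x : ℝ) * R x +
        (τ ‖x‖ * ∑ i, tanField i x * pd i φ x : ℝ) * T x) := by
  rw [fluxForm, Measure.restrict_congr_set hU]
  refine integral_congr_ae ?_
  rw [EventuallyEq, ae_restrict_iff' (measurableSet_annulus a b)]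
  filter_upwards [hA] with x hx hx'
  have hx0 : x ≠ 0 := norm_pos_iff.1 (ha.trans_lt hx'.1)
  rw [hx hx', ← sum_polarTensor_mul η τ R T (fun i => pd i φ x) hx0]
  simp only [Complex.real_smul, Complex.ofReal_mul]

/-- `B` bounds the squared `L²` norms (up to the factor `2π`) of the separated solution with radial
part `w` and radial flux `p` and of the two components of its gradient. -/
structure HasEnergyBound (a b κ : ℝ) (η w p : ℝ → ℝ) (B : ℝ) : Prop where
  fun_le : ∫ s in Ioo a b, s * w s ^ 2 ≤ B
  radial_le : ∫ s in Ioo a b, s * slope η p s ^ 2 ≤ B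
  tangential_le : ∫ s in Ioo a b, s * (κ * w s / s) ^ 2 ≤ B

/-- `u` is the sum of the series of separated solutions with coefficients `f`, and `R` and `T` are
the radial and tangential components of its gradient. The sum is taken in the weak topology of
`L²`, which is all that is needed to pass to the limit in the weak formulations. -/
structure IsModeSeries (a b : ℝ) (f : ℤ → ℂ) (η : ℝ → ℝ) (w p : ℤ → ℝ → ℝ)
    (u R T : Plane → ℂ) : Prop where
  memLp_fun : MemLp u 2 (volume.restrict (annulus a b))
  memLp_radial : MemLp R 2 (volume.restrict (annulus a b))
  memLp_tangential : MemLp T 2 (volume.restrict (annulus a b))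
  hasSum_fun : ∀ B : Plane → ℂ, MemLp B ∞ (volume.restrict (annulus a b)) →
    HasSum (fun k => f k * ∫ x in annulus a b, B x * modeFun k (w k) x)
      (∫ x in annulus a b, B x * u x)
  hasSum_radial : ∀ B : Plane → ℂ, MemLp B ∞ (volume.restrict (annulus a b)) →
    HasSum (fun k => f k * ∫ x in annulus a b, B x * modeFun k (slope η (p k)) x)
      (∫ x in annulus a b, B x * R x)
  hasSum_tangential : ∀ B : Plane → ℂ, MemLp B ∞ (volume.restrict (annulus a b)) →
    HasSum (fun k => f k * ∫ x in annulus a b, B x * modeTan k (w k) x)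
      (∫ x in annulus a b, B x * T x)

theorem HHalf.summable_coeff_sq_mul (f : HHalf) {M : ℝ} {I : ℤ → ℝ} (h0 : ∀ k, 0 ≤ I k)
    (hI : ∀ k : ℤ, I k ≤ M * √(1 + (k : ℝ) ^ 2)) : Summable fun k => ‖f.coeff k‖ ^ 2 * I k := by
  refine .of_nonneg_of_le (fun k => mul_nonneg (sq_nonneg _) (h0 k)) (fun k => ?_)
    (f.summable_weight.mul_left M)
  calc ‖f.coeff k‖ ^ 2 * I k ≤ ‖f.coeff k‖ ^ 2 * (M * √(1 + (k : ℝ) ^ 2)) :=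
        mul_le_mul_of_nonneg_left (hI k) (sq_nonneg _)
    _ = _ := by ring

theorem integral_add_of_memLp_top {μ : Measure Plane} [IsFiniteMeasure μ] {B C R T : Plane → ℂ}
    (hB : MemLp B ∞ μ) (hC : MemLp C ∞ μ) (hR : MemLp R 2 μ) (hT : MemLp T 2 μ) :
    ∫ x, (B x * R x + C x * T x) ∂μ = ∫ x, B x * R x ∂μ + ∫ x, C x * T x ∂μ :=
  integral_add ((hR.mul' (r := 2) hB).integrable one_le_two)
    ((hT.mul' (r := 2) hC).integrable one_le_two)

section Series

variable {a b : ℝ} {η τ : ℝ → ℝ} {w p : ℤ → ℝ → ℝ}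

theorem exists_isModeSeries (ha : 0 ≤ a) (hη : IsEllipticProfile a b η)
    (hm : ∀ k : ℤ, IsRadialMode a b k η τ (w k) (p k)) {M : ℝ}
    (hE : ∀ k : ℤ, HasEnergyBound a b k η (w k) (p k) (M * √(1 + (k : ℝ) ^ 2))) (f : HHalf) :
    ∃ u R T, IsModeSeries a b f.coeff η w p u R T := by
  have hnn : ∀ g : ℝ → ℝ, 0 ≤ ∫ s in Ioo a b, s * g s ^ 2 := fun g =>
    setIntegral_nonneg measurableSet_Ioo fun s hs => mul_nonneg (ha.trans hs.1.le) (sq_nonneg _)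
  obtain ⟨u, hu, hu'⟩ := exists_mode_series ha f.coeff
    (fun k => .of_continuous (hm k).continuous_fun)
    (f.summable_coeff_sq_mul (fun k => hnn _) fun k => (hE k).fun_le)
  obtain ⟨R, hR, hR'⟩ := exists_mode_series ha f.coeff (fun k => (hm k).isBddProfile_slope hη)
    (f.summable_coeff_sq_mul (fun k => hnn _) fun k => (hE k).radial_le)
  obtain ⟨T, hT, hT'⟩ := exists_mode_series ha f.coeff (fun k => (hm k).isBddProfile_fun)
    (f.summable_coeff_sq_mul (fun k => hnn _) fun k => (hE k).tangential_le)
  refine ⟨u, R, fun x => Complex.I * T x, hu, hR, hT.const_mul _, hu', hR', fun B hB => ?_⟩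
  simp only [modeTan, mul_left_comm _ Complex.I, integral_const_mul]
  exact (hT' B hB).mul_left Complex.I

namespace IsModeSeries

variable {f : ℤ → ℂ} {u R T : Plane → ℂ}

theorem hasSum_field (h : IsModeSeries a b f η w p u R T) (hη : IsEllipticProfile a b η)
    (hm : ∀ k : ℤ, IsRadialMode a b k η τ (w k) (p k)) {B C : Plane → ℂ}
    (hB : MemLp B ∞ (volume.restrict (annulus a b)))
    (hC : MemLp C ∞ (volume.restrict (annulus a b))) :
    HasSum (fun k => f k * ∫ x in annulus a b,
        (B x * modeFun k (slope η (p k)) x + C x * modeTan k (w k) x))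
      (∫ x in annulus a b, (B x * R x + C x * T x)) := by
  rw [integral_add_of_memLp_top hB hC h.memLp_radial h.memLp_tangential]
  refine ((h.hasSum_radial B hB).add (h.hasSum_tangential C hC)).congr_fun fun k => ?_
  rw [integral_add_of_memLp_top hB hC (memLp_modeFun k ((hm k).isBddProfile_slope hη) 2)
    (memLp_modeTan k (hm k).isBddProfile_fun 2), mul_add]

theorem hasSum_green (h : IsModeSeries a b f η w p u R T) (hη : IsEllipticProfile a b η)
    (hm : ∀ k : ℤ, IsRadialMode a b k η τ (w k) (p k)) {φ : Plane → ℝ} (hφ : ContDiff ℝ 1 φ)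
    (i : Fin 2) :
    HasSum (fun k => f k * ∫ x in annulus a b, (pd i φ x * modeFun k (w k) x +
        φ x * polarVector (modeFun k (slope η (p k))) (modeTan k (w k)) x i))
      (∫ x in annulus a b, (pd i φ x * u x + φ x * polarVector R T x i)) := by
  have hpd : MemLp (fun x => (pd i φ x : ℂ)) ∞ (volume.restrict (annulus a b)) :=
    memLp_top_annulus_of_continuous (Complex.continuous_ofReal.comp (continuous_pd hφ i))
  have hφ0 : MemLp (fun x => (φ x : ℂ)) ∞ (volume.restrict (annulus a b)) :=
    memLp_top_annulus_of_continuous (Complex.continuous_ofReal.comp hφ.continuous)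
  have hfield : HasSum (fun k => f k * ∫ x in annulus a b,
      φ x * polarVector (modeFun k (slope η (p k))) (modeTan k (w k)) x i)
      (∫ x in annulus a b, φ x * polarVector R T x i) := by
    simpa only [polarVector, mul_add, mul_assoc] using
      h.hasSum_field hη hm ((memLp_top_radField i _).mul' (r := ∞) hφ0)
        ((memLp_top_tanField i _).mul' (r := ∞) hφ0)
  have hG := memLp_pi_iff.1 (memLp_polarVector h.memLp_radial h.memLp_tangential) i
  rw [integral_add_of_memLp_top hpd hφ0 h.memLp_fun hG]
  refine ((h.hasSum_fun _ hpd).add hfield).congr_fun fun k => ?_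
  have hGk := memLp_pi_iff.1 (memLp_polarVector
    (memLp_modeFun k ((hm k).isBddProfile_slope hη) 2)
    (memLp_modeTan k (hm k).isBddProfile_fun 2)) i
  rw [integral_add_of_memLp_top hpd hφ0
    (memLp_modeFun k (.of_continuous (hm k).continuous_fun) 2) hGk, mul_add]

theorem hasSum_fluxForm (h : IsModeSeries a b f η w p u R T) (hη : IsEllipticProfile a b η)
    (hτ : IsEllipticProfile a b τ) (hm : ∀ k : ℤ, IsRadialMode a b k η τ (w k) (p k))
    (ha : 0 ≤ a) (hab : a ≤ b) {A : Plane → Matrix (Fin 2) (Fin 2) ℝ}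
    (hA : ∀ᵐ x : Plane, x ∈ annulus a b → A x = polarTensor η τ x) {U : Set Plane}
    (hU : U =ᵐ[volume] annulus a b) {φ : Plane → ℝ} (hφ : ContDiff ℝ 1 φ) :
    HasSum (fun k => f k *
        (p k b * ∫ θ in Ioo (-π) π, (φ (polarPt b θ) : ℂ) * Complex.exp (k * θ * Complex.I)))
      (fluxForm A U (polarVector R T) φ) := by
  rw [fluxForm_polarVector ha hA hU]
  refine (h.hasSum_field hη hm
    (memLp_top_mul_sum_pd hη.isBddProfile hφ fun i => memLp_top_radField i _)
    (memLp_top_mul_sum_pd hτ.isBddProfile hφ fun i => memLp_top_tanField i _)).congr_fun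
    fun k => ?_
  rw [← integral_const_mul]
  simp only [← mul_assoc]
  rw [← (hm k).integral_flux hη hτ ha hab hφ]
  congr 1
  refine setIntegral_congr_fun (measurableSet_annulus a b) fun x hx => ?_
  exact sum_polarTensor_mul η τ _ _ (fun i => pd i φ x) (norm_pos_iff.1 (ha.trans_lt hx.1))

end IsModeSeries

theorem apply_eq_zero_of_tsupport_subset {φ : Plane → ℝ} {U : Set Plane} (h : tsupport φ ⊆ U)
    {x : Plane} (hx : x ∉ U) : φ x = 0 :=
  image_eq_zero_of_notMem_tsupport fun hx' => hx (h hx')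

theorem norm_bdryPoint (θ : Angle) : ‖bdryPoint θ‖ = 2 := by
  induction θ using QuotientAddGroup.induction_on with
  | H θ => exact (congrArg norm (bdryPoint_coe θ)).trans (norm_polarPt zero_le_two θ)

theorem HasTrace.hasWeakGradOn {K : Set Plane} {u : Plane → ℂ} {G : Plane → Fin 2 → ℂ}
    {f : Angle → ℂ} (h : HasTrace K u G f)
    (hu : MemLp u 2 (volume.restrict (Metric.ball 0 2 \ K)))
    (hG : MemLp G 2 (volume.restrict (Metric.ball 0 2 \ K))) :
    HasWeakGradOn (Metric.ball 0 2 \ K) u G := by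
  intro φ hφ hsupp i
  have hfin : IsFiniteMeasure (volume.restrict (Metric.ball (0 : Plane) 2 \ K)) :=
    isFiniteMeasure_restrict.2
      (ne_top_of_le_ne_top measure_ball_lt_top.ne (measure_mono sdiff_subset))
  have hpd := (continuous_pd hφ.contDiff_one i).memLp_top_of_hasCompactSupport
    (hφ.compact.fderiv_apply ℝ _) (volume.restrict (Metric.ball 0 2 \ K))
  have hφ0 := hφ.contDiff_one.continuous.memLp_top_of_hasCompactSupport hφ.compact
    (volume.restrict (Metric.ball 0 2 \ K))
  have hbdry : ∀ θ : Angle, φ (bdryPoint θ) = 0 := fun θ =>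
    apply_eq_zero_of_tsupport_subset hsupp fun hx =>
      (mem_ball_zero_iff.1 hx.1).ne (norm_bdryPoint θ)
  have htrace := h φ hφ (fun x hx => (hsupp hx).2) i
  simp only [hbdry, zero_mul, mul_zero, zero_smul, integral_zero] at htrace
  have hpu : Integrable (fun x => pd i φ x • u x) (volume.restrict (Metric.ball 0 2 \ K)) :=
    (hu.integrable one_le_two).smul_of_top_right hpd
  have hφG : Integrable (fun x => φ x • G x i) (volume.restrict (Metric.ball 0 2 \ K)) :=
    ((memLp_pi_iff.1 hG i).integrable one_le_two).smul_of_top_right hφ0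
  rw [integral_add hpu hφG] at htrace
  exact eq_neg_of_add_eq_zero_left htrace

theorem IsModeSeries.hasTrace {f : HHalf} {u R T : Plane → ℂ}
    (h : IsModeSeries a 2 f.coeff η w p u R T) (hη : IsEllipticProfile a 2 η)
    (hm : ∀ k : ℤ, IsRadialMode a 2 k η τ (w k) (p k)) (hw : ∀ k, w k 2 = 1) (ha : 0 ≤ a)
    (ha2 : a ≤ 2) {K : Set Plane} (hU : (Metric.ball 0 2 \ K : Set Plane) =ᵐ[volume] annulus a 2)
    (hK : a = 0 ∨ ∀ θ, polarPt a θ ∈ K) : HasTrace K u (polarVector R T) f.toFun := by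
  intro φ hφ hsupp i
  have hφc := hφ.contDiff_one.continuous
  have hbdry := f.hasSum_integral (ψ := fun θ => 2 * (φ (bdryPoint θ) * normal θ i))
    (continuous_const.mul ((hφc.comp continuous_bdryPoint).mul (continuous_normal i)))
  have hinner : ∀ k θ, ((a * w k a : ℝ) * φ (polarPt a θ) : ℂ) = 0 := by
    intro k θ
    rcases hK with h | h
    · rw [h, zero_mul, Complex.ofReal_zero, zero_mul]
    · rw [apply_eq_zero_of_tsupport_subset hsupp fun h' => h' (h θ), Complex.ofReal_zero, mul_zero]
  rw [Measure.restrict_congr_set hU]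
  simp only [Complex.real_smul]
  refine (h.hasSum_green hη hm hφ.contDiff_one i).unique (hbdry.congr_fun fun k => ?_)
  rw [(hm k).integral_green hη ha ha2 hφ.contDiff_one i]
  congr 2 with θ
  rw [hinner, bdryPoint_coe, normal_coe, hw]
  push_cast
  ring

theorem isDtN_of_hasEnergyBound (ha : 0 ≤ a) (ha2 : a ≤ 2) {K : Set Plane}
    {A : Plane → Matrix (Fin 2) (Fin 2) ℝ} (hη : IsEllipticProfile a 2 η)
    (hτ : IsEllipticProfile a 2 τ)
    (hU : (Metric.ball 0 2 \ K : Set Plane) =ᵐ[volume] annulus a 2)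
    (hA : ∀ᵐ x : Plane, x ∈ annulus a 2 → A x = polarTensor η τ x)
    (hK : a = 0 ∨ ∀ θ, polarPt a θ ∈ K)
    (hm : ∀ k : ℤ, IsRadialMode a 2 k η τ (w k) (p k)) (hw : ∀ k, w k 2 = 1) {M : ℝ}
    (hE : ∀ k : ℤ, HasEnergyBound a 2 k η (w k) (p k) (M * √(1 + (k : ℝ) ^ 2)))
    {Λ : HHalf →L[ℂ] HMinusHalf} (hΛ : IsMultiplier (fun k => p k 2) Λ) : IsDtN A K Λ := by
  intro f
  obtain ⟨u, R, T, h⟩ := exists_isModeSeries ha hη hm hE f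
  have htrace := h.hasTrace hη hm hw ha ha2 hU hK
  have hflux : ∀ φ, IsTest φ → _ := fun φ hφ =>
    h.hasSum_fluxForm hη hτ hm ha ha2 hA hU (IsTest.contDiff_one hφ)
  have hu := h.memLp_fun
  have hG := memLp_polarVector h.memLp_radial h.memLp_tangential
  rw [← Measure.restrict_congr_set hU] at hu hG
  refine ⟨u, polarVector R T, ⟨hu, hG, htrace.hasWeakGradOn hu hG, htrace, ?_⟩, ?_⟩
  · intro φ hφ hsupp
    have hbdry : ∀ θ, φ (polarPt 2 θ) = 0 := fun θ =>
      apply_eq_zero_of_tsupport_subset hsupp (by simp [norm_polarPt zero_le_two])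
    refine (hflux φ hφ).unique (hasSum_zero.congr_fun fun k => ?_)
    simp only [hbdry, Complex.ofReal_zero, zero_mul, integral_zero, mul_zero]
  · intro φ hφ g hg
    refine (hΛ f g).unique ((hflux φ hφ).congr_fun fun k => ?_)
    rw [← HHalf.two_pi_mul_coeff_neg hg]
    ring

end Series

theorem IsBddProfile.id_mul_sq {a b : ℝ} {g : ℝ → ℝ} (hg : IsBddProfile a b g) :
    IsBddProfile a b fun s => s * g s ^ 2 := by
  simpa only [pow_two, id_eq] using (IsBddProfile.of_continuous continuous_id).mul (hg.mul hg)

theorem IsBddProfile.mul_integral_le {a b m : ℝ} {f g : ℝ → ℝ} (hf : IsBddProfile a b f)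
    (hg : IsBddProfile a b g) (h : ∀ s ∈ Ioo a b, m * f s ≤ g s) :
    m * ∫ s in Ioo a b, f s ≤ ∫ s in Ioo a b, g s := by
  rw [← integral_const_mul]
  exact setIntegral_mono_on (hf.const_mul m).integrableOn hg.integrableOn measurableSet_Ioo h

namespace IsRadialMode

variable {a b κ m : ℝ} {η τ w p : ℝ → ℝ}

theorem isBddProfile_energy (h : IsRadialMode a b κ η τ w p) (hη : IsEllipticProfile a b η)
    (hτ : IsEllipticProfile a b τ) :
    IsBddProfile a b fun s => η s * (s * slope η p s ^ 2) + τ s * (s * (κ * w s / s) ^ 2) :=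
  (hη.isBddProfile.mul (h.isBddProfile_slope hη).id_mul_sq).add
    (hτ.isBddProfile.mul h.isBddProfile_fun.id_mul_sq)

theorem integral_energy (h : IsRadialMode a b κ η τ w p) (hη : IsEllipticProfile a b η)
    (hτ : IsEllipticProfile a b τ) (ha : 0 ≤ a) (hab : a ≤ b) :
    ∫ s in Ioo a b, (η s * (s * slope η p s ^ 2) + τ s * (s * (κ * w s / s) ^ 2)) = w b * p b := by
  obtain ⟨S, hS, hd⟩ := h.hasDerivAt
  have hderiv : ∀ s ∈ Ioo a b \ S, HasDerivAt (fun s => w s * p s)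
      (η s * (s * slope η p s ^ 2) + τ s * (s * (κ * w s / s) ^ 2)) s := fun s hs => by
    have hs0 : s ≠ 0 := (ha.trans_lt hs.1.1).ne'
    have hη0 : η s ≠ 0 := (hη.pos hs.1).ne'
    refine ((hd s hs).1.mul (hd s hs).2).congr_deriv ?_
    rw [slope]
    field_simp
  have hint := integral_eq_of_hasDerivAt_off_countable_of_le _ _ hab hS
    (h.continuous_fun.mul h.continuous_flux).continuousOn hderiv
    ((intervalIntegrable_iff_integrableOn_Ioo_of_le hab).2
      (h.isBddProfile_energy hη hτ).integrableOn)
  rwa [intervalIntegral.integral_of_le hab, integral_Ioc_eq_integral_Ioo, Pi.mul_apply,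
    Pi.mul_apply, h.flux_inner, mul_zero, sub_zero] at hint

theorem mul_integral_slope_sq_le (h : IsRadialMode a b κ η τ w p) (hη : IsEllipticProfile a b η)
    (hτ : IsEllipticProfile a b τ) (ha : 0 ≤ a) (hab : a ≤ b) (hm : ∀ s ∈ Ioo a b, m ≤ η s) :
    m * ∫ s in Ioo a b, s * slope η p s ^ 2 ≤ w b * p b := by
  rw [← h.integral_energy hη hτ ha hab]
  refine (h.isBddProfile_slope hη).id_mul_sq.mul_integral_le (h.isBddProfile_energy hη hτ)
    fun s hs => ?_
  have hs0 : 0 ≤ s := ha.trans hs.1.le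
  have hτ0 := hτ.pos hs
  exact le_add_of_le_of_nonneg (mul_le_mul_of_nonneg_right (hm s hs) (by positivity))
    (by positivity)

theorem mul_integral_tangential_sq_le (h : IsRadialMode a b κ η τ w p)
    (hη : IsEllipticProfile a b η) (hτ : IsEllipticProfile a b τ) (ha : 0 ≤ a) (hab : a ≤ b)
    (hm : ∀ s ∈ Ioo a b, m ≤ τ s) :
    m * ∫ s in Ioo a b, s * (κ * w s / s) ^ 2 ≤ w b * p b := by
  rw [← h.integral_energy hη hτ ha hab]
  refine h.isBddProfile_fun.id_mul_sq.mul_integral_le (h.isBddProfile_energy hη hτ)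
    fun s hs => ?_
  have hs0 : 0 ≤ s := ha.trans hs.1.le
  have hη0 := hη.pos hs
  exact le_add_of_nonneg_of_le (by positivity)
    (mul_le_mul_of_nonneg_right (hm s hs) (by positivity))

theorem integral_sq_le (h : IsRadialMode a b κ η τ w p) (hκ : 1 ≤ κ ^ 2) (ha : 0 ≤ a) :
    ∫ s in Ioo a b, s * w s ^ 2 ≤ b ^ 2 * ∫ s in Ioo a b, s * (κ * w s / s) ^ 2 := by
  rw [← one_mul (∫ s in Ioo a b, s * w s ^ 2), ← integral_const_mul (b ^ 2)]
  refine (IsBddProfile.of_continuous h.continuous_fun).id_mul_sq.mul_integral_le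
    (h.isBddProfile_fun.id_mul_sq.const_mul _) fun s hs => ?_
  have hs0 : 0 < s := ha.trans_lt hs.1
  have hsb : 1 ≤ b ^ 2 / s ^ 2 :=
    (one_le_div (by positivity)).2 (pow_le_pow_left₀ hs0.le hs.2.le 2)
  calc 1 * (s * w s ^ 2) ≤ (b ^ 2 / s ^ 2 * κ ^ 2) * (s * w s ^ 2) :=
        mul_le_mul_of_nonneg_right (one_le_mul_of_one_le_of_one_le hsb hκ) (by positivity)
    _ = b ^ 2 * (s * (κ * w s / s) ^ 2) := by field_simp

end IsRadialMode

theorem abs_le_sqrt_one_add_sq (k : ℝ) : |k| ≤ √(1 + k ^ 2) :=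
  Real.abs_le_sqrt (by linarith)

theorem one_le_sqrt_one_add_sq (k : ℝ) : 1 ≤ √(1 + k ^ 2) :=
  Real.one_le_sqrt.2 (by nlinarith [sq_nonneg k])

theorem setIntegral_id_le (a b : ℝ) (hab : a ≤ b) : ∫ s in Ioo a b, s ≤ b ^ 2 / 2 := by
  rw [← integral_Ioc_eq_integral_Ioo, ← intervalIntegral.integral_of_le hab, integral_id]
  linarith [sq_nonneg a]

theorem IsRadialMode.hasEnergyBound {a m Q : ℝ} {k : ℤ} {η τ w p : ℝ → ℝ}
    (h : IsRadialMode a 2 k η τ w p) (hη : IsEllipticProfile a 2 η) (hτ : IsEllipticProfile a 2 τ)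
    (ha : 0 ≤ a) (ha2 : a ≤ 2) (hm : 0 < m) (hmη : ∀ s ∈ Ioo a 2, m ≤ η s)
    (hmτ : ∀ s ∈ Ioo a 2, m ≤ τ s) (hw : w 2 = 1) (hw0 : k = 0 → ∀ s, w s = 1) (hQ0 : 0 ≤ Q)
    (hQ : p 2 ≤ Q * |(k : ℝ)|) :
    HasEnergyBound a 2 k η w p ((4 * (Q / m) + 2) * √(1 + (k : ℝ) ^ 2)) := by
  have hk1 := one_le_sqrt_one_add_sq k
  have hQm : 0 ≤ Q / m * √(1 + (k : ℝ) ^ 2) := by positivity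
  have hbound : ∀ I : ℝ, m * I ≤ w 2 * p 2 → I ≤ Q / m * √(1 + (k : ℝ) ^ 2) := fun I hI =>
    calc I ≤ Q * |(k : ℝ)| / m := (le_div_iff₀' hm).2 (hI.trans (by rwa [hw, one_mul]))
      _ = Q / m * |(k : ℝ)| := by ring
      _ ≤ Q / m * √(1 + (k : ℝ) ^ 2) :=
          mul_le_mul_of_nonneg_left (abs_le_sqrt_one_add_sq k) (by positivity)
  have hrad := hbound _ (h.mul_integral_slope_sq_le hη hτ ha ha2 hmη)
  have htan := hbound _ (h.mul_integral_tangential_sq_le hη hτ ha ha2 hmτ)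
  refine ⟨?_, by linarith, by linarith⟩
  rcases eq_or_ne k 0 with hk | hk
  · simp only [hw0 hk, one_pow, mul_one]
    linarith [setIntegral_id_le a 2 ha2]
  · have hk2 : (1 : ℝ) ≤ (k : ℝ) ^ 2 := by
      exact_mod_cast (one_le_sq_iff_one_le_abs k).2 (Int.one_le_abs hk)
    linarith [h.integral_sq_le hk2 ha]

/-- The energy of each separated solution equals its boundary flux, so a linear bound on the fluxes
suffices. -/
theorem isDtN_of_flux_le {a Q : ℝ} {η τ : ℝ → ℝ} {w p : ℤ → ℝ → ℝ} (ha : 0 ≤ a) (ha2 : a ≤ 2)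
    {K : Set Plane} {A : Plane → Matrix (Fin 2) (Fin 2) ℝ} (hη : IsEllipticProfile a 2 η)
    (hτ : IsEllipticProfile a 2 τ)
    (hU : (Metric.ball 0 2 \ K : Set Plane) =ᵐ[volume] annulus a 2)
    (hA : ∀ᵐ x : Plane, x ∈ annulus a 2 → A x = polarTensor η τ x)
    (hK : a = 0 ∨ ∀ θ, polarPt a θ ∈ K)
    (hm : ∀ k : ℤ, IsRadialMode a 2 k η τ (w k) (p k)) (hw : ∀ k, w k 2 = 1)
    (hw0 : ∀ s, w 0 s = 1) (hQ0 : 0 ≤ Q) (hQ : ∀ k : ℤ, p k 2 ≤ Q * |(k : ℝ)|)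
    {Λ : HHalf →L[ℂ] HMinusHalf} (hΛ : IsMultiplier (fun k => p k 2) Λ) : IsDtN A K Λ := by
  obtain ⟨m, M, hm0, hM⟩ := hη.bounds
  obtain ⟨m', M', hm0', hM'⟩ := hτ.bounds
  exact isDtN_of_hasEnergyBound ha ha2 hη hτ hU hA hK hm hw (fun k => (hm k).hasEnergyBound hη hτ
    ha ha2 (lt_min hm0 hm0') (fun s hs => (min_le_left _ _).trans (hM s hs).1)
    (fun s hs => (min_le_right _ _).trans (hM' s hs).1) (hw k) (fun hk => hk ▸ hw0) hQ0 (hQ k)) hΛ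

/-! ### The radial profile of the coated disk -/

/-- The conductivity of the coated disk as a function of the radius. -/
def layeredProfile (L : ℕ) (r σ : ℕ → ℝ) (s : ℝ) : ℝ := layered L r σ (polarPt s 0)

section Profile

variable {L : ℕ} {r σ : ℕ → ℝ}

theorem mem_region_iff_of_norm_eq {x y : Plane} (h : ‖x‖ = ‖y‖) (j : ℕ) :
    x ∈ region L r j ↔ y ∈ region L r j := by
  unfold region
  split_ifs <;> simp [h]

theorem layered_eq_layeredProfile (x : Plane) : layered L r σ x = layeredProfile L r σ ‖x‖ := by
  have h : ‖x‖ = ‖polarPt ‖x‖ 0‖ := (norm_polarPt (norm_nonneg x) 0).symm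
  refine Finset.sum_congr rfl fun j _ => ?_
  by_cases hj : x ∈ region L r j
  · rw [indicator_of_mem hj, indicator_of_mem ((mem_region_iff_of_norm_eq h j).1 hj)]
  · rw [indicator_of_notMem hj, indicator_of_notMem (mt (mem_region_iff_of_norm_eq h j).2 hj)]

theorem measurableSet_region (j : ℕ) : MeasurableSet (region L r j) := by
  unfold region
  split_ifs
  · exact measurableSet_lt measurable_const measurable_norm
  · exact measurableSet_le measurable_norm measurable_const
  · exact (measurableSet_lt measurable_const measurable_norm).inter
      (measurableSet_le measurable_norm measurable_const)

theorem measurable_layered : Measurable (layered L r σ) :=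
  Finset.measurable_sum _ fun j _ => measurable_const.indicator (measurableSet_region j)

theorem measurable_layeredProfile : Measurable (layeredProfile L r σ) :=
  measurable_layered.comp
    (continuous_polarPt.comp (by fun_prop : Continuous fun s : ℝ => (s, (0 : ℝ)))).measurable

theorem norm_le_of_mem_region {j : ℕ} (hj : j ≠ 0) {x : Plane} (hx : x ∈ region L r j) :
    ‖x‖ ≤ r j := by
  unfold region at hx
  rw [if_neg hj] at hx
  split_ifs at hx with h
  · rw [h]
    exact hx
  · exact hx.2

theorem lt_norm_of_mem_region {j : ℕ} (hj : j ≠ L + 1) {x : Plane} (hx : x ∈ region L r j) :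
    r (j + 1) < ‖x‖ := by
  unfold region at hx
  split_ifs at hx with h
  · rw [h]
    exact hx
  · exact hx.1

theorem IsCoatedDisk.radius_le (h : IsCoatedDisk L r σ) {i j : ℕ} (hi : 1 ≤ i) (hij : i ≤ j)
    (hj : j ≤ L + 1) : r j ≤ r i := by
  induction j, hij using Nat.le_induction with
  | base => exact le_rfl
  | succ j hij ih =>
    exact (h.decreasing j (hi.trans hij) (by omega)).le.trans (ih (by omega))

theorem IsCoatedDisk.notMem_region (h : IsCoatedDisk L r σ) {i j : ℕ} (hij : i < j)
    (hj : j ≤ L + 1) {x : Plane} (hi : x ∈ region L r i) : x ∉ region L r j := by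
  intro hx
  have h1 := lt_norm_of_mem_region (by omega) hi
  have h2 := norm_le_of_mem_region (by omega) hx
  have h3 := h.radius_le (by omega : 1 ≤ i + 1) hij hj
  linarith

theorem IsCoatedDisk.layered_eq (h : IsCoatedDisk L r σ) {j : ℕ} (hj : j ≤ L + 1) {x : Plane}
    (hx : x ∈ region L r j) : layered L r σ x = σ j := by
  rw [layered, Finset.sum_eq_single_of_mem j (Finset.mem_range.2 (by omega)), indicator_of_mem hx]
  intro i hi hij
  have hi' : i ≤ L + 1 := by have := Finset.mem_range.1 hi; omega
  rw [indicator_of_notMem]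
  rcases lt_or_gt_of_ne hij with hlt | hlt
  · exact fun hxi => h.notMem_region hlt hj hxi hx
  · exact h.notMem_region hlt hi' hx

theorem IsCoatedDisk.layeredProfile_eq_one (h : IsCoatedDisk L r σ) {s : ℝ} (hs : 2 < s) :
    layeredProfile L r σ s = 1 := by
  rw [← h.background]
  refine h.layered_eq (Nat.zero_le _) ?_
  rw [region, if_pos rfl, mem_ofPred_eq, norm_polarPt (by linarith), h.outer]
  exact hs

theorem IsCoatedDisk.layeredProfile_eq (h : IsCoatedDisk L r σ) {j : ℕ} (hj : 1 ≤ j) (hjL : j ≤ L)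
    {s : ℝ} (hs : r (j + 1) < s) (hs' : s ≤ r j) : layeredProfile L r σ s = σ j := by
  refine h.layered_eq (by omega) ?_
  have h1 : 1 ≤ r (j + 1) := h.inner ▸ h.radius_le (by omega) (by omega) le_rfl
  rw [region, if_neg (by omega), if_neg (by omega), mem_ofPred_eq, norm_polarPt (by linarith)]
  exact ⟨hs, hs'⟩

theorem IsCoatedDisk.exists_layeredProfile_eq (h : IsCoatedDisk L r σ) {s : ℝ} (hs : 1 < s) :
    ∃ j ≤ L, layeredProfile L r σ s = σ j := by
  by_cases h2 : 2 < s
  · exact ⟨0, Nat.zero_le _, by rw [h.layeredProfile_eq_one h2, h.background]⟩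
  · classical
    have hex : ∃ j, r (j + 1) < s := ⟨L, by rwa [h.inner]⟩
    have hj := Nat.find_spec hex
    have hjL : Nat.find hex ≤ L := Nat.find_min' hex (by rwa [h.inner])
    have hj0 : Nat.find hex ≠ 0 := by
      intro h0
      rw [h0, zero_add, h.outer] at hj
      exact h2 hj
    obtain ⟨i, hi⟩ := Nat.exists_eq_succ_of_ne_zero hj0
    have hmin : ¬ r (i + 1) < s := Nat.find_min hex (by omega)
    rw [hi] at hj hjL
    exact ⟨i + 1, hjL, h.layeredProfile_eq (by omega) hjL hj (not_lt.1 hmin)⟩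

theorem IsCoatedDisk.conductivity_pos (h : IsCoatedDisk L r σ) {j : ℕ} (hj : j ≤ L) : 0 < σ j := by
  rcases Nat.eq_zero_or_pos j with rfl | hj0
  · rw [h.background]
    exact one_pos
  · exact h.coating j hj0 hj

theorem IsCoatedDisk.exists_conductivity_bounds (h : IsCoatedDisk L r σ) :
    ∃ m S : ℝ, 0 < m ∧ ∀ j ≤ L, m ≤ σ j ∧ σ j ≤ S := by
  have hne : (Finset.range (L + 1)).Nonempty := ⟨0, by simp⟩
  refine ⟨(Finset.range (L + 1)).inf' hne σ, (Finset.range (L + 1)).sup' hne σ, ?_, fun j hj => ?_⟩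
  · rw [Finset.lt_inf'_iff]
    exact fun j hj => h.conductivity_pos (Nat.lt_succ_iff.1 (Finset.mem_range.1 hj))
  · have hj' := Finset.mem_range.2 (Nat.lt_succ_of_le hj)
    exact ⟨Finset.inf'_le σ hj', Finset.le_sup' σ hj'⟩

theorem IsCoatedDisk.isEllipticProfile_comp (h : IsCoatedDisk L r σ) {a b : ℝ} {g : ℝ → ℝ}
    (hg : Measurable g) (hg1 : ∀ s ∈ Ioo a b, 1 < g s) :
    IsEllipticProfile a b fun s => layeredProfile L r σ (g s) := by
  obtain ⟨m, S, hm, hS⟩ := h.exists_conductivity_bounds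
  refine ⟨measurable_layeredProfile.comp hg, m, S, hm, fun s hs => ?_⟩
  obtain ⟨j, hj, hgs⟩ := h.exists_layeredProfile_eq (hg1 s hs)
  rw [hgs]
  exact hS j hj

end Profile

/-! ### The radial equation in logarithmic coordinates -/

/-- The radial equation `V' = P / C`, `P' = n² C V` on `(0, T)` of the separated solutions of
frequency `n` for the isotropic conductivity `C(log r)`, in the variable `τ = log r`, with no flux
at `τ = 0`. The equations may fail on a countable set. -/
structure IsLogMode (n : ℝ) (C : ℝ → ℝ) (T : ℝ) (V P : ℝ → ℝ) : Prop where
  continuous_fun : Continuous V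
  continuous_flux : Continuous P
  flux_zero : P 0 = 0
  hasDerivAt : ∃ S : Set ℝ, S.Countable ∧ ∀ τ ∈ Ioo 0 T \ S,
    HasDerivAt V (P τ / C τ) τ ∧ HasDerivAt P (n ^ 2 * C τ * V τ) τ

/-- The solution `V` of the radial equation in a layer of constant conductivity `q`, with the
values `V = v` and `P = p` at `τ = T`. -/
def layerFun (n q v p T τ : ℝ) : ℝ :=
  v * Real.cosh (n * (τ - T)) + p / (n * q) * Real.sinh (n * (τ - T))

/-- The flux `P` that belongs to `layerFun`. -/
def layerFlux (n q v p T τ : ℝ) : ℝ :=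
  p * Real.cosh (n * (τ - T)) + n * q * v * Real.sinh (n * (τ - T))

section Layer

variable {n q v p T τ : ℝ}

theorem layerFun_self (n q v p T : ℝ) : layerFun n q v p T T = v := by
  simp [layerFun]

theorem layerFlux_self (n q v p T : ℝ) : layerFlux n q v p T T = p := by
  simp [layerFlux]

theorem hasDerivAt_mul_sub (n T τ : ℝ) : HasDerivAt (fun t : ℝ => n * (t - T)) n τ := by
  simpa using ((hasDerivAt_id τ).sub_const T).const_mul n

theorem hasDerivAt_layerFun (hn : n ≠ 0) (hq : q ≠ 0) :
    HasDerivAt (layerFun n q v p T) (layerFlux n q v p T τ / q) τ := by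
  refine (((hasDerivAt_mul_sub n T τ).cosh.const_mul v).add
    ((hasDerivAt_mul_sub n T τ).sinh.const_mul (p / (n * q)))).congr_deriv ?_
  rw [layerFlux]
  field_simp
  ring

theorem hasDerivAt_layerFlux (hn : n ≠ 0) (hq : q ≠ 0) :
    HasDerivAt (layerFlux n q v p T) (n ^ 2 * q * layerFun n q v p T τ) τ := by
  refine (((hasDerivAt_mul_sub n T τ).cosh.const_mul p).add
    ((hasDerivAt_mul_sub n T τ).sinh.const_mul (n * q * v))).congr_deriv ?_
  rw [layerFun]
  field_simp
  ring

theorem continuous_layerFun : Continuous (layerFun n q v p T) := by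
  unfold layerFun
  fun_prop

theorem continuous_layerFlux : Continuous (layerFlux n q v p T) := by
  unfold layerFlux
  fun_prop

theorem mul_cosh_le_layerFun (hn : 0 ≤ n) (hq : 0 ≤ q) (hτ : T ≤ τ) (hp : 0 ≤ p) :
    v * Real.cosh (n * (τ - T)) ≤ layerFun n q v p T τ :=
  le_add_of_nonneg_right <| mul_nonneg (div_nonneg hp (mul_nonneg hn hq)) <|
    Real.sinh_nonneg_iff.2 (mul_nonneg hn (sub_nonneg.2 hτ))

theorem layerFun_pos (hn : 0 ≤ n) (hq : 0 ≤ q) (hτ : T ≤ τ) (hv : 0 < v) (hp : 0 ≤ p) :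
    0 < layerFun n q v p T τ :=
  (mul_pos hv (Real.cosh_pos _)).trans_le (mul_cosh_le_layerFun hn hq hτ hp)

theorem layerFlux_nonneg (hn : 0 ≤ n) (hq : 0 ≤ q) (hτ : T ≤ τ) (hv : 0 ≤ v) (hp : 0 ≤ p) :
    0 ≤ layerFlux n q v p T τ :=
  add_nonneg (mul_nonneg hp (Real.cosh_pos _).le) <| mul_nonneg (mul_nonneg (mul_nonneg hn hq) hv)
    (Real.sinh_nonneg_iff.2 (mul_nonneg hn (sub_nonneg.2 hτ)))

theorem layerFlux_le {S : ℝ} (hn : 0 < n) (hq : 0 < q) (hqS : q ≤ S) (hτ : T ≤ τ) (hv : 0 ≤ v)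
    (hp : 0 ≤ p) (hpv : p ≤ n * S * v) :
    layerFlux n q v p T τ ≤ n * S * layerFun n q v p T τ := by
  have hcosh : (n * S * v - p) * Real.sinh (n * (τ - T)) ≤
      (n * S * v - p) * Real.cosh (n * (τ - T)) :=
    mul_le_mul_of_nonneg_left (Real.sinh_lt_cosh _).le (sub_nonneg.2 hpv)
  have hsinh : 0 ≤ (S - q) * (n * v + p / q) * Real.sinh (n * (τ - T)) :=
    mul_nonneg (mul_nonneg (sub_nonneg.2 hqS) (by positivity))
      (Real.sinh_nonneg_iff.2 (mul_nonneg hn.le (sub_nonneg.2 hτ)))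
  have hsum : n * S * layerFun n q v p T τ - layerFlux n q v p T τ =
      (n * S * v - p) * Real.cosh (n * (τ - T)) - (n * S * v - p) * Real.sinh (n * (τ - T)) +
        (S - q) * (n * v + p / q) * Real.sinh (n * (τ - T)) := by
    rw [layerFun, layerFlux]
    field_simp
    ring
  linarith

theorem layerFlux_sub_mul_layerFun (hn : n ≠ 0) :
    layerFlux n 1 v p T τ - n * layerFun n 1 v p T τ = (p - n * v) * Real.exp (-(n * (τ - T))) := by
  rw [← Real.cosh_sub_sinh, layerFlux, layerFun]
  field_simp
  ring

/-- In the background medium, the increasing exponential dominates the function, while the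
combination `P - n V` only sees the decreasing one. -/
theorem abs_layerFlux_div_layerFun_sub_le (hn : 0 < n) (hτ : T ≤ τ) (hv : 0 < v) (hp : 0 ≤ p) :
    |layerFlux n 1 v p T τ / layerFun n 1 v p T τ - n| ≤
      2 * (|p - n * v| / v) * Real.exp (-(n * (τ - T))) ^ 2 := by
  have hpos := layerFun_pos hn.le zero_le_one hτ hv hp
  have hlower : v * (Real.exp (n * (τ - T)) / 2) ≤ layerFun n 1 v p T τ := by
    refine le_trans (mul_le_mul_of_nonneg_left ?_ hv.le)
      (mul_cosh_le_layerFun hn.le zero_le_one hτ hp)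
    rw [Real.cosh_eq]
    linarith [Real.exp_pos (-(n * (τ - T)))]
  rw [div_sub' hpos.ne', mul_comm _ n, layerFlux_sub_mul_layerFun hn.ne', abs_div, abs_mul,
    Real.abs_exp, abs_of_pos hpos, div_le_iff₀ hpos]
  calc |p - n * v| * Real.exp (-(n * (τ - T)))
      = 2 * (|p - n * v| / v) * Real.exp (-(n * (τ - T))) ^ 2 *
          (v * (Real.exp (n * (τ - T)) / 2)) := by
        rw [Real.exp_neg]
        field_simp
    _ ≤ _ := mul_le_mul_of_nonneg_left hlower (by positivity)

theorem IsLogMode.extend {C V P : ℝ → ℝ} {T' : ℝ} (h : IsLogMode n C T V P) (hn : n ≠ 0)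
    (hq : q ≠ 0) (hT : 0 ≤ T) (hC : ∀ τ, T < τ → τ < T' → C τ = q) :
    IsLogMode n C T' (fun τ => if τ ≤ T then V τ else layerFun n q (V T) (P T) T τ)
      (fun τ => if τ ≤ T then P τ else layerFlux n q (V T) (P T) T τ) := by
  obtain ⟨S, hS, hd⟩ := h.hasDerivAt
  refine ⟨h.continuous_fun.if_le continuous_layerFun continuous_id continuous_const ?_,
    h.continuous_flux.if_le continuous_layerFlux continuous_id continuous_const ?_,
    (if_pos hT).trans h.flux_zero, insert T S, hS.insert T, ?_⟩
  · rintro τ rfl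
    exact (layerFun_self ..).symm
  · rintro τ rfl
    exact (layerFlux_self ..).symm
  · rintro τ ⟨hτ, hτS⟩
    rw [mem_insert_iff, not_or] at hτS
    rcases lt_or_gt_of_ne hτS.1 with hlt | hgt
    · obtain ⟨hV, hP⟩ := hd τ ⟨⟨hτ.1, hlt⟩, hτS.2⟩
      have hev : ∀ᶠ t in 𝓝 τ, t ≤ T := (eventually_lt_nhds hlt).mono fun _ => le_of_lt
      simp only [if_pos hlt.le]
      exact ⟨hV.congr_of_eventuallyEq (hev.mono fun t ht => if_pos ht),
        hP.congr_of_eventuallyEq (hev.mono fun t ht => if_pos ht)⟩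
    · have hev : ∀ᶠ t in 𝓝 τ, ¬ t ≤ T := (eventually_gt_nhds hgt).mono fun _ => not_le_of_gt
      simp only [if_neg (not_le_of_gt hgt), hC τ hgt hτ.2]
      exact ⟨(hasDerivAt_layerFun hn hq).congr_of_eventuallyEq (hev.mono fun t ht => if_neg ht),
        (hasDerivAt_layerFlux hn hq).congr_of_eventuallyEq (hev.mono fun t ht => if_neg ht)⟩

end Layer

/-! ### Separated solutions for the coated disk -/

/-- The separated solution of frequency `n` for the coated disk, on the whole exterior `τ > 0` of
its core in the variable `τ = log r`, with its behaviour in the background `r > 2`. The number `S`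
is an upper bound for the conductivities, and the solution is normalized for `n = 0` only. -/
structure IsCoatedMode (C : ℝ → ℝ) (S : ℝ) (n : ℕ) (V P : ℝ → ℝ) : Prop where
  isLogMode : ∀ T, IsLogMode n C T V P
  fun_log_two_pos : 0 < V (Real.log 2)
  flux_log_two_nonneg : 0 ≤ P (Real.log 2)
  flux_log_two_le : P (Real.log 2) ≤ n * S * V (Real.log 2)
  fun_eq : ∀ τ, Real.log 2 < τ → V τ = layerFun n 1 (V (Real.log 2)) (P (Real.log 2)) (Real.log 2) τ
  flux_eq : ∀ τ, Real.log 2 < τ →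
    P τ = layerFlux n 1 (V (Real.log 2)) (P (Real.log 2)) (Real.log 2) τ
  fun_eq_one : n = 0 → ∀ τ, V τ = 1

section CoatedDisk

variable {L : ℕ} {r σ : ℕ → ℝ} {S : ℝ} {n : ℕ}

theorem IsCoatedDisk.exists_logMode_layers (h : IsCoatedDisk L r σ) (hS : ∀ j ≤ L, σ j ≤ S)
    {n : ℝ} (hn : 0 < n) (i : ℕ) (hi : i ≤ L) :
    ∃ V P, IsLogMode n (fun τ => layeredProfile L r σ (Real.exp τ)) (Real.log (r (L + 1 - i))) V P ∧
      0 < V (Real.log (r (L + 1 - i))) ∧ 0 ≤ P (Real.log (r (L + 1 - i))) ∧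
      P (Real.log (r (L + 1 - i))) ≤ n * S * V (Real.log (r (L + 1 - i))) := by
  induction i with
  | zero =>
    have hS0 : 0 ≤ S := (h.conductivity_pos (Nat.zero_le L)).le.trans (hS 0 (Nat.zero_le L))
    refine ⟨fun _ => 1, fun _ => 0, ⟨continuous_const, continuous_const, rfl, ∅, countable_empty,
      ?_⟩, one_pos, le_rfl, by positivity⟩
    rintro τ ⟨hτ, -⟩
    rw [Nat.sub_zero, h.inner, Real.log_one] at hτ
    exact absurd (hτ.1.trans hτ.2) (lt_irrefl _)
  | succ i ih =>
    obtain ⟨V, P, hVP, hV, hP, hPV⟩ := ih (by omega)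
    obtain ⟨j, hj⟩ : ∃ j, L + 1 - (i + 1) = j := ⟨_, rfl⟩
    rw [show L + 1 - i = j + 1 by omega] at hVP hV hP hPV
    have hj1 : 1 ≤ j := by omega
    have hjL : j ≤ L := by omega
    have hr1 : 1 ≤ r (j + 1) := h.inner ▸ h.radius_le (by omega) (by omega) le_rfl
    have hr : r (j + 1) < r j := h.decreasing j hj1 hjL
    have hlog : Real.log (r (j + 1)) < Real.log (r j) := Real.log_lt_log (by linarith) hr
    have hσ := h.conductivity_pos hjL
    rw [hj]
    refine ⟨_, _, hVP.extend (q := σ j) hn.ne' hσ.ne' (Real.log_nonneg hr1) fun τ hτ hτ' => ?_, ?_⟩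
    · exact h.layeredProfile_eq hj1 hjL ((Real.log_lt_iff_lt_exp (by linarith)).1 hτ)
        ((Real.lt_log_iff_exp_lt (by linarith)).1 hτ').le
    · simp only [if_neg (not_le_of_gt hlog)]
      exact ⟨layerFun_pos hn.le hσ.le hlog.le hV hP,
        layerFlux_nonneg hn.le hσ.le hlog.le hV.le hP,
        layerFlux_le hn hσ (hS j hjL) hlog.le hV.le hP hPV⟩

theorem isCoatedMode_zero (C : ℝ → ℝ) (S : ℝ) : IsCoatedMode C S 0 (fun _ => 1) (fun _ => 0) where
  isLogMode T := ⟨continuous_const, continuous_const, rfl, ∅, countable_empty, fun τ _ =>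
    ⟨by simpa using hasDerivAt_const τ (1 : ℝ), by simpa using hasDerivAt_const τ (0 : ℝ)⟩⟩
  fun_log_two_pos := one_pos
  flux_log_two_nonneg := le_rfl
  flux_log_two_le := by simp
  fun_eq τ _ := by simp [layerFun]
  flux_eq τ _ := by simp [layerFlux]
  fun_eq_one _ _ := rfl

theorem IsCoatedDisk.exists_isCoatedMode (h : IsCoatedDisk L r σ) (hS : ∀ j ≤ L, σ j ≤ S) (n : ℕ) :
    ∃ V P, IsCoatedMode (fun τ => layeredProfile L r σ (Real.exp τ)) S n V P := by
  rcases Nat.eq_zero_or_pos n with rfl | hn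
  · exact ⟨_, _, isCoatedMode_zero _ S⟩
  have hn' : (0 : ℝ) < n := Nat.cast_pos.2 hn
  obtain ⟨V, P, hVP, hV, hP, hPV⟩ := h.exists_logMode_layers hS hn' L le_rfl
  rw [Nat.add_sub_cancel_left, h.outer] at hVP hV hP hPV
  refine ⟨_, _, fun T => hVP.extend (q := 1) hn'.ne' one_ne_zero (Real.log_nonneg one_le_two)
      fun τ hτ _ => h.layeredProfile_eq_one ((Real.log_lt_iff_lt_exp two_pos).1 hτ),
    ?_, ?_, ?_, fun τ hτ => ?_, fun τ hτ => ?_, fun hn0 => absurd hn0 hn.ne'⟩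
  · simpa using hV
  · simpa using hP
  · simpa using hPV
  · simp only [le_refl, if_true, if_neg (not_le_of_gt hτ)]
  · simp only [le_refl, if_true, if_neg (not_le_of_gt hτ)]

namespace IsCoatedMode

variable {C V P : ℝ → ℝ} {τ : ℝ}

theorem fun_pos (h : IsCoatedMode C S n V P) (hτ : Real.log 2 < τ) : 0 < V τ := by
  rw [h.fun_eq τ hτ]
  exact layerFun_pos n.cast_nonneg zero_le_one hτ.le h.fun_log_two_pos h.flux_log_two_nonneg

theorem abs_flux_sub_div_le (h : IsCoatedMode C S n V P) :
    |P (Real.log 2) - n * V (Real.log 2)| / V (Real.log 2) ≤ (1 + S) * n := by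
  rw [div_le_iff₀ h.fun_log_two_pos, abs_le]
  have hV : 0 ≤ n * V (Real.log 2) := mul_nonneg n.cast_nonneg h.fun_log_two_pos.le
  constructor <;> linarith [h.flux_log_two_nonneg, h.flux_log_two_le]

theorem abs_flux_div_fun_sub_le (h : IsCoatedMode C S n V P) (hτ : Real.log 2 < τ) :
    |P τ / V τ - n| ≤ 2 * (|P (Real.log 2) - n * V (Real.log 2)| / V (Real.log 2)) *
      Real.exp (-(n * (τ - Real.log 2))) ^ 2 := by
  rcases Nat.eq_zero_or_pos n with rfl | hn
  · have hP : P (Real.log 2) = 0 :=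
      le_antisymm (by simpa using h.flux_log_two_le) h.flux_log_two_nonneg
    simp [h.flux_eq τ hτ, layerFlux, hP]
  · rw [h.fun_eq τ hτ, h.flux_eq τ hτ]
    exact abs_layerFlux_div_layerFun_sub_le (Nat.cast_pos.2 hn) hτ.le h.fun_log_two_pos
      h.flux_log_two_nonneg

end IsCoatedMode

end CoatedDisk

/-! ### Separated solutions from the logarithmic equation -/

theorem IsBddProfile.div_id {a b : ℝ} (ha : 0 < a) {g : ℝ → ℝ} (hg : IsBddProfile a b g) :
    IsBddProfile a b fun s => g s / s := by
  have hinv : IsBddProfile a b fun s => s⁻¹ := by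
    refine ⟨measurable_inv, a⁻¹, fun s hs => ?_⟩
    rw [abs_of_pos (inv_pos.2 (ha.trans hs.1))]
    exact inv_anti₀ ha hs.1.le
  simpa only [div_eq_mul_inv] using hg.mul hinv

/-- The hypothesis on `T` says that `dτ / dr = C / (η r)` with `C² = η τ`: the change of variables
`τ = T(r)` makes an anisotropic radial conductivity isotropic. -/
theorem IsLogMode.isRadialMode {a b n κ : ℝ} {η τ C T V P : ℝ → ℝ} (ha : 0 < a) (hab : a ≤ b)
    (hη : ∀ s ∈ Ioo a b, 0 < η s) (hτ : ∀ s ∈ Ioo a b, 0 < τ s) (hV : IsLogMode n C (T b) V P)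
    (hκ : κ ^ 2 = n ^ 2) (hT : Continuous T) (hTa : T a = 0) (hTm : StrictMonoOn T (Icc a b))
    (hC : ∀ s ∈ Ioo a b, C (T s) ^ 2 = η s * τ s) {S : Set ℝ} (hS : S.Countable)
    (hd : ∀ s ∈ Ioo a b \ S, HasDerivAt T (C (T s) / (η s * s)) s) :
    IsRadialMode a b κ η τ (fun s => V (T s)) (fun s => P (T s)) := by
  obtain ⟨U, hU, hVd⟩ := hV.hasDerivAt
  have hmaps : ∀ s ∈ Ioo a b, T s ∈ Ioo 0 (T b) := fun s hs =>
    ⟨hTa ▸ hTm (left_mem_Icc.2 hab) (Ioo_subset_Icc_self hs) hs.1,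
      hTm (Ioo_subset_Icc_self hs) (right_mem_Icc.2 hab) hs.2⟩
  have hVT : Continuous fun s => V (T s) := hV.continuous_fun.comp hT
  have hPT : Continuous fun s => P (T s) := hV.continuous_flux.comp hT
  refine ⟨hVT, hPT, (IsBddProfile.of_continuous hPT).div_id ha,
    (IsBddProfile.of_continuous (continuous_const.mul hVT)).div_id ha,
    ⟨S ∪ {s ∈ Ioo a b | T s ∈ U}, hS.union ?_, ?_⟩, by rw [hTa, hV.flux_zero]⟩
  · exact MapsTo.countable_of_injOn (f := T) (fun s hs => hs.2)
      (hTm.injOn.mono fun s hs => Ioo_subset_Icc_self hs.1) hU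
  · rintro s ⟨hs, hsU⟩
    rw [mem_union, not_or] at hsU
    obtain ⟨hV', hP'⟩ := hVd (T s) ⟨hmaps s hs, fun h => hsU.2 ⟨hs, h⟩⟩
    have hTs := hd s ⟨hs, hsU.1⟩
    have hs0 : s ≠ 0 := (ha.trans hs.1).ne'
    have hη0 : η s ≠ 0 := (hη s hs).ne'
    have hC0 : C (T s) ≠ 0 := fun h => (mul_pos (hη s hs) (hτ s hs)).ne' (by simp [← hC s hs, h])
    refine ⟨(hV'.comp s hTs).congr_deriv ?_, (hP'.comp s hTs).congr_deriv ?_⟩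
    · rw [slope]
      field_simp
    · field_simp
      rw [hκ, hC s hs]
      ring

theorem IsRadialMode.mul_const {a b κ : ℝ} {η τ w p : ℝ → ℝ} (h : IsRadialMode a b κ η τ w p)
    (c : ℝ) : IsRadialMode a b κ η τ (fun s => w s * c) (fun s => p s * c) := by
  obtain ⟨S, hS, hd⟩ := h.hasDerivAt
  refine ⟨h.continuous_fun.mul_const c, h.continuous_flux.mul_const c, ?_, ?_,
    ⟨S, hS, fun s hs => ?_⟩, by rw [h.flux_inner, zero_mul]⟩
  · simpa only [mul_div_right_comm, mul_comm c] using h.isBddProfile_flux.const_mul c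
  · simpa only [mul_div_right_comm, mul_comm c, mul_assoc] using h.isBddProfile_fun.const_mul c
  · refine ⟨((hd s hs).1.mul_const c).congr_deriv ?_, ((hd s hs).2.mul_const c).congr_deriv ?_⟩
    · rw [slope, slope]
      ring
    · ring

theorem hasDerivAt_half_pow (n : ℕ) {s : ℝ} (hs : s ≠ 0) :
    HasDerivAt (fun s : ℝ => (s / 2) ^ n) (n * (s / 2) ^ n / s) s := by
  refine (((hasDerivAt_id s).div_const 2).pow n).congr_deriv ?_
  rcases n with _ | n
  · simp
  · rw [Nat.add_sub_cancel, pow_succ, id_eq]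
    field_simp

theorem isBddProfile_half_pow (n : ℕ) :
    IsBddProfile 0 2 fun s => n * (s / 2) ^ n / s := by
  refine ⟨by fun_prop, n, fun s hs => ?_⟩
  have hs0 : 0 ≤ s / 2 := (half_pos hs.1).le
  have hs1 : s / 2 ≤ 1 := (div_le_one two_pos).2 hs.2.le
  rw [abs_of_nonneg (div_nonneg (mul_nonneg n.cast_nonneg (pow_nonneg hs0 n)) hs.1.le),
    div_le_iff₀ hs.1]
  rcases n with _ | n
  · simp
  · have hpow : (s / 2) ^ (n + 1) ≤ s / 2 := pow_le_of_le_one hs0 hs1 n.succ_ne_zero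
    exact mul_le_mul_of_nonneg_left (hpow.trans (half_le_self hs.1.le)) (Nat.cast_nonneg _)

theorem abs_intCast_eq_natAbs (k : ℤ) : |(k : ℝ)| = k.natAbs := by
  rw [Nat.cast_natAbs, Int.cast_abs]

theorem isRadialMode_disk (k : ℤ) :
    IsRadialMode 0 2 k (fun _ => 1) (fun _ => 1) (fun s => (s / 2) ^ k.natAbs)
      (fun s => k.natAbs * (s / 2) ^ k.natAbs) := by
  have hbdd : IsBddProfile 0 2 fun s => k * (s / 2) ^ k.natAbs / s := by
    refine ⟨by fun_prop, ?_⟩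
    simpa only [abs_div, abs_mul, abs_intCast_eq_natAbs, Nat.abs_cast] using
      (isBddProfile_half_pow k.natAbs).bounded
  refine ⟨by fun_prop, by fun_prop, isBddProfile_half_pow k.natAbs, hbdd,
    ⟨∅, countable_empty, fun s hs => ?_⟩, ?_⟩
  · have hder := hasDerivAt_half_pow k.natAbs hs.1.1.ne'
    refine ⟨hder.congr_deriv (by rw [slope, inv_one, one_mul]),
      (hder.const_mul _).congr_deriv ?_⟩
    rw [← abs_intCast_eq_natAbs, ← mul_div_assoc, ← mul_assoc, abs_mul_abs_self]
    ring
  · rcases Nat.eq_zero_or_pos k.natAbs with h | h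
    · rw [h, Nat.cast_zero, zero_mul]
    · rw [zero_div, zero_pow h.ne', mul_zero]

/-! ### The push-forward by a radial map -/

theorem radField_mul_add_tanField_mul {x : Plane} (hx : x ≠ 0) (i j : Fin 2) :
    radField i x * radField j x + tanField i x * tanField j x =
      (1 : Matrix (Fin 2) (Fin 2) ℝ) i j := by
  have hq := radField_sq_add_sq hx
  fin_cases i <;> fin_cases j <;>
    simp only [Fin.zero_eta, Fin.mk_one, tanField_zero, tanField_one, Matrix.one_apply_eq,
      Matrix.one_apply_ne, ne_eq, zero_ne_one, one_ne_zero, not_false_eq_true] <;>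
    linarith

theorem isotropic_eq_polarTensor {s : Plane → ℝ} {c : ℝ → ℝ} {x : Plane} (hs : s x = c ‖x‖)
    (hx : x ≠ 0) : isotropic s x = polarTensor c c x := by
  ext i j
  rw [isotropic, Matrix.smul_apply, ← radField_mul_add_tanField_mul hx, hs, smul_eq_mul, mul_add]
  rfl

theorem transpose_polarTensor (η τ : ℝ → ℝ) (x : Plane) :
    (polarTensor η τ x)ᵀ = polarTensor η τ x := by
  ext i j
  simp only [polarTensor, Matrix.transpose_apply, Matrix.of_apply, mul_comm]

theorem smul_polarTensor (c : ℝ) (η τ : ℝ → ℝ) (x : Plane) :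
    c • polarTensor η τ x = polarTensor (fun s => c * η s) (fun s => c * τ s) x := by
  ext i j
  simp only [polarTensor, Matrix.smul_apply, Matrix.of_apply, smul_eq_mul]
  ring

theorem det_polarTensor (η τ : ℝ → ℝ) {x : Plane} (hx : x ≠ 0) :
    (polarTensor η τ x).det = η ‖x‖ * τ ‖x‖ := by
  simp only [Matrix.det_fin_two, polarTensor, Matrix.of_apply, tanField_zero, tanField_one]
  linear_combination η ‖x‖ * τ ‖x‖ * (radField 0 x ^ 2 + radField 1 x ^ 2 + 1) *
    radField_sq_add_sq hx

theorem polarTensor_mul (η τ η' τ' : ℝ → ℝ) {x : Plane} (hx : x ≠ 0) :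
    polarTensor η τ x * polarTensor η' τ' x =
      polarTensor (fun s => η s * η' s) (fun s => τ s * τ' s) x := by
  ext i j
  simp only [Matrix.mul_apply, Fin.sum_univ_two, polarTensor, Matrix.of_apply, tanField_zero,
    tanField_one]
  linear_combination (η ‖x‖ * η' ‖x‖ * (radField i x * radField j x) +
    τ ‖x‖ * τ' ‖x‖ * (tanField i x * tanField j x)) * radField_sq_add_sq hx

theorem hasFDerivAt_norm {x : Plane} (hx : x ≠ 0) :
    HasFDerivAt (fun z : Plane => ‖z‖) (‖x‖⁻¹ • innerSL ℝ x) x := by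
  have hn : ‖x‖ ^ 2 ≠ 0 := pow_ne_zero 2 (norm_ne_zero_iff.2 hx)
  have h := ((hasStrictFDerivAt_norm_sq x).hasFDerivAt).sqrt hn
  simp only [Real.sqrt_sq (norm_nonneg _)] at h
  refine h.congr_fderiv ?_
  ext v
  simp only [_root_.smul_apply, smul_eq_mul, nsmul_eq_mul, Nat.cast_ofNat]
  have : ‖x‖ ≠ 0 := norm_ne_zero_iff.2 hx
  field_simp

theorem jacobian_radial {F : Plane → Plane} {g : ℝ → ℝ} {d : ℝ} {x : Plane} (hx : x ≠ 0)
    (hF : ∀ z, F z = (g ‖z‖ / ‖z‖) • z) (hg : HasDerivAt g d ‖x‖) :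
    jacobian F x = polarTensor (fun _ => d) (fun s => g s / s) x := by
  have hn : ‖x‖ ≠ 0 := norm_ne_zero_iff.2 hx
  have hquot : HasDerivAt (fun s => g s / s) ((d - g ‖x‖ / ‖x‖) / ‖x‖) ‖x‖ := by
    refine (hg.div (hasDerivAt_id ‖x‖) hn).congr_deriv ?_
    simp only [id]
    field_simp
  have hder : HasFDerivAt F _ x :=
    ((hquot.comp_hasFDerivAt x (hasFDerivAt_norm hx)).smul (hasFDerivAt_id x)).congr_of_eventuallyEq
      (Eventually.of_forall hF)
  ext i j
  have hδ : (EuclideanSpace.single j (1 : ℝ) : Plane) i =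
      radField i x * radField j x + tanField i x * tanField j x := by
    rw [radField_mul_add_tanField_mul hx, PiLp.single_apply, Matrix.one_apply]
  rw [jacobian, Matrix.of_apply, hder.fderiv]
  simp only [_root_.add_apply, _root_.smul_apply, ContinuousLinearMap.id_apply,
    ContinuousLinearMap.smulRight_apply, PiLp.add_apply, PiLp.smul_apply, innerSL_apply_apply,
    EuclideanSpace.inner_single_right, smul_eq_mul, hδ, polarTensor, Matrix.of_apply, radField,
    Function.comp_apply, id, starRingEnd_apply, star_trivial, one_mul]
  field_simp
  ring

theorem radField_smul {t : ℝ} (ht : 0 < t) (i : Fin 2) (x : Plane) :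
    radField i (t • x) = radField i x := by
  rw [radField, radField, norm_smul, Real.norm_of_nonneg ht.le, PiLp.smul_apply, smul_eq_mul,
    mul_div_mul_left _ _ ht.ne']

theorem tanField_smul {t : ℝ} (ht : 0 < t) (i : Fin 2) (x : Plane) :
    tanField i (t • x) = tanField i x := by
  fin_cases i
  · simp only [Fin.zero_eta, tanField_zero, radField_smul ht]
  · simp only [Fin.mk_one, tanField_one, radField_smul ht]

/-- In terms of the inverse `b` of the radial part `g` of the map, the push-forward divides the
radial conductivity by `s b'(s) / b(s)` and multiplies the tangential one by it. -/
theorem pushForward_radial {F : Plane → Plane} {g b b' f : ℝ → ℝ} {c : Plane → ℝ} {y : Plane}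
    (hF : ∀ z, F z = (g ‖z‖ / ‖z‖) • z) (hg0 : ∀ t, 0 ≤ t → 0 ≤ g t)
    (hgb : ∀ t, 0 ≤ t → (g t = ‖y‖ ↔ t = b ‖y‖)) (hy : y ≠ 0) (hb : 0 < b ‖y‖)
    (hb' : 0 < b' ‖y‖) (hg : HasDerivAt g (b' ‖y‖)⁻¹ (b ‖y‖)) (hc : ∀ x, c x = f ‖x‖) :
    pushForward F c y = polarTensor (fun s => f (b s) * (s * b' s / b s)⁻¹)
      (fun s => f (b s) * (s * b' s / b s)) y := by
  have hy0 : 0 < ‖y‖ := norm_pos_iff.2 hy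
  have hpre : F (Function.invFun F y) = y := by
    refine Function.invFun_eq ⟨(b ‖y‖ / ‖y‖) • y, ?_⟩
    rw [hF, norm_smul, Real.norm_of_nonneg (div_pos hb hy0).le, div_mul_cancel₀ _ hy0.ne',
      (hgb _ hb.le).2 rfl, smul_smul, div_mul_div_cancel₀ hb.ne', div_self hy0.ne', one_smul]
  rw [pushForward]
  generalize Function.invFun F y = x at hpre
  have hx : x ≠ 0 := by
    rintro rfl
    exact hy (by rw [← hpre, hF, smul_zero])
  have hx0 : 0 < ‖x‖ := norm_pos_iff.2 hx
  have hgx : g ‖x‖ = ‖y‖ := by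
    rw [← hpre, hF, norm_smul, Real.norm_of_nonneg (div_nonneg (hg0 _ hx0.le) hx0.le),
      div_mul_cancel₀ _ hx0.ne']
  have hxb : ‖x‖ = b ‖y‖ := (hgb _ hx0.le).1 hgx
  have hratio : 0 < g ‖x‖ / ‖x‖ := div_pos (hgx ▸ hy0) hx0
  rw [← hxb] at hg
  rw [jacobian_radial hx hF hg, isotropic_eq_polarTensor (hc x) hx, transpose_polarTensor,
    polarTensor_mul _ _ _ _ hx, polarTensor_mul _ _ _ _ hx, smul_polarTensor,
    det_polarTensor _ _ hx, abs_of_pos (mul_pos (inv_pos.2 hb') hratio)]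
  have hbx : b ‖y‖ ≠ 0 := hb.ne'
  ext i j
  rw [polarTensor, polarTensor, Matrix.of_apply, Matrix.of_apply, ← hpre, hF, radField_smul hratio,
    radField_smul hratio, tanField_smul hratio, tanField_smul hratio, ← hF, hpre, hgx, hxb]
  field_simp

/-! ### The blow-up map -/

/-- The radial part of the blow-up map. -/
def blowUpRadius (ρ t : ℝ) : ℝ := min (t / ρ) (max ((3 - 3 * ρ + t) / (3 - 2 * ρ)) t)

/-- The inverse of `blowUpRadius` on `[1, ∞)`, extended continuously by the constant `ρ`. -/
def blowDown (ρ s : ℝ) : ℝ := max ρ (min ((3 - 2 * ρ) * s - (3 - 3 * ρ)) s)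

/-- The derivative of `blowDown` on `(1, ∞)`, except at the kink `3 / 2`. -/
def blowDownSlope (ρ s : ℝ) : ℝ := if s < 3 / 2 then 3 - 2 * ρ else 1

/-- The logarithmic derivative of the radius under `blowDown`: the square root of the ratio of the
tangential to the radial conductivity of the push-forward. -/
def blowDownRatio (ρ s : ℝ) : ℝ := s * blowDownSlope ρ s / blowDown ρ s

section BlowUp

variable {ρ s : ℝ}

theorem continuous_blowUpRadius : Continuous (blowUpRadius ρ) := by
  unfold blowUpRadius
  fun_prop

theorem continuous_blowDown : Continuous (blowDown ρ) := by
  unfold blowDown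
  fun_prop

theorem strictMono_blowUpRadius (hρ : 0 < ρ) (hρ1 : ρ < 1) : StrictMono (blowUpRadius ρ) := by
  have h : 0 < 3 - 2 * ρ := by linarith
  exact fun t t' ht => min_lt_min ((div_lt_div_iff_of_pos_right hρ).2 ht)
    (max_lt_max ((div_lt_div_iff_of_pos_right h).2 (add_lt_add_right ht _)) ht)

theorem blowUpRadius_nonneg (hρ : 0 < ρ) {t : ℝ} (ht : 0 ≤ t) : 0 ≤ blowUpRadius ρ t :=
  le_min (div_nonneg ht hρ.le) (ht.trans (le_max_right _ _))

theorem blowUp_eq_smul (hρ : 0 < ρ) (hρ1 : ρ < 1) (x : Plane) :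
    blowUp ρ x = (blowUpRadius ρ ‖x‖ / ‖x‖) • x := by
  have h : 0 < 3 - 2 * ρ := by linarith
  rcases eq_or_ne x 0 with rfl | hx
  · simp only [blowUp, smul_zero, ite_self]
  have hx0 : ‖x‖ ≠ 0 := norm_ne_zero_iff.2 hx
  rw [blowUp, blowUpRadius]
  split_ifs with h1 h2
  · rw [min_eq_left (le_max_of_le_left _), div_div_cancel_left' hx0]
    rw [div_le_div_iff₀ hρ h]
    nlinarith
  · rw [max_eq_left, min_eq_right, div_eq_mul_inv _ ‖x‖, one_div_mul_eq_div, add_div]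
    · rw [div_le_div_iff₀ h hρ]
      nlinarith
    · rw [le_div_iff₀ h]
      nlinarith
  · rw [max_eq_right, min_eq_right (le_div_self (norm_nonneg x) hρ hρ1.le), div_self hx0, one_smul]
    rw [div_le_iff₀ h]
    nlinarith

theorem blowDown_pos (hρ : 0 < ρ) (s : ℝ) : 0 < blowDown ρ s := hρ.trans_le (le_max_left _ _)

theorem blowDown_eq_min (hρ1 : ρ < 1) (hs : 1 ≤ s) :
    blowDown ρ s = min ((3 - 2 * ρ) * s - (3 - 3 * ρ)) s :=
  max_eq_right (le_min (by nlinarith) (hρ1.le.trans hs))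

theorem blowDown_of_le (hρ1 : ρ < 1) (h1 : 1 ≤ s) (h2 : s ≤ 3 / 2) :
    blowDown ρ s = (3 - 2 * ρ) * s - (3 - 3 * ρ) := by
  rw [blowDown_eq_min hρ1 h1, min_eq_left (by nlinarith)]

theorem blowDown_of_ge (hρ1 : ρ < 1) (h : 3 / 2 ≤ s) : blowDown ρ s = s := by
  rw [blowDown_eq_min hρ1 (by linarith), min_eq_right (by nlinarith)]

theorem blowDown_one (hρ1 : ρ < 1) : blowDown ρ 1 = ρ := by
  rw [blowDown_of_le hρ1 le_rfl (by norm_num)]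
  ring

theorem strictMonoOn_blowDown (hρ1 : ρ < 1) : StrictMonoOn (blowDown ρ) (Ici 1) := by
  intro s hs t ht hst
  rw [blowDown_eq_min hρ1 hs, blowDown_eq_min hρ1 ht]
  exact min_lt_min (by nlinarith) hst

theorem blowUpRadius_blowDown (hρ : 0 < ρ) (hρ1 : ρ < 1) (hs : 1 ≤ s) :
    blowUpRadius ρ (blowDown ρ s) = s := by
  have h : 0 < 3 - 2 * ρ := by linarith
  rcases le_total s (3 / 2) with h2 | h2
  · have haff : (3 - 3 * ρ + ((3 - 2 * ρ) * s - (3 - 3 * ρ))) / (3 - 2 * ρ) = s := by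
      rw [add_sub_cancel, mul_div_cancel_left₀ _ h.ne']
    rw [blowDown_of_le hρ1 hs h2, blowUpRadius, haff, max_eq_left, min_eq_right]
    · rw [le_div_iff₀ hρ]
      nlinarith
    · nlinarith
  · rw [blowDown_of_ge hρ1 h2, blowUpRadius, max_eq_right,
      min_eq_right (le_div_self (by linarith) hρ hρ1.le)]
    rw [div_le_iff₀ h]
    nlinarith

theorem hasDerivAt_blowDown (hρ1 : ρ < 1) (h1 : 1 < s) (h : s ≠ 3 / 2) :
    HasDerivAt (blowDown ρ) (blowDownSlope ρ s) s := by
  rcases lt_or_gt_of_ne h with hlt | hgt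
  · rw [blowDownSlope, if_pos hlt]
    have haff : HasDerivAt (fun s : ℝ => (3 - 2 * ρ) * s - (3 - 3 * ρ)) (3 - 2 * ρ) s := by
      simpa only [mul_one, id] using ((hasDerivAt_id s).const_mul (3 - 2 * ρ)).sub_const (3 - 3 * ρ)
    refine haff.congr_of_eventuallyEq ?_
    filter_upwards [Ioo_mem_nhds h1 hlt] with t ht
    exact blowDown_of_le hρ1 ht.1.le ht.2.le
  · rw [blowDownSlope, if_neg (not_lt.2 hgt.le)]
    refine (hasDerivAt_id s).congr_of_eventuallyEq ?_
    filter_upwards [Ioi_mem_nhds hgt] with t ht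
    exact blowDown_of_ge hρ1 (le_of_lt ht)

theorem one_le_blowDownSlope (hρ1 : ρ < 1) : 1 ≤ blowDownSlope ρ s := by
  unfold blowDownSlope
  split_ifs <;> linarith

theorem hasDerivAt_blowUpRadius (hρ : 0 < ρ) (hρ1 : ρ < 1) (h1 : 1 < s) (h : s ≠ 3 / 2) :
    HasDerivAt (blowUpRadius ρ) (blowDownSlope ρ s)⁻¹ (blowDown ρ s) := by
  have hs : blowUpRadius ρ (blowDown ρ s) = s := blowUpRadius_blowDown hρ hρ1 h1.le
  refine HasDerivAt.of_local_left_inverse continuous_blowUpRadius.continuousAt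
    (by rw [hs]; exact hasDerivAt_blowDown hρ1 h1 h)
    (one_pos.trans_le (one_le_blowDownSlope hρ1)).ne' ?_
  have hev : ∀ᶠ t in 𝓝 (blowDown ρ s), 1 < blowUpRadius ρ t :=
    continuous_blowUpRadius.continuousAt.eventually_const_lt (by rwa [hs])
  filter_upwards [hev] with t ht
  exact (strictMono_blowUpRadius hρ hρ1).injective (blowUpRadius_blowDown hρ hρ1 ht.le)

theorem isEllipticProfile_blowDownRatio (hρ : 0 < ρ) (hρ1 : ρ < 1) :
    IsEllipticProfile 1 2 (blowDownRatio ρ) := by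
  have hid : IsEllipticProfile 1 2 fun s => s :=
    ⟨measurable_id, 1, 2, one_pos, fun s hs => ⟨hs.1.le, hs.2.le⟩⟩
  have hslope : IsEllipticProfile 1 2 (blowDownSlope ρ) := by
    refine ⟨Measurable.ite measurableSet_Iio measurable_const measurable_const, 1, 3, one_pos,
      fun s _ => ⟨one_le_blowDownSlope hρ1, ?_⟩⟩
    unfold blowDownSlope
    split_ifs <;> linarith
  have hdown : IsEllipticProfile 1 2 (blowDown ρ) :=
    ⟨continuous_blowDown.measurable, ρ, 2, hρ, fun s hs =>
      ⟨le_max_left _ _, max_le (by linarith) ((min_le_right _ _).trans hs.2.le)⟩⟩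
  exact (hid.mul hslope).mul hdown.inv

theorem pushForward_blowUp (hρ : 0 < ρ) (hρ1 : ρ < 1) {c : Plane → ℝ} {f : ℝ → ℝ}
    (hc : ∀ x, c x = f ‖x‖) {y : Plane} (hy : 1 < ‖y‖) (hy' : ‖y‖ ≠ 3 / 2) :
    pushForward (blowUp ρ) c y =
      polarTensor (fun s => f (blowDown ρ s) * (blowDownRatio ρ s)⁻¹)
        (fun s => f (blowDown ρ s) * blowDownRatio ρ s) y := by
  have hinv : blowUpRadius ρ (blowDown ρ ‖y‖) = ‖y‖ := blowUpRadius_blowDown hρ hρ1 hy.le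
  refine pushForward_radial (b' := blowDownSlope ρ) (blowUp_eq_smul hρ hρ1)
    (fun t ht => blowUpRadius_nonneg hρ ht) (fun t _ => ⟨fun ht => ?_, fun ht => by rw [ht, hinv]⟩)
    (norm_pos_iff.1 (one_pos.trans hy)) (blowDown_pos hρ _)
    (one_pos.trans_le (one_le_blowDownSlope hρ1)) (hasDerivAt_blowUpRadius hρ hρ1 hy hy') hc
  exact (strictMono_blowUpRadius hρ hρ1).injective (ht.trans hinv.symm)

end BlowUp

/-! ### Multipole expansions -/

theorem abs_le_of_hasSum_mul_pow {a : ℕ → ℝ} (ha : Summable fun k => |a k|) {n : ℕ}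
    (ha0 : ∀ k, k + 1 ≤ n → a k = 0) {x S : ℝ} (hx0 : 0 ≤ x) (hx1 : x ≤ 1)
    (h : HasSum (fun k => a k * x ^ (k + 1)) S) : |S| ≤ x ^ (n + 1) * ∑' k, |a k| := by
  have hterm : ∀ k, ‖a k * x ^ (k + 1)‖ ≤ x ^ (n + 1) * |a k| := fun k => by
    rw [norm_mul, Real.norm_eq_abs, Real.norm_of_nonneg (pow_nonneg hx0 _), mul_comm]
    rcases le_or_gt (k + 1) n with hk | hk
    · simp [ha0 k hk]
    · exact mul_le_mul_of_nonneg_right (pow_le_pow_of_le_one hx0 hx1 hk) (abs_nonneg _)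
  have hsum := tsum_of_norm_bounded (ha.hasSum.mul_left (x ^ (n + 1))) hterm
  rwa [h.tsum_eq, Real.norm_eq_abs] at hsum

theorem eq_zero_of_forall_hasSum_mul_pow {a : ℕ → ℝ} {B : ℝ} {n : ℕ}
    (h : ∀ j : ℕ, HasSum (fun k => a k * ((1 / 2 : ℝ) ^ j) ^ (k + 1)) (B * ((1 / 2 : ℝ) ^ j) ^ n))
    (ha : ∀ k, k + 1 ≤ n → a k = 0) : B = 0 := by
  have hs : Summable fun k => |a k| := by simpa using (h 0).summable.abs
  have hle : ∀ j : ℕ, |B| ≤ (∑' k, |a k|) * (1 / 2 : ℝ) ^ j := fun j => by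
    have hx : (0 : ℝ) < (1 / 2) ^ j := by positivity
    have hB := abs_le_of_hasSum_mul_pow hs ha hx.le
      (pow_le_one₀ (by norm_num) (by norm_num)) (h j)
    rw [abs_mul, abs_of_pos (pow_pos hx n)] at hB
    refine le_of_mul_le_mul_right (hB.trans_eq ?_) (pow_pos hx n)
    ring
  have hlim : Tendsto (fun j : ℕ => (∑' k, |a k|) * (1 / 2 : ℝ) ^ j) atTop (𝓝 0) := by
    simpa using (tendsto_pow_atTop_nhds_zero_of_lt_one (by norm_num : (0 : ℝ) ≤ 1 / 2)
      (by norm_num)).const_mul (∑' k, |a k|)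
  exact abs_nonpos_iff.1 (ge_of_tendsto' hlim hle)

theorem angle_smul {t : ℝ} (ht : 0 < t) (x : Plane) : angle (t • x) = angle x := by
  rw [angle, angle, ← Complex.arg_real_mul ⟨x 0, x 1⟩ ht]
  congr 1
  apply Complex.ext <;> simp

theorem continuousAt_angle {x : Plane} (hx : 0 < x 0) : ContinuousAt angle x := by
  have hC : Continuous fun x : Plane => (⟨x 0, x 1⟩ : ℂ) := by
    simp only [Complex.mk_eq_add_mul_I]
    fun_prop
  exact ContinuousAt.comp (f := fun x : Plane => (⟨x 0, x 1⟩ : ℂ))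
    (Complex.continuousAt_arg (Complex.mem_slitPlane_iff.2 (.inl hx))) hC.continuousAt

theorem ae_smul {Q : Plane → Prop} (h : ∀ᵐ x : Plane, Q x) {t : ℝ} (ht : t ≠ 0) :
    ∀ᵐ x : Plane, Q (t • x) := by
  rw [ae_iff] at h ⊢
  have hpre := Measure.addHaar_preimage_smul (volume : Measure Plane) ht {x | ¬ Q x}
  rwa [h, mul_zero] at hpre

/-- The term of order `k + 1` of the multipole expansion with coefficients `c` and `d`. -/
def multipoleTerm (c d : ℕ → ℝ) (k : ℕ) (x : Plane) : ℝ :=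
  -(Real.cos ((k + 1 : ℕ) * angle x) / (2 * π * (k + 1 : ℕ) * ‖x‖ ^ (k + 1)) * c (k + 1))
    - (Real.sin ((k + 1 : ℕ) * angle x) / (2 * π * (k + 1 : ℕ) * ‖x‖ ^ (k + 1)) * d (k + 1))

theorem multipoleTerm_smul (c d : ℕ → ℝ) (k : ℕ) {t : ℝ} (ht : 0 < t) (x : Plane) :
    multipoleTerm c d k (t • x) = multipoleTerm c d k x * t⁻¹ ^ (k + 1) := by
  simp only [multipoleTerm, angle_smul ht, norm_smul, Real.norm_of_nonneg ht.le, mul_pow, inv_pow]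
  field_simp

theorem HasMultipoleExpansion.exists_hasSum {w : Plane → ℝ} {c d : ℕ → ℝ}
    (h : HasMultipoleExpansion w c d) (n : ℕ) : ∃ x : Plane, 2 < ‖x‖ ∧
      Real.cos (n * angle x) ≠ 0 ∧
      ∀ j : ℕ, HasSum (fun k => multipoleTerm c d k ((2 : ℝ) ^ j • x)) (w ((2 : ℝ) ^ j • x)) := by
  have hae : ∀ᵐ x : Plane, ∀ j : ℕ, 2 < ‖(2 : ℝ) ^ j • x‖ →
      HasSum (fun k => multipoleTerm c d k ((2 : ℝ) ^ j • x)) (w ((2 : ℝ) ^ j • x)) :=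
    ae_all_iff.2 fun j => ae_smul h (by positivity)
  have hcont : ContinuousAt (fun x => Real.cos (n * angle x)) (polarPt 3 0) :=
    Real.continuous_cos.continuousAt.comp
      (continuousAt_const.mul (continuousAt_angle (by simp [polarPt])))
  have hnear : ∀ᶠ x in 𝓝 (polarPt 3 0), 2 < ‖x‖ ∧ Real.cos (n * angle x) ≠ 0 := by
    have hnorm : 2 < ‖polarPt 3 0‖ := by
      rw [norm_polarPt (by norm_num)]
      norm_num
    refine (continuous_norm.continuousAt.eventually (lt_mem_nhds hnorm)).and
      (hcont.eventually_ne ?_)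
    rw [angle_polarPt (by norm_num) ⟨neg_lt_zero.2 Real.pi_pos, Real.pi_pos.le⟩]
    simp
  obtain ⟨x, hx, hx2, hcos⟩ := (Measure.dense_of_ae hae).inter_nhds_nonempty hnear
  refine ⟨x, hx2, hcos, fun j => hx j ?_⟩
  rw [norm_smul, Real.norm_of_nonneg (by positivity)]
  exact hx2.trans_le (le_mul_of_one_le_left (norm_nonneg x) (one_le_pow₀ one_le_two))

theorem HasMultipoleExpansion.eq_zero_of_eq_inv_pow_mul_cos {n : ℕ} {B : ℝ} {w : Plane → ℝ}
    {c d : ℕ → ℝ} (h : HasMultipoleExpansion w c d)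
    (hw : ∀ x : Plane, 2 < ‖x‖ → w x = B * (‖x‖ ^ n)⁻¹ * Real.cos (n * angle x))
    (hcd : ∀ m, 1 ≤ m → m ≤ n → c m = 0 ∧ d m = 0) : B = 0 := by
  obtain ⟨x, hx, hcos, hsum⟩ := h.exists_hasSum n
  have hzero : B * (‖x‖ ^ n)⁻¹ * Real.cos (n * angle x) = 0 := by
    refine eq_zero_of_forall_hasSum_mul_pow (a := fun k => multipoleTerm c d k x) (n := n)
      (fun j => ?_) fun k hk => ?_
    · have hj : (0 : ℝ) < 2 ^ j := by positivity
      have hnorm : ‖(2 : ℝ) ^ j • x‖ = 2 ^ j * ‖x‖ := by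
        rw [norm_smul, Real.norm_of_nonneg hj.le]
      have hlt : 2 < ‖(2 : ℝ) ^ j • x‖ := hnorm ▸
        hx.trans_le (le_mul_of_one_le_left (norm_nonneg x) (one_le_pow₀ one_le_two))
      have hvalue : w ((2 : ℝ) ^ j • x) =
          B * (‖x‖ ^ n)⁻¹ * Real.cos (n * angle x) * (2 ^ j)⁻¹ ^ n := by
        rw [hw _ hlt, hnorm, angle_smul hj, mul_pow, mul_inv, inv_pow]
        ring
      have hj_sum := hsum j
      simp only [multipoleTerm_smul c d _ hj] at hj_sum
      rwa [hvalue, ← inv_pow, ← one_div] at hj_sum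
    · obtain ⟨hc, hd⟩ := hcd (k + 1) (Nat.le_add_left 1 k) hk
      simp [multipoleTerm, hc, hd]
  have hnorm : (‖x‖ ^ n)⁻¹ ≠ 0 := inv_ne_zero (pow_ne_zero _ (two_pos.trans hx).ne')
  simpa [hnorm, hcos] using hzero

/-! ### Separated solutions of the transmission problem -/

theorem exterior_inter_ball (b : ℝ) : exterior ∩ Metric.ball 0 b = annulus 1 b := by
  ext x
  simp [exterior, annulus]

theorem IsTest.exists_tsupport_subset_ball {φ : Plane → ℝ} (hφ : IsTest φ) :
    ∃ b, 1 < b ∧ tsupport φ ⊆ Metric.ball 0 b := by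
  obtain ⟨b, hb⟩ := hφ.compact.isBounded.subset_ball 0
  exact ⟨max b 2, by simp, hb.trans (Metric.ball_subset_ball (le_max_left _ _))⟩

theorem pd_eq_zero_of_tsupport_subset {φ : Plane → ℝ} {U : Set Plane} (h : tsupport φ ⊆ U)
    {x : Plane} (hx : x ∉ U) (i : Fin 2) : pd i φ x = 0 := by
  have hfderiv : fderiv ℝ φ x = 0 :=
    image_eq_zero_of_notMem_tsupport fun hx' => hx (h (tsupport_fderiv_subset ℝ hx'))
  rw [pd, hfderiv, zero_apply]

theorem setIntegral_exterior {b : ℝ} {F : Plane → ℝ}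
    (hF : ∀ x, x ∉ Metric.ball (0 : Plane) b → F x = 0) :
    ∫ x in exterior, F x = ∫ x in annulus 1 b, F x := by
  rw [← exterior_inter_ball]
  exact setIntegral_eq_of_subset_of_forall_sdiff_eq_zero
    (measurableSet_lt measurable_const measurable_norm) inter_subset_left
    fun x hx => hF x fun hxb => hx.2 ⟨hx.1, hxb⟩

theorem setIntegral_smul_re {U : Set Plane} {B : Plane → ℝ} {F : Plane → ℂ}
    (h : IntegrableOn (fun x => (B x : ℂ) * F x) U) :
    ∫ x in U, B x • (F x).re = (∫ x in U, (B x : ℂ) * F x).re := by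
  simpa using Complex.reCLM.integral_comp_comm h

section Transmission

variable {c w p : ℝ → ℝ} {k : ℤ}

theorem IsRadialMode.memLp_fun {a b : ℝ} {η τ : ℝ → ℝ} (h : IsRadialMode a b k η τ w p) :
    MemLp (modeFun k w) 2 (volume.restrict (annulus a b)) :=
  memLp_modeFun k (.of_continuous h.continuous_fun) 2

theorem IsRadialMode.memLp_field {a b : ℝ} {η τ : ℝ → ℝ} (h : IsRadialMode a b k η τ w p)
    (hη : IsEllipticProfile a b η) :
    MemLp (polarVector (modeFun k (slope η p)) (modeTan k w)) 2
      (volume.restrict (annulus a b)) :=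
  memLp_polarVector (memLp_modeFun k (h.isBddProfile_slope hη) 2)
    (memLp_modeTan k h.isBddProfile_fun 2)

theorem hasWeakGradOn_exterior (hc : ∀ b, IsEllipticProfile 1 b c)
    (hm : ∀ b, 1 < b → IsRadialMode 1 b k c c w p) :
    HasWeakGradOn exterior (fun x => (modeFun k w x).re)
      fun x i => (polarVector (modeFun k (slope c p)) (modeTan k w) x i).re := by
  intro φ hφ hsupp i
  obtain ⟨b, hb, hbs⟩ := hφ.exists_tsupport_subset_ball
  have hφ1 := hφ.contDiff_one
  have hpd := memLp_top_annulus_of_continuous (a := 1) (b := b)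
    (Complex.continuous_ofReal.comp (continuous_pd hφ1 i))
  have hφm := memLp_top_annulus_of_continuous (a := 1) (b := b)
    (Complex.continuous_ofReal.comp hφ1.continuous)
  have hfun := ((hm b hb).memLp_fun.mul' (r := 2) hpd).integrable one_le_two
  have hgrad := ((memLp_pi_iff.1 ((hm b hb).memLp_field (hc b)) i).mul' (r := 2) hφm).integrable
    one_le_two
  have hinner : ∀ θ, φ (polarPt 1 θ) = 0 := fun θ =>
    apply_eq_zero_of_tsupport_subset hsupp (by simp [exterior, norm_polarPt zero_le_one])
  have houter : ∀ θ, φ (polarPt b θ) = 0 := fun θ =>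
    apply_eq_zero_of_tsupport_subset hbs (by simp [norm_polarPt (zero_le_one.trans hb.le)])
  have hgreen := (hm b hb).integral_green (hc b) zero_le_one hb.le hφ1 i
  simp only [hinner, houter, Complex.ofReal_zero, mul_zero, sub_zero, zero_mul,
    integral_zero] at hgreen
  rw [setIntegral_exterior (b := b)
      fun x hx => by rw [pd_eq_zero_of_tsupport_subset hbs hx, zero_smul],
    setIntegral_exterior (b := b)
      fun x hx => by rw [apply_eq_zero_of_tsupport_subset hbs hx, zero_smul],
    setIntegral_smul_re hfun, setIntegral_smul_re hgrad, ← Complex.neg_re]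
  exact congrArg Complex.re
    (eq_neg_of_add_eq_zero_left ((integral_add hfun hgrad).symm.trans hgreen))

theorem fluxForm_exterior_eq_zero (hc : ∀ b, IsEllipticProfile 1 b c)
    (hm : ∀ b, 1 < b → IsRadialMode 1 b k c c w p) {s : Plane → ℝ} (hs : ∀ x, s x = c ‖x‖)
    {φ : Plane → ℝ} (hφ : IsTest φ) :
    fluxForm (isotropic s) exterior
      (fun x i => (polarVector (modeFun k (slope c p)) (modeTan k w) x i).re) φ = 0 := by
  obtain ⟨b, hb, hbs⟩ := hφ.exists_tsupport_subset_ball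
  have hφ1 := hφ.contDiff_one
  have houter : ∀ θ, φ (polarPt b θ) = 0 := fun θ =>
    apply_eq_zero_of_tsupport_subset hbs (by simp [norm_polarPt (zero_le_one.trans hb.le)])
  have hflux := (hm b hb).integral_flux (hc b) (hc b) zero_le_one hb.le hφ1
  simp only [houter, Complex.ofReal_zero, mul_zero, zero_mul, integral_zero] at hflux
  have hx0 : ∀ x ∈ annulus 1 b, x ≠ 0 := fun x hx => norm_pos_iff.1 (one_pos.trans hx.1)
  have hcoeff : ∀ {V : Fin 2 → Plane → ℝ},
      (∀ i, MemLp (fun x => (V i x : ℂ)) ∞ (volume.restrict (annulus 1 b))) → _ :=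
    memLp_top_mul_sum_pd (hc b).isBddProfile hφ1
  have hint : IntegrableOn (fun x => ∑ i, ∑ j, (polarTensor c c x i j * pd i φ x : ℂ) *
      polarVector (modeFun k (slope c p)) (modeTan k w) x j) (annulus 1 b) := by
    have hrad := ((memLp_modeFun k ((hm b hb).isBddProfile_slope (hc b)) 2).mul' (r := 2)
      (hcoeff fun i => memLp_top_radField i _)).integrable one_le_two
    have htan := ((memLp_modeTan k (hm b hb).isBddProfile_fun 2).mul' (r := 2)
      (hcoeff fun i => memLp_top_tanField i _)).integrable one_le_two
    exact (hrad.add htan).congr (ae_restrict_of_forall_mem (measurableSet_annulus 1 b)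
      fun x hx => (sum_polarTensor_mul c c _ _ _ (hx0 x hx)).symm)
  rw [fluxForm, setIntegral_exterior (b := b)
    fun x hx => by simp [pd_eq_zero_of_tsupport_subset hbs hx]]
  refine Eq.trans (setIntegral_congr_fun (measurableSet_annulus 1 b) fun x hx => ?_)
    ((Complex.reCLM.integral_comp_comm hint).trans (congrArg Complex.re hflux))
  simp only [isotropic_eq_polarTensor (hs x) (hx0 x hx), map_sum, Complex.reCLM_apply,
    smul_eq_mul, ← Complex.ofReal_mul, Complex.re_ofReal_mul]

theorem isTransmissionSolution_of_isRadialMode (hc : ∀ b, IsEllipticProfile 1 b c)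
    (hm : ∀ b, 1 < b → IsRadialMode 1 b k c c w p) {s : Plane → ℝ} (hs : ∀ x, s x = c ‖x‖)
    {H : Plane → ℝ}
    (hH : ∃ C R : ℝ, ∀ᵐ x : Plane, R < ‖x‖ → |(modeFun k w x).re - H x| ≤ C * ‖x‖⁻¹) :
    IsTransmissionSolution s H fun x => (modeFun k w x).re := by
  refine ⟨⟨_, fun b => ?_, hasWeakGradOn_exterior hc hm,
    fun φ hφ => fluxForm_exterior_eq_zero hc hm hs hφ⟩, hH⟩
  have hm' := hm (max b 2) (one_lt_two.trans_le (le_max_right b 2))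
  have hle : volume.restrict (exterior ∩ Metric.ball 0 b) ≤
      volume.restrict (annulus 1 (max b 2)) := by
    rw [← exterior_inter_ball]
    exact Measure.restrict_mono
      (inter_subset_inter_right _ (Metric.ball_subset_ball (le_max_left b 2))) le_rfl
  exact ⟨(hm'.memLp_fun.mono_measure hle).re, memLp_pi_iff.2 fun i =>
    (memLp_pi_iff.1 ((hm'.memLp_field (hc _)).mono_measure hle) i).re⟩

end Transmission

/-! ### Vanishing generalized polarization tensors -/

theorem re_modeFun (n : ℕ) (w : ℝ → ℝ) (x : Plane) :
    (modeFun n w x).re = w ‖x‖ * Real.cos (n * angle x) := by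
  rw [modeFun, Complex.re_ofReal_mul, expAngle]
  congr 1
  simpa only [Complex.ofReal_mul, Complex.ofReal_natCast, Int.cast_natCast] using
    Complex.exp_ofReal_mul_I_re (n * angle x)

theorem re_modeFun_sub_harmCos {n : ℕ} {w : ℝ → ℝ} {B : ℝ} {x : Plane}
    (hw : w ‖x‖ = ‖x‖ ^ n + B * (‖x‖ ^ n)⁻¹) :
    (modeFun n w x).re - harmCos n x = B * (‖x‖ ^ n)⁻¹ * Real.cos (n * angle x) := by
  rw [re_modeFun, hw, harmCos]
  ring

theorem abs_inv_pow_mul_cos_le {n : ℕ} (hn : n ≠ 0) (B θ : ℝ) {s : ℝ} (hs : 1 ≤ s) :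
    |B * (s ^ n)⁻¹ * Real.cos θ| ≤ |B| * s⁻¹ := by
  have hs0 : 0 < s := one_pos.trans_le hs
  rw [abs_mul, abs_mul, abs_of_pos (inv_pos.2 (pow_pos hs0 n))]
  calc |B| * (s ^ n)⁻¹ * |Real.cos θ| ≤ |B| * (s ^ n)⁻¹ :=
        mul_le_of_le_one_right (by positivity) (Real.abs_cos_le_one θ)
    _ ≤ |B| * s⁻¹ :=
        mul_le_mul_of_nonneg_left (inv_anti₀ hs0 (le_self_pow₀ hs hn)) (abs_nonneg B)

theorem layerFun_log {n : ℕ} {v p s : ℝ} (hs : 0 < s) :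
    layerFun n 1 v p (Real.log 2) (Real.log s) =
      ((v + p / n) * (s ^ n / 2 ^ n) + (v - p / n) * (2 ^ n / s ^ n)) / 2 := by
  have hexp : Real.exp (n * (Real.log s - Real.log 2)) = s ^ n / 2 ^ n := by
    rw [← Real.log_div hs.ne' two_ne_zero, Real.exp_nat_mul, Real.exp_log (div_pos hs two_pos),
      div_pow]
  rw [layerFun, Real.cosh_eq, Real.sinh_eq, Real.exp_neg, hexp, inv_div, mul_one]
  ring

/-- The radial coordinate `log s`, extended by `0` to `s ≤ 1`. -/
def logRadius (s : ℝ) : ℝ := Real.log (max s 1)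

theorem logRadius_of_one_le {s : ℝ} (hs : 1 ≤ s) : logRadius s = Real.log s := by
  rw [logRadius, max_eq_left hs]

theorem continuous_logRadius : Continuous logRadius :=
  (continuous_id.max continuous_const).log fun _ => (lt_max_of_lt_right one_pos).ne'

theorem hasDerivAt_logRadius {s : ℝ} (hs : 1 < s) : HasDerivAt logRadius s⁻¹ s :=
  (Real.hasDerivAt_log (one_pos.trans hs).ne').congr_of_eventuallyEq <|
    (eventually_gt_nhds hs).mono fun _ ht => logRadius_of_one_le (le_of_lt ht)

theorem strictMonoOn_logRadius : StrictMonoOn logRadius (Ici 1) := fun _ hs _ ht hst => by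
  rw [logRadius_of_one_le hs, logRadius_of_one_le ht]
  exact Real.log_lt_log (one_pos.trans_le hs) hst

theorem IsLogMode.isRadialMode_logRadius {n κ b : ℝ} {c V P : ℝ → ℝ} (hb : 1 ≤ b)
    (hc : ∀ s ∈ Ioo 1 b, 0 < c s)
    (hV : IsLogMode n (fun τ => c (Real.exp τ)) (logRadius b) V P) (hκ : κ ^ 2 = n ^ 2) :
    IsRadialMode 1 b κ c c (fun s => V (logRadius s)) fun s => P (logRadius s) := by
  have hexp : ∀ s ∈ Ioo 1 b, Real.exp (logRadius s) = s := fun s hs => by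
    rw [logRadius_of_one_le hs.1.le, Real.exp_log (one_pos.trans hs.1)]
  refine hV.isRadialMode one_pos hb hc hc hκ continuous_logRadius (by simp [logRadius])
    (strictMonoOn_logRadius.mono Icc_subset_Ici_self) (fun s hs => ?_) countable_empty
    fun s hs => (hasDerivAt_logRadius hs.1.1).congr_deriv ?_
  · rw [hexp s hs, pow_two]
  · rw [hexp s hs.1, div_mul_cancel_left₀ (hc s hs.1).ne']

section CoatedDisk

variable {L : ℕ} {r σ : ℕ → ℝ} {S : ℝ} {n : ℕ} {V P : ℝ → ℝ}

theorem IsCoatedDisk.isTransmissionSolution (h : IsCoatedDisk L r σ) (hn : n ≠ 0)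
    (hV : IsCoatedMode (fun τ => layeredProfile L r σ (Real.exp τ)) S n V P) {B q : ℝ}
    (hw : ∀ s, 2 < s → V (logRadius s) * q = s ^ n + B * (s ^ n)⁻¹) :
    IsTransmissionSolution (layered L r σ) (harmCos n)
      fun x => (modeFun n (fun s => V (logRadius s) * q) x).re := by
  have hc : ∀ b, IsEllipticProfile 1 b (layeredProfile L r σ) := fun b =>
    h.isEllipticProfile_comp measurable_id fun s hs => hs.1
  refine isTransmissionSolution_of_isRadialMode hc (fun b hb =>
    ((hV.isLogMode _).isRadialMode_logRadius hb.le (fun s hs => (hc b).pos hs)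
      (by simp)).mul_const q) layered_eq_layeredProfile ⟨|B|, 2, .of_forall fun x hx => ?_⟩
  rw [re_modeFun_sub_harmCos (hw _ hx)]
  exact abs_inv_pow_mul_cos_le hn B _ (one_lt_two.trans hx).le

/-- In the background the mode is a multiple of `rⁿ + B r⁻ⁿ`, where `B` vanishes exactly if the flux
at `r = 2` is that of `rⁿ`; and `B` is, up to a nonzero factor, the diagonal polarization tensor
`M^{cc}_{nn}`. -/
theorem IsCoatedDisk.flux_eq_of_isGPTVanishing (h : IsCoatedDisk L r σ) {N : ℕ}
    (hN : IsGPTVanishing N (layered L r σ)) (hn : 1 ≤ n) (hnN : n ≤ N)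
    (hV : IsCoatedMode (fun τ => layeredProfile L r σ (Real.exp τ)) S n V P) :
    P (Real.log 2) = n * V (Real.log 2) := by
  obtain ⟨Mcc, Mcs, Msc, Mss, hM, hM0⟩ := hN
  set v := V (Real.log 2)
  set p := P (Real.log 2)
  have hlayer : ∀ τ, Real.log 2 < τ → V τ = layerFun n 1 v p (Real.log 2) τ := hV.fun_eq
  have hn0 : (0 : ℝ) < n := Nat.cast_pos.2 hn
  have hvp : 0 < v + p / n :=
    add_pos_of_pos_of_nonneg hV.fun_log_two_pos (div_nonneg hV.flux_log_two_nonneg hn0.le)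
  have hw : ∀ s, 2 < s → V (logRadius s) * (2 * 2 ^ n / (v + p / n)) =
      s ^ n + (v - p / n) / (v + p / n) * (2 ^ n) ^ 2 * (s ^ n)⁻¹ := fun s hs => by
    have hs0 : 0 < s := two_pos.trans hs
    rw [logRadius_of_one_le (one_lt_two.trans hs).le, hlayer _ (Real.log_lt_log two_pos hs),
      layerFun_log hs0]
    generalize p / (n : ℝ) = t at hvp ⊢
    field_simp [hvp.ne']
  have hexp := hM.cos_expansion n hn _ (h.isTransmissionSolution (by omega) hV hw)
  have hB : (v - p / n) / (v + p / n) * (2 ^ n) ^ 2 = 0 := by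
    refine hexp.eq_zero_of_eq_inv_pow_mul_cos (fun x hx => re_modeFun_sub_harmCos (hw _ hx))
      fun m hm hmn => ?_
    obtain ⟨hcc, -, hsc, -⟩ := hM0 m n hm (hmn.trans hnN) hn hnN
    exact ⟨hcc, hsc⟩
  have hvp0 : v - p / n = 0 := by simpa [hvp.ne'] using hB
  rw [sub_eq_zero.1 hvp0, mul_div_cancel₀ p hn0.ne']

end CoatedDisk

/-! ### The near-cloaking estimate -/

theorem exists_isDtN_homogeneous :
    ∃ Λ, IsMultiplier (fun k => |(k : ℝ)|) Λ ∧ IsDtN (isotropic fun _ => 1) ∅ Λ := by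
  have hone : IsEllipticProfile 0 2 fun _ => 1 :=
    ⟨measurable_const, 1, 1, one_pos, fun _ _ => ⟨le_rfl, le_rfl⟩⟩
  obtain ⟨Λ, hΛ⟩ := exists_isMultiplier (l := fun k => |(k : ℝ)|) (M := 1) fun k => by
    simpa using abs_le_sqrt_one_add_sq (k : ℝ)
  have hx0 : ∀ᵐ x : Plane, x ≠ 0 := by simp [ae_iff]
  refine ⟨Λ, hΛ, isDtN_of_flux_le (Q := 1) le_rfl zero_le_two hone hone ?_
    (.of_forall fun x hx => isotropic_eq_polarTensor (c := fun _ => 1) rfl (norm_pos_iff.1 hx.1))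
    (.inl rfl) isRadialMode_disk (fun k => by simp) (fun s => by simp) zero_le_one
    (fun k => by simp) (by simpa using hΛ)⟩
  rw [sdiff_empty, eventuallyEq_set]
  filter_upwards [hx0] with x hx
  simp [annulus, hx]

/-- The logarithm of the radius that the blow-up moves to `s`, in units of `ρ`: a radial coordinate
in which the near-cloak looks like the coated disk in the coordinate `log s`. -/
def cloakLog (ρ s : ℝ) : ℝ := Real.log (blowDown ρ s / ρ)

section CloakLog

variable {ρ : ℝ}

theorem continuous_cloakLog (hρ : 0 < ρ) : Continuous (cloakLog ρ) :=
  (continuous_blowDown.div_const ρ).log fun s => (div_pos (blowDown_pos hρ s) hρ).ne'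

theorem exp_cloakLog (hρ : 0 < ρ) (s : ℝ) : Real.exp (cloakLog ρ s) = blowDown ρ s / ρ :=
  Real.exp_log (div_pos (blowDown_pos hρ s) hρ)

theorem cloakLog_one (hρ : 0 < ρ) (hρ1 : ρ < 1) : cloakLog ρ 1 = 0 := by
  rw [cloakLog, blowDown_one hρ1, div_self hρ.ne', Real.log_one]

theorem cloakLog_two (hρ1 : ρ < 1) : cloakLog ρ 2 = Real.log (2 / ρ) := by
  rw [cloakLog, blowDown_of_ge hρ1 (by norm_num)]

theorem strictMonoOn_cloakLog (hρ : 0 < ρ) (hρ1 : ρ < 1) : StrictMonoOn (cloakLog ρ) (Ici 1) :=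
  fun s hs _ ht hst => Real.log_lt_log (div_pos (blowDown_pos hρ s) hρ) <|
    div_lt_div_of_pos_right (strictMonoOn_blowDown hρ1 hs ht hst) hρ

theorem hasDerivAt_cloakLog (hρ : 0 < ρ) (hρ1 : ρ < 1) {s : ℝ} (h1 : 1 < s) (h : s ≠ 3 / 2) :
    HasDerivAt (cloakLog ρ) (blowDownRatio ρ s / s) s := by
  have hs0 : s ≠ 0 := (one_pos.trans h1).ne'
  have hbd : blowDown ρ s ≠ 0 := (blowDown_pos hρ s).ne'
  refine (((hasDerivAt_blowDown hρ1 h1 h).div_const ρ).log (div_ne_zero hbd hρ.ne')).congr_deriv ?_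
  rw [blowDownRatio]
  field_simp

theorem one_lt_blowDown_div (hρ : 0 < ρ) (hρ1 : ρ < 1) {s : ℝ} (hs : 1 < s) :
    1 < blowDown ρ s / ρ := by
  rw [one_lt_div hρ]
  simpa only [blowDown_one hρ1] using strictMonoOn_blowDown hρ1 self_mem_Ici hs.le hs

end CloakLog

/-- The `k`-th Fourier multiplier of the Dirichlet-to-Neumann map on the circle with logarithmic
radius `T`, for a conductivity whose separated solution of degree `n` is `V n`, with flux `P n`. -/
def dtnSymbol (V P : ℕ → ℝ → ℝ) (T : ℝ) (k : ℤ) : ℝ := P k.natAbs T / V k.natAbs T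

section CoatedDisk

variable {L N : ℕ} {r σ : ℕ → ℝ} {ρ S : ℝ} {V P : ℕ → ℝ → ℝ}

theorem log_two_lt_log_two_div (hρ : 0 < ρ) (hρ1 : ρ < 1) : Real.log 2 < Real.log (2 / ρ) :=
  Real.log_lt_log two_pos ((lt_div_iff₀ hρ).2 (mul_lt_of_lt_one_right two_pos hρ1))

theorem IsCoatedDisk.isEllipticProfile_blowDown_div (h : IsCoatedDisk L r σ) (hρ : 0 < ρ)
    (hρ1 : ρ < 1) : IsEllipticProfile 1 2 fun s => layeredProfile L r σ (blowDown ρ s / ρ) :=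
  h.isEllipticProfile_comp (continuous_blowDown.measurable.div_const ρ)
    fun _ hs => one_lt_blowDown_div hρ hρ1 hs.1

theorem IsCoatedDisk.isRadialMode_cloak (h : IsCoatedDisk L r σ) (hρ : 0 < ρ) (hρ1 : ρ < 1)
    {n κ : ℝ} {v p : ℝ → ℝ} (hκ : κ ^ 2 = n ^ 2)
    (hv : IsLogMode n (fun τ => layeredProfile L r σ (Real.exp τ)) (cloakLog ρ 2) v p) :
    IsRadialMode 1 2 κ
      (fun s => layeredProfile L r σ (blowDown ρ s / ρ) * (blowDownRatio ρ s)⁻¹)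
      (fun s => layeredProfile L r σ (blowDown ρ s / ρ) * blowDownRatio ρ s)
      (fun s => v (cloakLog ρ s)) fun s => p (cloakLog ρ s) := by
  have hf : ∀ s ∈ Ioo 1 2, 0 < layeredProfile L r σ (blowDown ρ s / ρ) := fun s =>
    (h.isEllipticProfile_blowDown_div hρ hρ1).pos
  have hq : ∀ s ∈ Ioo 1 2, 0 < blowDownRatio ρ s := fun s =>
    (isEllipticProfile_blowDownRatio hρ hρ1).pos
  refine hv.isRadialMode one_pos one_le_two (fun s hs => mul_pos (hf s hs) (inv_pos.2 (hq s hs)))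
    (fun s hs => mul_pos (hf s hs) (hq s hs)) hκ (continuous_cloakLog hρ) (cloakLog_one hρ hρ1)
    ((strictMonoOn_cloakLog hρ hρ1).mono Icc_subset_Ici_self) (fun s hs => ?_)
    (countable_singleton (3 / 2)) fun s hs =>
      (hasDerivAt_cloakLog hρ hρ1 hs.1.1 hs.2).congr_deriv ?_
  · have := (hq s hs).ne'
    rw [exp_cloakLog hρ]
    field_simp
  · have := (hq s hs.1).ne'
    have := (hf s hs.1).ne'
    rw [exp_cloakLog hρ]
    field_simp

theorem IsCoatedDisk.isDtN_cloak (h : IsCoatedDisk L r σ) (hρ : 0 < ρ) (hρ1 : ρ < 1)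
    (hV : ∀ n, IsCoatedMode (fun τ => layeredProfile L r σ (Real.exp τ)) S n (V n) (P n)) {Q : ℝ}
    (hQ0 : 0 ≤ Q) (hQ : ∀ k : ℤ, dtnSymbol V P (Real.log (2 / ρ)) k ≤ Q * |(k : ℝ)|)
    {Λ : HHalf →L[ℂ] HMinusHalf} (hΛ : IsMultiplier (dtnSymbol V P (Real.log (2 / ρ))) Λ) :
    IsDtN (pushForward (blowUp ρ) (layered L r σ ∘ dilation (1 / ρ)))
      (Metric.closedBall 0 1) Λ := by
  have hV2 : ∀ n, 0 < V n (cloakLog ρ 2) := fun n => by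
    rw [cloakLog_two hρ1]
    exact (hV n).fun_pos (log_two_lt_log_two_div hρ hρ1)
  have hf := h.isEllipticProfile_blowDown_div hρ hρ1
  have hq := isEllipticProfile_blowDownRatio hρ hρ1
  have hp2 : ∀ k : ℤ, P k.natAbs (cloakLog ρ 2) * (V k.natAbs (cloakLog ρ 2))⁻¹ =
      dtnSymbol V P (Real.log (2 / ρ)) k := fun k => by
    rw [cloakLog_two hρ1, dtnSymbol, ← div_eq_mul_inv]
  have hannulus : (Metric.ball 0 2 \ Metric.closedBall 0 1 : Set Plane) = annulus 1 2 := by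
    ext x
    simp [annulus, and_comm]
  have hsphere : ∀ᵐ x : Plane, x ∉ Metric.sphere (0 : Plane) (3 / 2) :=
    measure_eq_zero_iff_ae_notMem.1 (Measure.addHaar_sphere _ _ _)
  refine isDtN_of_flux_le zero_le_one one_le_two (hf.mul hq.inv) (hf.mul hq) hannulus.eventuallyEq
    ?_ (.inr fun θ => by simp [norm_polarPt zero_le_one]) (fun k => (h.isRadialMode_cloak hρ hρ1
      (by rw [← abs_intCast_eq_natAbs, sq_abs]) ((hV k.natAbs).isLogMode _)).mul_const
        (V k.natAbs (cloakLog ρ 2))⁻¹)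
    (fun k => mul_inv_cancel₀ (hV2 _).ne') (fun s => by simp [(hV 0).fun_eq_one rfl]) hQ0
    (fun k => (hp2 k).trans_le (hQ k)) (by simpa only [hp2] using hΛ)
  filter_upwards [hsphere] with y hy32 hy
  refine pushForward_blowUp (f := fun t => layeredProfile L r σ (t / ρ)) hρ hρ1 (fun x => ?_) hy.1
    (by simpa using hy32)
  rw [Function.comp_apply, dilation, layered_eq_layeredProfile, norm_smul,
    Real.norm_of_nonneg (one_div_pos.2 hρ).le, one_div_mul_eq_div]

theorem IsCoatedDisk.exists_isDtN_cloak (h : IsCoatedDisk L r σ) (hρ : 0 < ρ) (hρ1 : ρ < 1)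
    (hV : ∀ n, IsCoatedMode (fun τ => layeredProfile L r σ (Real.exp τ)) S n (V n) (P n)) {M : ℝ}
    (hM0 : 0 ≤ M)
    (hM : ∀ k : ℤ, |(dtnSymbol V P (Real.log (2 / ρ)) k - |(k : ℝ)|)| ≤ M * |(k : ℝ)|) :
    ∃ Λ, IsMultiplier (dtnSymbol V P (Real.log (2 / ρ))) Λ ∧
      IsDtN (pushForward (blowUp ρ) (layered L r σ ∘ dilation (1 / ρ)))
        (Metric.closedBall 0 1) Λ := by
  have hQ : ∀ k : ℤ, |dtnSymbol V P (Real.log (2 / ρ)) k| ≤ (M + 1) * |(k : ℝ)| := fun k => by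
    have htri := abs_sub_abs_le_abs_sub (dtnSymbol V P (Real.log (2 / ρ)) k) |(k : ℝ)|
    rw [abs_abs] at htri
    linarith [hM k]
  have hQ0 : 0 ≤ M + 1 := by positivity
  obtain ⟨Λ, hΛ⟩ := exists_isMultiplier fun k => (hQ k).trans
    (mul_le_mul_of_nonneg_left (abs_le_sqrt_one_add_sq _) hQ0)
  exact ⟨Λ, hΛ, h.isDtN_cloak hρ hρ1 hV hQ0 (fun k => (le_abs_self _).trans (hQ k)) hΛ⟩

theorem exp_neg_mul_log_two_div_sub_sq (hρ : 0 < ρ) (n : ℕ) :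
    Real.exp (-(n * (Real.log (2 / ρ) - Real.log 2))) ^ 2 = ρ ^ (2 * n) := by
  rw [Real.log_div two_ne_zero hρ.ne', sub_sub_cancel_left, mul_neg, neg_neg, Real.exp_nat_mul,
    Real.exp_log hρ, ← pow_mul, mul_comm]

/-- The orders `n ≤ N` do not contribute: their flux is that of the homogeneous disk. -/
theorem IsCoatedDisk.abs_dtnSymbol_sub_le (h : IsCoatedDisk L r σ)
    (hN : IsGPTVanishing N (layered L r σ)) (hS : 0 ≤ S)
    (hV : ∀ n, IsCoatedMode (fun τ => layeredProfile L r σ (Real.exp τ)) S n (V n) (P n))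
    (hρ : 0 < ρ) (hρ1 : ρ < 1) (k : ℤ) :
    |(dtnSymbol V P (Real.log (2 / ρ)) k - |(k : ℝ)|)| ≤
      2 * (1 + S) * ρ ^ (2 * N + 2) * |(k : ℝ)| := by
  set n := k.natAbs
  have hdev := (hV n).abs_flux_sub_div_le
  have hbound := (hV n).abs_flux_div_fun_sub_le (log_two_lt_log_two_div hρ hρ1)
  rw [exp_neg_mul_log_two_div_sub_sq hρ] at hbound
  rw [abs_intCast_eq_natAbs, dtnSymbol]
  refine hbound.trans ?_
  rcases lt_or_ge N n with hn | hn
  · have hpow : ρ ^ (2 * n) ≤ ρ ^ (2 * N + 2) := pow_le_pow_of_le_one hρ.le hρ1.le (by omega)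
    calc 2 * (|P n (Real.log 2) - n * V n (Real.log 2)| / V n (Real.log 2)) * ρ ^ (2 * n)
        ≤ 2 * ((1 + S) * n) * ρ ^ (2 * N + 2) := by gcongr
      _ = 2 * (1 + S) * ρ ^ (2 * N + 2) * n := by ring
  · have hzero : |P n (Real.log 2) - n * V n (Real.log 2)| / V n (Real.log 2) ≤ 0 := by
      rcases Nat.eq_zero_or_pos n with hn0 | hn0
      · simpa [hn0] using hdev
      · rw [h.flux_eq_of_isGPTVanishing hN hn0 hn (hV n), sub_self, abs_zero, zero_div]
    calc 2 * (|P n (Real.log 2) - n * V n (Real.log 2)| / V n (Real.log 2)) * ρ ^ (2 * n)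
        ≤ 0 := mul_nonpos_of_nonpos_of_nonneg (by linarith) (by positivity)
      _ ≤ 2 * (1 + S) * ρ ^ (2 * N + 2) * n := by positivity

end CoatedDisk

end

end NearCloaking

theorem mainTheorem3 (L N : ℕ) (r σ : ℕ → ℝ)
    (hσ : NearCloaking.IsCoatedDisk L r σ)
    (hGPT : NearCloaking.IsGPTVanishing N (NearCloaking.layered L r σ)) :
    ∃ C : ℝ, ∀ ρ : ℝ, 0 < ρ → ρ < 1 →
      ∃ Λρ Λ₁ : NearCloaking.HHalf →L[ℂ] NearCloaking.HMinusHalf,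
        NearCloaking.IsDtN
          (NearCloaking.pushForward (NearCloaking.blowUp ρ)
            (NearCloaking.layered L r σ ∘ NearCloaking.dilation (1 / ρ)))
          (Metric.closedBall 0 1) Λρ ∧
        NearCloaking.IsDtN (NearCloaking.isotropic fun _ => 1) ∅ Λ₁ ∧
        ‖Λρ - Λ₁‖ ≤ C * ρ ^ (2 * N + 2) := by
  obtain ⟨m, S, hm, hS⟩ := hσ.exists_conductivity_bounds
  have hS0 : 0 ≤ S := hm.le.trans ((hS 0 L.zero_le).1.trans (hS 0 L.zero_le).2)
  choose V P hV using hσ.exists_isCoatedMode fun j hj => (hS j hj).2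
  obtain ⟨Λ₁, hΛ₁, hDtN₁⟩ := NearCloaking.exists_isDtN_homogeneous
  refine ⟨2 * Real.pi * (2 * (1 + S)), fun ρ hρ hρ1 => ?_⟩
  have hsymbol := hσ.abs_dtnSymbol_sub_le hGPT hS0 hV hρ hρ1
  have hM0 : 0 ≤ 2 * (1 + S) * ρ ^ (2 * N + 2) := by positivity
  obtain ⟨Λρ, hΛρ, hDtNρ⟩ := hσ.exists_isDtN_cloak hρ hρ1 hV hM0 hsymbol
  refine ⟨Λρ, Λ₁, hDtNρ, hDtN₁, (hΛρ.norm_sub_le hΛ₁ fun k => (hsymbol k).trans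
    (mul_le_mul_of_nonneg_left (NearCloaking.abs_le_sqrt_one_add_sq _) hM0)).trans_eq ?_⟩
  ring
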